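/- A \emph{tree instance} $(G,T,c)$ consists of a tree $G=(V,E)$ with $n\ge 1$ vertices, an arbitrary set $T\subseteq V$ of terminals, and a positive integer capacity $c(e)$ for every edge $e\in E$. For $X\subseteq V$ let $E(X)$ be the set of edges with exactly one end-vertex in $X$, and for $h:E\to\mathbb Z_{\ge 0}$ put $h(X)=\sum_{e\in E(X)}h(e)$. An \emph{integral multiterminal flow} is a function $f:E\to\mathbb Z_{\ge0}$ for which there are nonnegative integers $g(P)$, one for every path $P$ of $G$ joining two distinct terminals, such that $f(e)=\sum_{P\ni e}g(P)$ for all $e\in E$. It is \emph{feasible} if $f(e)\le c(e)$ for all $e\in E$, and its value is $\alpha(f)=\frac12\sum_{t\in T}f(\{t\})$; a feasible integral multiterminal flow is \emph{maximum} if no other one has a larger value. A \emph{cut-system} is a family $\mathcal X=(X_t)_{t\in T}$ of pairwise disjoint vertex sets such that every $X_t$ induces a connected subgraph of $G$ and $X_t\cap T=\{t\}$ (the $X_t$ need not cover $V$). Put $\gamma(\mathcal X)=\sum_{t\in T}c(X_t)$, and let $\kappa(\mathcal X)$ be the number of connected components $W$ of $G-\bigcup_{t\in T}X_t$ for which $c(W)$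 is odd. A cut-system is \emph{minimum} if it minimizes $\frac12(\gamma(\mathcal X)-\kappa(\mathcal X))$ over all cut-systems. \textbf{Theorem.} There is an algorithm that, given any tree instance $(G,T,c)$ with $n$ vertices, finds in $O(n)$ time and $O(n)$ space a feasible integral multiterminal flow $f$ and a cut-system $\mathcal X$ with $$\alpha(f)=\tfrac12\bigl(\gamma(\mathcal X)-\kappa(\mathcal X)\bigr),$$ and such that $f$ is a maximum feasible integral multiterminal flow and $\mathcal X$ is a minimum cut-system. Here the algorithm is a fixed program for a random access machine whose unit-time operations are reading, writing (with indirect addressing), comparison, addition, subtraction and halving of nonnegative integers. Its input is $n$, the list of edges (in any order) with their end-vertices and capacities, and the characteristic vector of $T$; its output consists of the numbers $f(e)$, $e\in E$, and, for every vertex $v$, the terminal $t$ with $v\in X_t$, or the information that there is none. All numbers that occur in the computation have $O(\log(n+\max_e c(e)+2))$ bits. The constants in the $O(\cdot)$ are absolute. -/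

import Mathlib

open Classical in
/-- `E(X)`: the edges of `G` with exactly one end-vertex in `X`. -/
noncomputable def cutEdges {V : Type*} [Fintype V] (G : SimpleGraph V) (X : Set V) :
    Finset (Sym2 V) :=
  {e ∈ G.edgeFinset | ∃ u ∈ X, ∃ v ∉ X, e = s(u, v)}

/-- `h(X) = ∑_{e ∈ E(X)} h(e)`.  Edge functions are functions on `Sym2 V`, of which only the values
on the edges of `G` matter. -/
noncomputable def cutValue {V : Type*} [Fintype V] (G : SimpleGraph V) (h : Sym2 V → ℕ)
    (X : Set V) : ℕ :=
  ∑ e ∈ cutEdges G X, h e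

/-- A path of `G` between two distinct terminals, with one of its two orientations. (An undirected
path has two representatives; a multiplicity of the undirected path is the sum of the
multiplicities of the two.) -/
structure TerminalPath {V : Type*} (G : SimpleGraph V) (T : Finset V) where
  source : V
  target : V
  source_mem : source ∈ T
  target_mem : target ∈ T
  source_ne_target : source ≠ target
  path : G.Path source target

open Classical in
/-- `f` is an integral multiterminal flow: it has a decomposition `g` into nonnegative integral
multiplicities of paths between distinct terminals. (As `V` is finite, there are finitely many
paths, so that finite support is no restriction.) -/
def IsIntegralFlow {V : Type*} (G : SimpleGraph V) (T : Finset V) (f : Sym2 V → ℕ) : Prop :=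
  ∃ g : TerminalPath G T →₀ ℕ, ∀ e ∈ G.edgeSet,
    f e = g.sum fun P k => if e ∈ P.path.1.edges then k else 0

/-- An integral multiterminal flow that respects the capacities `c`. -/
def IsFeasibleFlow {V : Type*} (G : SimpleGraph V) (T : Finset V) (c f : Sym2 V → ℕ) : Prop :=
  IsIntegralFlow G T f ∧ ∀ e ∈ G.edgeSet, f e ≤ c e

/-- The flow value `α(f) = ½ ∑_{t ∈ T} f({t})`. -/
noncomputable def flowValue {V : Type*} [Fintype V] (G : SimpleGraph V) (T : Finset V)
    (f : Sym2 V → ℕ) : ℚ :=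
  (∑ t ∈ T, (cutValue G f {t} : ℚ)) / 2

/-- A cut-system of `T`: pairwise disjoint sets `X t`, `t ∈ T`, where `X t` induces a connected
subgraph and `t` is its only terminal. The values of `X` outside `T` play no role. -/
def IsCutSystem {V : Type*} (G : SimpleGraph V) (T : Finset V) (X : V → Set V) : Prop :=
  (∀ t ∈ T, X t ∩ (T : Set V) = {t} ∧ (G.induce (X t)).Connected) ∧
    (T : Set V).PairwiseDisjoint X

/-- `γ(𝒳) = ∑_{X ∈ 𝒳} c(X)`. -/
noncomputable def cutSystemGamma {V : Type*} [Fintype V] (G : SimpleGraph V) (T : Finset V)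
    (c : Sym2 V → ℕ) (X : V → Set V) : ℕ :=
  ∑ t ∈ T, cutValue G c (X t)

/-- The vertices that lie in no member of the cut-system. -/
def uncovered {V : Type*} (T : Finset V) (X : V → Set V) : Set V :=
  {v | ∀ t ∈ T, v ∉ X t}

/-- `κ(𝒳)`: the number of connected components `W` of `G - ⋃ 𝒳` for which `c(W)` is odd; here
`c(W)` is the value of the cut of `W` in the whole graph `G`. -/
noncomputable def cutSystemKappa {V : Type*} [Fintype V] (G : SimpleGraph V) (T : Finset V)
    (c : Sym2 V → ℕ) (X : V → Set V) : ℕ :=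
  Nat.card {W : (G.induce (uncovered T X)).ConnectedComponent //
    Odd (cutValue G c (Subtype.val '' W.supp))}

/-- The bound `½ (γ(𝒳) - κ(𝒳))` given by a cut-system. -/
noncomputable def cutSystemValue {V : Type*} [Fintype V] (G : SimpleGraph V) (T : Finset V)
    (c : Sym2 V → ℕ) (X : V → Set V) : ℚ :=
  ((cutSystemGamma G T c X : ℚ) - (cutSystemKappa G T c X : ℚ)) / 2

/-- A feasible integral flow of maximum value. -/
def IsMaximumFlow {V : Type*} [Fintype V] (G : SimpleGraph V) (T : Finset V)
    (c f : Sym2 V → ℕ) : Prop :=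
  IsFeasibleFlow G T c f ∧
    ∀ f' : Sym2 V → ℕ, IsFeasibleFlow G T c f' → flowValue G T f' ≤ flowValue G T f

/-- A cut-system of minimum value. -/
def IsMinimumCutSystem {V : Type*} [Fintype V] (G : SimpleGraph V) (T : Finset V)
    (c : Sym2 V → ℕ) (X : V → Set V) : Prop :=
  IsCutSystem G T X ∧
    ∀ X' : V → Set V, IsCutSystem G T X' → cutSystemValue G T c X ≤ cutSystemValue G T c X'

/-! ### A random access machine

A program is a finite text over integer variables and integer arrays; being finite, it names
a fixed number of them, independently of the input. The machine has two parameters: all array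
indices have to be less than `S`, and all numbers that are ever stored or computed have to be less
than `B`; otherwise there is no execution. Every elementary operation (reading a constant,
a variable or an array cell, addition, subtraction, halving, comparison, writing) takes
one unit of time. -/

namespace RAM

/-- Integer expressions: a constant, a variable, a cell of an array at a computed index, sum,
subtraction (with result `0` where the difference is negative), and half, rounded down. -/
inductive Expr where
  | const (k : ℕ)
  | var (x : ℕ)
  | read (a : ℕ) (i : Expr)
  | add (p q : Expr)
  | sub (p q : Expr)
  | half (p : Expr)

/-- Programs; the tests of `ite` and `loop` (a while loop) compare two expressions by `p < q`. -/
inductive Cmd where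
  | skip
  | assign (x : ℕ) (p : Expr)
  | write (a : ℕ) (i p : Expr)
  | seq (C D : Cmd)
  | ite (p q : Expr) (C D : Cmd)
  | loop (p q : Expr) (C : Cmd)

/-- The contents of the variables and of the arrays. -/
structure State where
  var : ℕ → ℕ
  arr : ℕ → ℕ → ℕ

/-- The number of operations in the evaluation of an expression. -/
def Expr.cost : Expr → ℕ
  | const _ => 1
  | var _ => 1
  | read _ i => i.cost + 1
  | add p q => p.cost + q.cost + 1
  | sub p q => p.cost + q.cost + 1
  | half p => p.cost + 1

/-- `p.Eval S B s v`: with array indices below `S` and numbers below `B`, the expression `p`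
evaluates to `v` in the state `s`. -/
inductive Expr.Eval (S B : ℕ) (s : State) : Expr → ℕ → Prop
  | const {k : ℕ} (h : k < B) : Eval S B s (const k) k
  | var {x : ℕ} (h : s.var x < B) : Eval S B s (var x) (s.var x)
  | read {a : ℕ} {i : Expr} {j : ℕ} (hi : Eval S B s i j) (hj : j < S) (h : s.arr a j < B) :
      Eval S B s (read a i) (s.arr a j)
  | add {p q : Expr} {v w : ℕ} (hp : Eval S B s p v) (hq : Eval S B s q w) (h : v + w < B) :
      Eval S B s (add p q) (v + w)
  | sub {p q : Expr} {v w : ℕ} (hp : Eval S B s p v) (hq : Eval S B s q w) :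
      Eval S B s (sub p q) (v - w)
  | half {p : Expr} {v : ℕ} (hp : Eval S B s p v) : Eval S B s (half p) (v / 2)

/-- The state after writing `v` into the variable `x`. -/
def State.setVar (s : State) (x v : ℕ) : State :=
  { s with var := Function.update s.var x v }

/-- The state after writing `v` into cell `j` of the array `a`. -/
def State.setArr (s : State) (a j v : ℕ) : State :=
  { s with arr := Function.update s.arr a (Function.update (s.arr a) j v) }

/-- `Exec S B C s k s'`: with array indices below `S` and numbers below `B`, the program `C`,
started in the state `s`, halts after `k` units of time in the state `s'`. -/
inductive Exec (S B : ℕ) : Cmd → State → ℕ → State → Prop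
  | skip {s : State} : Exec S B Cmd.skip s 1 s
  | assign {s : State} {x : ℕ} {p : Expr} {v : ℕ} (hp : p.Eval S B s v) :
      Exec S B (Cmd.assign x p) s (p.cost + 1) (s.setVar x v)
  | write {s : State} {a : ℕ} {i p : Expr} {j v : ℕ} (hi : i.Eval S B s j) (hj : j < S)
      (hp : p.Eval S B s v) :
      Exec S B (Cmd.write a i p) s (i.cost + p.cost + 1) (s.setArr a j v)
  | seq {C D : Cmd} {s s' s'' : State} {k l : ℕ} (hC : Exec S B C s k s')
      (hD : Exec S B D s' l s'') : Exec S B (Cmd.seq C D) s (k + l) s''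
  | ite_true {p q : Expr} {C D : Cmd} {s s' : State} {v w k : ℕ} (hp : p.Eval S B s v)
      (hq : q.Eval S B s w) (h : v < w) (hC : Exec S B C s k s') :
      Exec S B (Cmd.ite p q C D) s (p.cost + q.cost + 1 + k) s'
  | ite_false {p q : Expr} {C D : Cmd} {s s' : State} {v w k : ℕ} (hp : p.Eval S B s v)
      (hq : q.Eval S B s w) (h : ¬ v < w) (hD : Exec S B D s k s') :
      Exec S B (Cmd.ite p q C D) s (p.cost + q.cost + 1 + k) s'
  | loop_true {p q : Expr} {C : Cmd} {s s' s'' : State} {v w k l : ℕ} (hp : p.Eval S B s v)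
      (hq : q.Eval S B s w) (h : v < w) (hC : Exec S B C s k s')
      (hW : Exec S B (Cmd.loop p q C) s' l s'') :
      Exec S B (Cmd.loop p q C) s (p.cost + q.cost + 1 + k + l) s''
  | loop_false {p q : Expr} {C : Cmd} {s : State} {v w : ℕ} (hp : p.Eval S B s v)
      (hq : q.Eval S B s w) (h : ¬ v < w) :
      Exec S B (Cmd.loop p q C) s (p.cost + q.cost + 1) s

end RAM

/-- `L` lists the edges of `G`, each exactly once, in some order and by its two end-vertices in
some order. -/
def IsEdgeList {V : Type*} (G : SimpleGraph V) (L : List (V × V)) : Prop :=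
  (L.map fun p => s(p.1, p.2)).Nodup ∧
    ∀ e : Sym2 V, e ∈ (L.map fun p => s(p.1, p.2)) ↔ e ∈ G.edgeSet

/-- The initial state for an instance with vertices `0, …, n - 1` and list of edges `L`: variable
`0` holds `n`, the arrays `0`, `1`, `2` hold the two end-vertices and the capacity of the `i`-th
edge in their cells `i`, the cells of array `3` flag the terminals, all else is `0`. -/
def inputState {n : ℕ} (T : Finset (Fin n)) (c : Sym2 (Fin n) → ℕ) (L : List (Fin n × Fin n)) :
    RAM.State where
  var := fun x => if x = 0 then n else 0
  arr := fun a i =>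
    match a with
    | 0 => (L[i]?.map fun p => p.1.val).getD 0
    | 1 => (L[i]?.map fun p => p.2.val).getD 0
    | 2 => (L[i]?.map fun p => c s(p.1, p.2)).getD 0
    | 3 => if ∃ t ∈ T, t.val = i then 1 else 0
    | _ => 0

/-- The state `s` holds the flow `f` and the cut-system `X`: cell `i` of array `4` is the flow
on the `i`-th edge, and cell `v` of array `5` is `t + 1` if `v ∈ X t`, `t ∈ T`, and `0` if `v` lies
in no member of the cut-system. -/
def IsOutput {n : ℕ} (T : Finset (Fin n)) (L : List (Fin n × Fin n)) (s : RAM.State)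
    (f : Sym2 (Fin n) → ℕ) (X : Fin n → Set (Fin n)) : Prop :=
  (∀ (i : ℕ) (p : Fin n × Fin n), L[i]? = some p → s.arr 4 i = f s(p.1, p.2)) ∧
    (∀ t ∈ T, ∀ v ∈ X t, s.arr 5 v.val = t.val + 1) ∧
    ∀ v ∈ uncovered T X, s.arr 5 v.val = 0

/-! By weak duality, equality of the two values certifies both optimality claims, so the task is to
prove weak duality and to compute, in linear time, a flow and a cut-system of equal value.

Weak duality. Decompose `f` into paths. Each path crosses the boundary of `X t` at least as often as
that of `{t}`. It crosses the boundary of an uncovered component `W` an even number of times, so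
`f(W)` is even; if `c(W)` is odd, some edge leaving `W` has spare capacity, and its other end lies
in some `X t`. Distinct components yield distinct such edges, hence `∑ f({t}) + κ ≤ γ`
(`sum_cutValue_add_cutSystemKappa_le`).

Flows locally. In a forest, an edge function is an integral flow as soon as at every nonterminal the
incident values have an even sum and none exceeds half of it (`isIntegralFlow_of_isPairable`). So
only local conditions have to be arranged.

Dynamic program. Root the tree at a terminal. Every edge above a vertex gets two numbers `a ≤ b` of
equal parity. At a nonterminal with child sums `A` and `B`, the number `ao` is the larger of `A % 2`
and of the amount that must go upwards when the child with the largest `a` sends that much while its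
siblings absorb their `b`'s. Cutting off at the capacity gives `a`; rounding `min B c` down to the
parity of `a` gives `b`. From the root downwards, the flow `k` on the parent edge is then
distributed over the children so that the local condition holds (`IsBalanced`).

Labels. If `c < ao`, the edge is a bottleneck and the vertex joins the terminal below it that is
found by following maximal children. Otherwise it inherits the label of its parent, except that it
stays uncovered if that label is not its own lower terminal and `c < B`. The invariants `IsUpper`
and `IsLower` tie labels to flow. They imply that at a nonterminal of `X t` the edge towards `t`
carries exactly half of the flow, so `∑ f({t}) = ∑ f(X t)` (`sum_cutValue_singleton`). Every
boundary edge is saturated, except that the top edge of an uncovered component may lack one unit;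
parity then makes the capacity of that component odd (`odd_cutValue`). This is strong duality,
`IsSolved.flowValue_eq`.

Linear time. Each vertex stores its degree and the sum of the indices of its remaining edges. Once
it has become a leaf, this sum is the index of its parent edge, so no adjacency lists are needed. A
queue of leaves yields an order with children before parents (`peel_runs`), and reading it backwards
serves the pass from the root (`topDown_runs`). -/

/-! ### Weak duality -/

theorem mk_mem_cutEdges {V : Type*} [Fintype V] {G : SimpleGraph V} {X : Set V} {u v : V} :
    s(u, v) ∈ cutEdges G X ↔ G.Adj u v ∧ (u ∈ X ↔ v ∉ X) := by
  classical
  simp only [cutEdges, Finset.mem_filter, SimpleGraph.mem_edgeFinset, SimpleGraph.mem_edgeSet]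
  refine and_congr_right fun _ => ⟨?_, fun h => ?_⟩
  · rintro ⟨a, ha, b, hb, hab⟩
    rcases Sym2.eq_iff.1 hab with ⟨rfl, rfl⟩ | ⟨rfl, rfl⟩ <;> tauto
  · by_cases hu : u ∈ X
    · exact ⟨u, hu, v, h.1 hu, rfl⟩
    · exact ⟨v, by tauto, u, hu, Sym2.eq_swap⟩

theorem cutEdges_subset_edgeSet {V : Type*} [Fintype V] {G : SimpleGraph V} {X : Set V}
    {e : Sym2 V} (he : e ∈ cutEdges G X) : e ∈ G.edgeSet := by
  induction e with | _ u v => exact (mk_mem_cutEdges.1 he).1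

open Classical in
/-- The number of edges of the cut `E(X)` in a walk. -/
noncomputable def walkCrossings {V : Type*} [Fintype V] {G : SimpleGraph V} (X : Set V) {u v : V}
    (p : G.Walk u v) : ℕ :=
  p.edges.countP (· ∈ cutEdges G X)

section WalkCrossings

variable {V : Type*} [Fintype V] {G : SimpleGraph V}

open Classical in
theorem walkCrossings_cons (X : Set V) {u v w : V} (h : G.Adj u v) (p : G.Walk v w) :
    walkCrossings X (SimpleGraph.Walk.cons h p) =
      walkCrossings X p + if (u ∈ X ↔ v ∉ X) then 1 else 0 := by
  simp only [walkCrossings, SimpleGraph.Walk.edges_cons, List.countP_cons, mk_mem_cutEdges, h,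
    true_and, decide_eq_true_eq]

theorem walkCrossings_append (X : Set V) {u v w : V} (p : G.Walk u v) (q : G.Walk v w) :
    walkCrossings X (p.append q) = walkCrossings X p + walkCrossings X q := by
  simp [walkCrossings, List.countP_append]

theorem walkCrossings_reverse (X : Set V) {u v : V} (p : G.Walk u v) :
    walkCrossings X p.reverse = walkCrossings X p := by
  simp [walkCrossings, List.countP_reverse]

theorem even_walkCrossings (X : Set V) {u v : V} (p : G.Walk u v) :
    Even (walkCrossings X p) ↔ (u ∈ X ↔ v ∈ X) := by
  classical
  induction p with
  | nil => simp [walkCrossings]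
  | cons h p ih =>
    rw [walkCrossings_cons]
    split_ifs <;> simp only [Nat.even_add_one, add_zero, ih] <;> tauto

theorem walkCrossings_singleton_of_notMem {t u v : V} (p : G.Walk u v) (h : t ∉ p.support) :
    walkCrossings {t} p = 0 := by
  classical
  induction p with
  | nil => simp [walkCrossings]
  | cons hadj p ih =>
    rw [SimpleGraph.Walk.support_cons, List.mem_cons, not_or] at h
    have h2 : t ≠ _ := fun e => h.2 (e ▸ p.start_mem_support)
    rw [walkCrossings_cons, ih h.2]
    simp [Ne.symm h.1, h2.symm]

/-- A nontrivial path from `t` never returns to `t`, so it crosses `{t}` at most once; it ends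
outside `X`, so it crosses `X` an odd number of times, hence at least once. -/
theorem walkCrossings_singleton_start_le {t v : V} (X : Set V) (p : G.Walk t v) (hp : p.IsPath)
    (ht : t ∈ X) (hv : v ∈ X → v = t) : walkCrossings {t} p ≤ walkCrossings X p := by
  classical
  cases p with
  | nil => simp [walkCrossings]
  | cons hadj p =>
    have hs := (SimpleGraph.Walk.cons_isPath_iff hadj p).1 hp
    have hne : v ≠ t := fun e => hs.2 (e ▸ p.end_mem_support)
    have hodd : ¬ Even (walkCrossings X (SimpleGraph.Walk.cons hadj p)) := by
      rw [even_walkCrossings]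
      tauto
    have hpos : walkCrossings X (SimpleGraph.Walk.cons hadj p) ≠ 0 := fun e => hodd (by simp [e])
    have hone : walkCrossings {t} (SimpleGraph.Walk.cons hadj p) ≤ 1 := by
      rw [walkCrossings_cons, walkCrossings_singleton_of_notMem p hs.2]
      split_ifs <;> simp
    lia

/-- If the path meets `t`, split it there and treat both halves as paths starting at `t`; this also
covers a terminal that is an inner vertex of the path. -/
theorem walkCrossings_singleton_le {t u v : V} (X : Set V) (p : G.Walk u v) (hp : p.IsPath)
    (ht : t ∈ X) (hu : u ∈ X → u = t) (hv : v ∈ X → v = t) :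
    walkCrossings {t} p ≤ walkCrossings X p := by
  classical
  by_cases h : t ∈ p.support
  · rw [← p.take_spec h, walkCrossings_append, walkCrossings_append]
    refine Nat.add_le_add ?_
      (walkCrossings_singleton_start_le X _ (hp.dropUntil h) ht hv)
    rw [← walkCrossings_reverse, ← walkCrossings_reverse X]
    exact walkCrossings_singleton_start_le X _ (hp.takeUntil h).reverse ht hu
  · rw [walkCrossings_singleton_of_notMem p h]
    exact Nat.zero_le _

open Classical in
theorem sum_cutEdges_mem_edges (X : Set V) {u v : V} (p : G.Walk u v) (hp : p.IsPath) (k : ℕ) :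
    ∑ e ∈ cutEdges G X, (if e ∈ p.edges then k else 0) = k * walkCrossings X p := by
  have hn : (p.edges.filter (· ∈ cutEdges G X)).Nodup := (hp.isTrail.edges_nodup).filter _
  rw [← Finset.sum_filter, Finset.sum_const, smul_eq_mul, mul_comm, walkCrossings,
    List.countP_eq_length_filter, ← List.toFinset_card_of_nodup hn]
  congr 2
  ext e
  simp [and_comm]

end WalkCrossings

open Classical in
theorem cutValue_eq_sum_walkCrossings {V : Type*} [Fintype V] {G : SimpleGraph V} {T : Finset V}
    {f : Sym2 V → ℕ} {g : TerminalPath G T →₀ ℕ}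
    (hg : ∀ e ∈ G.edgeSet, f e = g.sum fun P k => if e ∈ P.path.1.edges then k else 0) (X : Set V) :
    cutValue G f X = g.sum fun P k => k * walkCrossings X P.path.1 := by
  unfold cutValue
  rw [Finset.sum_congr rfl fun e he => hg e (cutEdges_subset_edgeSet he)]
  unfold Finsupp.sum
  rw [Finset.sum_comm]
  refine Finset.sum_congr rfl fun P _ => ?_
  exact sum_cutEdges_mem_edges X _ P.path.2 _

theorem cutValue_singleton_le_of_isIntegralFlow {V : Type*} [Fintype V] {G : SimpleGraph V}
    {T : Finset V} {f : Sym2 V → ℕ} (hf : IsIntegralFlow G T f) {X : Set V} {t : V}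
    (hX : X ∩ (T : Set V) = {t}) : cutValue G f {t} ≤ cutValue G f X := by
  obtain ⟨g, hg⟩ := hf
  rw [cutValue_eq_sum_walkCrossings hg, cutValue_eq_sum_walkCrossings hg]
  have key : ∀ v ∈ T, v ∈ X → v = t := fun v hv hvX => by
    have : v ∈ X ∩ (T : Set V) := ⟨hvX, hv⟩
    rwa [hX] at this
  have ht : t ∈ X := (hX.symm.subset rfl).1
  exact Finset.sum_le_sum fun P _ => Nat.mul_le_mul_left _
    (walkCrossings_singleton_le X _ P.path.2 ht (key _ P.source_mem) (key _ P.target_mem))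

theorem even_cutValue_of_isIntegralFlow {V : Type*} [Fintype V] {G : SimpleGraph V}
    {T : Finset V} {f : Sym2 V → ℕ} (hf : IsIntegralFlow G T f) {W : Set V}
    (hW : ∀ t ∈ T, t ∉ W) : Even (cutValue G f W) := by
  obtain ⟨g, hg⟩ := hf
  rw [cutValue_eq_sum_walkCrossings hg]
  refine Finset.even_sum _ fun P _ => Even.mul_left ?_ _
  rw [even_walkCrossings]
  exact iff_of_false (hW _ P.source_mem) (hW _ P.target_mem)

/-- The flow through the boundary of `W` is even and the capacity is odd, so some boundary edge is
not saturated. Its outer end is covered, since an uncovered neighbour would belong to the same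
component. -/
theorem exists_slack_of_odd_component {V : Type*} [Fintype V] {G : SimpleGraph V}
    {T : Finset V} {c f : Sym2 V → ℕ} {X : V → Set V} (hf : IsFeasibleFlow G T c f)
    (hX : IsCutSystem G T X) (W : (G.induce (uncovered T X)).ConnectedComponent)
    (hW : Odd (cutValue G c (Subtype.val '' W.supp))) :
    ∃ x y : V, (∃ hx : x ∈ uncovered T X,
      (G.induce (uncovered T X)).connectedComponentMk ⟨x, hx⟩ = W) ∧
      ∃ t ∈ T, y ∈ X t ∧ s(x, y) ∈ cutEdges G (X t) ∧ f s(x, y) < c s(x, y) := by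
  have heven : Even (cutValue G f (Subtype.val '' W.supp)) := by
    refine even_cutValue_of_isIntegralFlow hf.1 fun t ht => ?_
    rintro ⟨w, -, rfl⟩
    exact w.2 w ht (((hX.1 w ht).1.symm.subset rfl).1)
  have hne : ∃ e ∈ cutEdges G (Subtype.val '' W.supp), f e < c e := by
    by_contra! h
    have heq : cutValue G f (Subtype.val '' W.supp) = cutValue G c (Subtype.val '' W.supp) :=
      Finset.sum_congr rfl fun e he => le_antisymm (hf.2 e (cutEdges_subset_edgeSet he)) (h e he)
    rw [heq] at heven
    exact (Nat.not_even_iff_odd.2 hW) heven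
  obtain ⟨e, he, hlt⟩ := hne
  obtain ⟨x, y, rfl, hadj, hx, hy⟩ : ∃ x y, e = s(x, y) ∧ G.Adj x y ∧
      x ∈ (Subtype.val '' W.supp) ∧ y ∉ (Subtype.val '' W.supp) := by
    induction e with | _ u v =>
    obtain ⟨h1, h2⟩ := mk_mem_cutEdges.1 he
    by_cases hu : u ∈ (Subtype.val '' W.supp)
    · exact ⟨u, v, rfl, h1, hu, h2.1 hu⟩
    · exact ⟨v, u, Sym2.eq_swap, h1.symm, by tauto, hu⟩
  obtain ⟨x, hxW, rfl⟩ := hx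
  have hycov : y ∉ uncovered T X := by
    intro hyu
    refine hy ⟨⟨y, hyu⟩, ?_, rfl⟩
    rw [SimpleGraph.ConnectedComponent.mem_supp_iff] at hxW ⊢
    rw [← hxW, SimpleGraph.ConnectedComponent.eq]
    exact SimpleGraph.Adj.reachable (by simpa using hadj.symm)
  obtain ⟨t, ht, hyt⟩ : ∃ t ∈ T, y ∈ X t := by
    simpa [uncovered] using hycov
  exact ⟨x, y, ⟨x.2, hxW⟩, t, ht, hyt, mk_mem_cutEdges.2 ⟨hadj, by
    have := x.2 t ht
    tauto⟩, hlt⟩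

theorem sum_cutValue_add_cutSystemKappa_le {V : Type*} [Fintype V] {G : SimpleGraph V}
    {T : Finset V} {c f : Sym2 V → ℕ} {X : V → Set V} (hf : IsFeasibleFlow G T c f)
    (hX : IsCutSystem G T X) :
    ∑ t ∈ T, cutValue G f (X t) + cutSystemKappa G T c X ≤ cutSystemGamma G T c X := by
  classical
  -- Slack edges are oriented from the uncovered to the covered end. The first entry determines the
  -- component, and the unoriented edge determines the pair, because the reversed pair would start
  -- at a covered vertex.
  let P : Finset (V × V) := Finset.univ.filter fun p => p.1 ∈ uncovered T X ∧
    ∃ t ∈ T, p.2 ∈ X t ∧ s(p.1, p.2) ∈ cutEdges G (X t) ∧ f s(p.1, p.2) < c s(p.1, p.2)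
  have h1 : cutSystemKappa G T c X ≤ P.card := by
    unfold cutSystemKappa
    choose x y hx t ht hyt he hlt using
      fun W : {W : (G.induce (uncovered T X)).ConnectedComponent //
        Odd (cutValue G c (Subtype.val '' W.supp))} =>
        exists_slack_of_odd_component hf hX W.1 W.2
    have hmem : ∀ W, (x W, y W) ∈ P := fun W => Finset.mem_filter.2
      ⟨Finset.mem_univ _, (hx W).1, t W, ht W, hyt W, he W, hlt W⟩
    rw [← Fintype.card_coe P, ← Nat.card_eq_fintype_card]
    refine Nat.card_le_card_of_injective (fun W => (⟨(x W, y W), hmem W⟩ : P)) ?_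
    intro W W' hWW
    have hxx : x W = x W' := congrArg (fun z : P => z.1.1) hWW
    obtain ⟨hu, hW⟩ := hx W
    obtain ⟨hu', hW'⟩ := hx W'
    apply Subtype.ext
    rw [← hW, ← hW']
    congr 2
  have h2 : P.card ≤ ∑ t ∈ T, ((cutEdges G (X t)).filter fun e => f e < c e).card := by
    rw [← Finset.card_sigma]
    have hch : ∀ p : V × V, ∃ t, p ∈ P → t ∈ T ∧ p.2 ∈ X t ∧ s(p.1, p.2) ∈ cutEdges G (X t) ∧
        f s(p.1, p.2) < c s(p.1, p.2) := fun p => by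
      by_cases hp : p ∈ P
      · exact (Finset.mem_filter.1 hp).2.2.imp fun t h _ => h
      · exact ⟨p.1, fun h => absurd h hp⟩
    choose t ht using hch
    refine Finset.card_le_card_of_injOn (fun p => ⟨t p, s(p.1, p.2)⟩) ?_ ?_
    · intro p hp
      simp only [Finset.coe_sigma, Set.mem_sigma_iff, Finset.mem_coe, Finset.mem_filter]
      exact ⟨(ht p hp).1, (ht p hp).2.2⟩
    · intro p hp q hq hpq
      simp only [Sigma.mk.injEq, heq_eq_eq] at hpq
      rcases Sym2.eq_iff.1 hpq.2 with ⟨h, h'⟩ | ⟨h, h'⟩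
      · exact Prod.ext h h'
      · have hu := (Finset.mem_filter.1 hp).2.1 (t q) (ht q hq).1
        exact absurd (h ▸ (ht q hq).2.1) hu
  have h3 : ∀ t ∈ T, cutValue G f (X t) +
      ((cutEdges G (X t)).filter fun e => f e < c e).card ≤ cutValue G c (X t) := by
    intro t _
    unfold cutValue
    rw [Finset.card_filter, ← Finset.sum_add_distrib]
    refine Finset.sum_le_sum fun e he => ?_
    have := hf.2 e (cutEdges_subset_edgeSet he)
    split_ifs <;> lia
  calc _ ≤ ∑ t ∈ T, cutValue G f (X t) +
        ∑ t ∈ T, ((cutEdges G (X t)).filter fun e => f e < c e).card :=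
        Nat.add_le_add_left (h1.trans h2) _
    _ ≤ _ := by
        rw [← Finset.sum_add_distrib]
        exact Finset.sum_le_sum h3

/-- Weak duality: every cut-system bounds the value of every feasible flow. -/
theorem flowValue_le_cutSystemValue {V : Type*} [Fintype V] {G : SimpleGraph V}
    {T : Finset V} {c f : Sym2 V → ℕ} {X : V → Set V} (hf : IsFeasibleFlow G T c f)
    (hX : IsCutSystem G T X) : flowValue G T f ≤ cutSystemValue G T c X := by
  have h1 : ∑ t ∈ T, cutValue G f {t} ≤ ∑ t ∈ T, cutValue G f (X t) :=
    Finset.sum_le_sum fun t ht => cutValue_singleton_le_of_isIntegralFlow hf.1 (hX.1 t ht).1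
  have h2 := sum_cutValue_add_cutSystemKappa_le hf hX
  have h3 : ∑ t ∈ T, cutValue G f {t} + cutSystemKappa G T c X ≤ cutSystemGamma G T c X := by
    lia
  have h4 : (∑ t ∈ T, (cutValue G f {t} : ℚ)) + cutSystemKappa G T c X ≤
      cutSystemGamma G T c X := by
    exact_mod_cast h3
  unfold flowValue cutSystemValue
  linarith

/-! ### A local criterion for integral flows in forests -/

open Classical in
/-- The sum of the values of an edge function over the edges at a vertex. -/
noncomputable def starSum {V : Type*} [Fintype V] (G : SimpleGraph V) (f : Sym2 V → ℕ) (v : V) :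
    ℕ :=
  ∑ u with G.Adj v u, f s(v, u)

/-- The local condition at a vertex under which the flow units on its edges can be paired. -/
def IsPairable {V : Type*} [Fintype V] (G : SimpleGraph V) (f : Sym2 V → ℕ) (v : V) : Prop :=
  Even (starSum G f v) ∧ ∀ u, G.Adj v u → 2 * f s(v, u) ≤ starSum G f v

/-- A path may use the edges `vu` and `vw` at `v` without spoiling `IsPairable G f v`. -/
def IsSafeTurn {V : Type*} [Fintype V] (G : SimpleGraph V) (f : Sym2 V → ℕ) (v u w : V) : Prop :=
  ∀ x, G.Adj v x → x ≠ u → x ≠ w → 2 * f s(v, x) + 2 ≤ starSum G f v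

/-- A path along positive edges with safe turns at its inner nonterminals. -/
structure IsSafePath {V : Type*} [Fintype V] {G : SimpleGraph V} (T : Finset V) (f : Sym2 V → ℕ)
    {a b : V} (p : G.Walk a b) : Prop where
  isPath : p.IsPath
  pos : ∀ e ∈ p.edges, 0 < f e
  safe : ∀ i, 0 < i → i < p.length → p.getVert i ∉ T →
    IsSafeTurn G f (p.getVert i) (p.getVert (i - 1)) (p.getVert (i + 1))

section Decomposition

variable {V : Type*} [Fintype V] {G : SimpleGraph V} {T : Finset V} {f : Sym2 V → ℕ}

theorem IsPairable.exists_safeTurn {v u : V} (h : IsPairable G f v) (hu : G.Adj v u)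
    (hpos : 0 < f s(v, u)) :
    ∃ w, w ≠ u ∧ G.Adj v w ∧ 0 < f s(v, w) ∧ IsSafeTurn G f v u w := by
  classical
  obtain ⟨heven, hle⟩ := h
  have hN : u ∈ Finset.univ.filter (G.Adj v) := by simpa using hu
  have hsum := Finset.add_sum_erase _ (fun x => f s(v, x)) hN
  have hS : starSum G f v = ∑ x with G.Adj v x, f s(v, x) := by
    unfold starSum
    congr
  rw [← hS] at hsum
  have h2 := hle u hu
  have hne : ((Finset.univ.filter (G.Adj v)).erase u).Nonempty := by
    by_contra hcon
    rw [Finset.not_nonempty_iff_eq_empty] at hcon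
    rw [hcon, Finset.sum_empty] at hsum
    lia
  -- With `w` maximal among the other neighbours, any third `x` satisfies `2 f(x) + 1 ≤ f(x) + f(w)
  -- + f(u)`, which is at most the sum at `v`; evenness of that sum improves the `1` to `2`.
  obtain ⟨w, hw, hmax⟩ := Finset.exists_max_image _ (fun x => f s(v, x)) hne
  have hwu : w ≠ u := (Finset.mem_erase.1 hw).1
  have hwa : G.Adj v w := by simpa using (Finset.mem_erase.1 hw).2
  have hwpos : 0 < f s(v, w) := by
    by_contra hcon
    have : ∑ x ∈ (Finset.univ.filter (G.Adj v)).erase u, f s(v, x) = 0 :=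
      Finset.sum_eq_zero fun x hx => by
        have := hmax x hx
        lia
    lia
  refine ⟨w, hwu, hwa, hwpos, fun x hx hxu hxw => ?_⟩
  have hx' : x ∈ ((Finset.univ.filter (G.Adj v)).erase u).erase w := by
    simp [hx, hxu, hxw]
  have h3 := Finset.add_sum_erase _ (fun x => f s(v, x)) hw
  have h4 := Finset.single_le_sum (f := fun x => f s(v, x)) (fun _ _ => Nat.zero_le _) hx'
  have h5 := hmax x (Finset.mem_of_mem_erase hx')
  obtain ⟨y, hy⟩ := heven
  lia

/-- Flow that arrives at a nonterminal can be continued along a safe turn. In a forest the only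
neighbour of the start on the path is its second vertex, which the turn avoids, so the longer walk
is again a path. -/
theorem IsSafePath.exists_cons (hG : G.IsAcyclic) (hf : ∀ v ∉ T, IsPairable G f v) {a b : V}
    {p : G.Walk a b} (hp : IsSafePath T f p) (hnil : ¬ p.Nil) (ha : a ∉ T) :
    ∃ (w : V) (h : G.Adj w a), IsSafePath T f (SimpleGraph.Walk.cons h p) := by
  have hadj : G.Adj a p.snd := p.adj_snd hnil
  have hpos : 0 < f s(a, p.snd) := hp.pos _ (p.mk_start_snd_mem_edges hnil)
  obtain ⟨w, hwu, hw, hwpos, hsafe⟩ := (hf a ha).exists_safeTurn hadj hpos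
  refine ⟨w, hw.symm, ?_, ?_, ?_⟩
  · refine (SimpleGraph.Walk.cons_isPath_iff _ _).2 ⟨hp.isPath, fun hmem => hwu ?_⟩
    exact hG.eq_snd_of_adj_start hp.isPath hw hmem
  · intro e he
    rw [SimpleGraph.Walk.edges_cons, List.mem_cons] at he
    rcases he with rfl | he
    · rwa [Sym2.eq_swap]
    · exact hp.pos e he
  · intro i hi hil hiT
    obtain ⟨j, rfl⟩ : ∃ j, i = j + 1 := ⟨i - 1, by lia⟩
    rcases Nat.eq_zero_or_pos j with rfl | hj
    · intro x hx hxu hxw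
      simp only [Nat.reduceAdd, Nat.add_one_sub_one, SimpleGraph.Walk.getVert_zero,
        SimpleGraph.Walk.getVert_cons_succ] at hx hxu hxw ⊢
      exact hsafe x hx hxw hxu
    · obtain ⟨l, rfl⟩ : ∃ l, j = l + 1 := ⟨j - 1, by lia⟩
      simp only [SimpleGraph.Walk.getVert_cons_succ, Nat.add_one_sub_one,
        SimpleGraph.Walk.length_cons] at hil hiT ⊢
      exact hp.safe (l + 1) (by lia) (by lia) hiT

/-- Prepending cannot go on forever, since a path has fewer edges than there are vertices; it stops
only at a terminal. -/
theorem IsSafePath.exists_start_mem (hG : G.IsAcyclic) (hf : ∀ v ∉ T, IsPairable G f v) {a b : V}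
    {p : G.Walk a b} (hp : IsSafePath T f p) (hnil : ¬ p.Nil) :
    ∃ t ∈ T, ∃ q : G.Walk t b, IsSafePath T f q ∧ ¬ q.Nil := by
  induction hm : Fintype.card V - p.length using Nat.strong_induction_on generalizing a with
  | _ m ih =>
    by_cases ha : a ∈ T
    · exact ⟨a, ha, p, hp, hnil⟩
    · obtain ⟨w, h, hq⟩ := hp.exists_cons hG hf hnil ha
      have := hq.isPath.length_lt
      rw [SimpleGraph.Walk.length_cons] at this
      exact ih (Fintype.card V - (p.length + 1)) (by lia) hq (by simp) (by simp)

theorem isSafePath_of_adj {a b : V} (h : G.Adj a b) (hpos : 0 < f s(a, b)) :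
    IsSafePath T f (SimpleGraph.Walk.cons h SimpleGraph.Walk.nil) where
  isPath := by simp [h.ne]
  pos := by simpa using hpos
  safe i hi hil := by
    simp only [SimpleGraph.Walk.length_cons, SimpleGraph.Walk.length_nil] at hil
    lia

theorem exists_safe_terminalPath (hG : G.IsAcyclic) (hf : ∀ v ∉ T, IsPairable G f v)
    {a b : V} (h : G.Adj a b) (hpos : 0 < f s(a, b)) :
    ∃ P : TerminalPath G T, IsSafePath T f P.path.1 := by
  obtain ⟨t, ht, q, hq, hqn⟩ := (isSafePath_of_adj h hpos).exists_start_mem hG hf (by simp)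
  have h1 : G.Adj q.snd t := (q.adj_snd hqn).symm
  have h2 : 0 < f s(q.snd, t) := by
    rw [Sym2.eq_swap]
    exact hq.pos _ (q.mk_start_snd_mem_edges hqn)
  -- Paths grow only at their start. Hence only the terminal edge of the first path is kept;
  -- reversed, it is the seed of a second path, which ends at the terminal `t` and grows back to
  -- another one.
  obtain ⟨u, hu, p, hp, hpn⟩ := (isSafePath_of_adj h1 h2).exists_start_mem hG hf (by simp)
  refine ⟨⟨u, t, hu, ht, ?_, ⟨p, hp.isPath⟩⟩, hp⟩
  rintro rfl
  exact hpn (SimpleGraph.Walk.isPath_iff_nil.1 hp.isPath)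

-- At an inner nonterminal of the path the sum drops by two and both edges used drop by one. For the
-- other edges the bound survives by the safety of the turn.
open Classical in
theorem IsPairable.sub_path {v : V} (h : IsPairable G f v) (P : TerminalPath G T)
    (hP : IsSafePath T f P.path.1) (hv : v ∉ T) :
    IsPairable G (fun e => f e - if e ∈ P.path.1.edges then 1 else 0) v := by
  by_cases hs : v ∈ P.path.1.support
  · obtain ⟨i, hi, hil⟩ := (SimpleGraph.Walk.mem_support_iff_exists_getVert).1 hs
    have hi0 : i ≠ 0 := by
      rintro rfl
      exact hv (by simpa [← hi] using P.source_mem)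
    have hil' : i < P.path.1.length := by
      refine lt_of_le_of_ne hil ?_
      rintro rfl
      exact hv (by simpa [← hi] using P.target_mem)
    have hnbr := hP.isPath.neighborSet_toSubgraph_internal hi0 hil'
    have hcard := hP.isPath.ncard_neighborSet_toSubgraph_internal_eq_two hi0 hil'
    have hsafe := hP.safe i (Nat.pos_of_ne_zero hi0) hil' (by rwa [hi])
    rw [hi] at hnbr hsafe hcard
    set u := P.path.1.getVert (i - 1)
    set w := P.path.1.getVert (i + 1)
    have huw : u ≠ w := by
      intro e
      rw [hnbr, e] at hcard
      simp at hcard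
    have hmem : ∀ x, s(v, x) ∈ P.path.1.edges ↔ x = u ∨ x = w := by
      intro x
      rw [← SimpleGraph.Walk.mem_edges_toSubgraph, SimpleGraph.Subgraph.mem_edgeSet,
        ← SimpleGraph.Subgraph.mem_neighborSet, hnbr]
      simp
    have hadj : ∀ x, x = u ∨ x = w → G.Adj v x := fun x hx =>
      SimpleGraph.Walk.edges_subset_edgeSet _ ((hmem x).2 hx)
    have hpos : ∀ x, x = u ∨ x = w → 0 < f s(v, x) := fun x hx => hP.pos _ ((hmem x).2 hx)
    have hS : starSum G (fun e => f e - if e ∈ P.path.1.edges then 1 else 0) v + 2 =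
        starSum G f v := by
      have h2 : ∑ x with G.Adj v x, (if x = u ∨ x = w then 1 else 0) = 2 := by
        rw [← Finset.sum_filter, ← Finset.card_eq_sum_ones, Finset.filter_filter,
          ← Finset.card_pair huw]
        congr 1
        ext x
        simp only [Finset.mem_filter, Finset.mem_univ, true_and, Finset.mem_insert,
          Finset.mem_singleton]
        exact ⟨fun hx => hx.2, fun hx => ⟨hadj x hx, hx⟩⟩
      rw [← h2]
      unfold starSum
      rw [← Finset.sum_add_distrib]
      refine Finset.sum_congr rfl fun x _ => ?_
      have := hpos x
      simp only [hmem]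
      split_ifs with hx
      · have := hpos x hx
        lia
      · lia
    obtain ⟨heven, hle⟩ := h
    refine ⟨?_, fun x hx => ?_⟩
    · rw [← hS, Nat.even_add] at heven
      exact heven.2 even_two
    · have h1 := hle x hx
      have h2 := hsafe x hx
      have h3 := hpos x
      simp only [hmem]
      split_ifs with hx'
      · lia
      · push Not at hx'
        have := h2 hx'.1 hx'.2
        lia
  · have hnot : ∀ x, s(v, x) ∉ P.path.1.edges := fun x hx =>
      hs (SimpleGraph.Walk.fst_mem_support_of_mem_edges _ hx)
    have hS : starSum G (fun e => f e - if e ∈ P.path.1.edges then 1 else 0) v =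
        starSum G f v := by
      unfold starSum
      simp [hnot]
    unfold IsPairable
    rw [hS]
    simpa [hnot, IsPairable] using h

/-- In a forest, every edge function that is pairable at all nonterminals is an integral
multiterminal flow. -/
theorem isIntegralFlow_of_isPairable (hG : G.IsAcyclic) (hf : ∀ v ∉ T, IsPairable G f v) :
    IsIntegralFlow G T f := by
  classical
  induction hm : ∑ e ∈ G.edgeFinset, f e using Nat.strong_induction_on generalizing f with
  | _ m ih =>
    by_cases h0 : ∀ e ∈ G.edgeSet, f e = 0
    · exact ⟨0, fun e he => by simp [h0 e he]⟩
    · push Not at h0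
      obtain ⟨e, he, hne⟩ := h0
      induction e with | _ a b =>
      obtain ⟨P, hP⟩ := exists_safe_terminalPath hG hf he (Nat.pos_of_ne_zero hne)
      -- One unit is peeled off along a safe path; the total flow decreases and pairability
      -- survives, so the induction hypothesis decomposes the rest.
      set f' : Sym2 V → ℕ := fun e => f e - if e ∈ P.path.1.edges then 1 else 0 with hf'
      have hlt : ∑ e ∈ G.edgeFinset, f' e < m := by
        rw [← hm]
        have hnil : ¬ P.path.1.Nil := fun h => P.source_ne_target h.eq
        refine Finset.sum_lt_sum (fun e _ => Nat.sub_le _ _)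
          ⟨s(P.source, P.path.1.snd), SimpleGraph.mem_edgeFinset.2 (P.path.1.adj_snd hnil), ?_⟩
        have hmem := P.path.1.mk_start_snd_mem_edges hnil
        have := hP.pos _ hmem
        simp only [hf', hmem, if_true]
        lia
      obtain ⟨g, hg⟩ := ih _ hlt (fun v hv => (hf v hv).sub_path P hP hv) rfl
      refine ⟨g + Finsupp.single P 1, fun e he => ?_⟩
      rw [Finsupp.sum_add_index' (by simp) (by intro a b c; split_ifs <;> simp),
        Finsupp.sum_single_index (by simp)]
      have h1 := hg e he
      have h2 := hP.pos e
      simp only at h1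
      rw [← h1]
      split_ifs with hmem
      · have := h2 hmem
        lia
      · lia

end Decomposition

/-! ### Rooted trees and edge sums -/

/-- `par` is the parent function of the tree `G` rooted at `r`, `depth` the distance from `r`. -/
structure IsRooting {V : Type*} (G : SimpleGraph V) (r : V) (par : V → V) (depth : V → ℕ) :
    Prop where
  adj_par : ∀ v, v ≠ r → G.Adj v (par v)
  depth_par : ∀ v, v ≠ r → depth (par v) + 1 = depth v
  of_adj : ∀ u v, G.Adj u v → (u ≠ r ∧ par u = v) ∨ (v ≠ r ∧ par v = u)

theorem SimpleGraph.IsTree.exists_isRooting {V : Type*} {G : SimpleGraph V} (hG : G.IsTree)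
    (r : V) : ∃ par depth, IsRooting G r par depth := by
  classical
  choose p hp hlen using fun v => (hG.connected r v).exists_path_of_dist
  have hpen : ∀ v, v ≠ r → ¬ (p v).Nil := fun v hv h => hv h.eq.symm
  -- If `w` is nearer to `r` than `v`, then `v` is not on the path to `w`; uniqueness of paths makes
  -- `w` the last vertex before `v` on the path from `r` to `v`.
  have huniq : ∀ v w, G.Adj v w → G.dist r v = G.dist r w + 1 → (p v).penultimate = w := by
    intro v w hadj hd
    have hv : v ∉ (p w).support := by
      intro hmem
      have h1 := SimpleGraph.dist_le ((p w).takeUntil v hmem)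
      have h2 := (p w).length_takeUntil_le_length hmem
      have h3 := hlen w
      lia
    have hw := hG.isAcyclic.mem_support_of_ne_mem_support_of_adj_of_isPath (hp v) (hp w) hadj hv
    exact (hG.isAcyclic.eq_penultimate_of_adj_end (hp v) hadj hw).symm
  refine ⟨fun v => (p v).penultimate, G.dist r, fun v hv => ((p v).adj_penultimate
    (hpen v hv)).symm, fun v hv => ?_, fun u v hadj => ?_⟩
  · have hadj := (p v).adj_penultimate (hpen v hv)
    have h1 := hG.dist_eq_dist_add_one_of_adj r hadj
    have h2 := SimpleGraph.dist_le (p v).dropLast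
    have h3 : (p v).dropLast.length + 1 = (p v).length := by
      have := (hpen v hv)
      rw [SimpleGraph.Walk.not_nil_iff_lt_length] at this
      simp only [SimpleGraph.Walk.dropLast, SimpleGraph.Walk.take_length]
      lia
    have h4 := hlen v
    lia
  · have hr : ∀ x y, G.dist r x = G.dist r y + 1 → x ≠ r := by
      rintro x y h rfl
      simp at h
    rcases hG.dist_eq_dist_add_one_of_adj r hadj with h | h
    · exact Or.inl ⟨hr _ _ h, huniq u v hadj h⟩
    · exact Or.inr ⟨hr _ _ h, huniq v u hadj.symm h⟩

/-- The children of `v` in the tree rooted at `r` with parent function `par`. -/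
def children {V : Type*} [Fintype V] [DecidableEq V] (r : V) (par : V → V) (v : V) : Finset V :=
  {u | u ≠ r ∧ par u = v}

theorem mem_children {V : Type*} [Fintype V] [DecidableEq V] {r : V} {par : V → V} {u v : V} :
    u ∈ children r par v ↔ u ≠ r ∧ par u = v := by
  simp [children]

theorem sum_sum_children {V M : Type*} [Fintype V] [DecidableEq V] [AddCommMonoid M] (r : V)
    (par : V → V) (g : V → M) :
    ∑ v, ∑ u ∈ children r par v, g u = ∑ u with u ≠ r, g u := by
  rw [← Finset.sum_fiberwise (Finset.univ.filter (· ≠ r)) par g]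
  refine Finset.sum_congr rfl fun v _ => ?_
  rw [Finset.filter_filter]
  rfl

/-- `x` is a descendant of `u`. -/
inductive IsDescendant {V : Type*} (r : V) (par : V → V) (u : V) : V → Prop
  | refl : IsDescendant r par u u
  | step {x : V} (hx : x ≠ r) (h : IsDescendant r par u (par x)) : IsDescendant r par u x

theorem IsDescendant.of_par {V : Type*} {r : V} {par : V → V} {u x : V} (hu : u ≠ r) (hd : IsDescendant r par u x) :
    IsDescendant r par (par u) x := by
  induction hd with
  | refl => exact .step hu .refl
  | step hx _ ih => exact .step hx ih

namespace IsRooting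

variable {V : Type*} {G : SimpleGraph V} {r : V} {par : V → V} {depth : V → ℕ}

theorem par_ne (h : IsRooting G r par depth) {v : V} (hv : v ≠ r) : par v ≠ v :=
  (h.adj_par v hv).ne'

theorem depth_le (h : IsRooting G r par depth) {u x : V} (hd : IsDescendant r par u x) :
    depth u ≤ depth x := by
  induction hd with
  | refl => exact le_rfl
  | step hx _ ih =>
    have := h.depth_par _ hx
    lia

theorem eq_of_isDescendant (h : IsRooting G r par depth) {u w x : V}
    (hu : IsDescendant r par u x) (hw : IsDescendant r par w x) (he : depth u = depth w) :
    u = w := by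
  induction hu with
  | refl =>
    cases hw with
    | refl => rfl
    | step hx hw =>
      have := h.depth_le hw
      have := h.depth_par _ hx
      lia
  | step hx hu ih =>
    cases hw with
    | refl =>
      have := h.depth_le hu
      have := h.depth_par _ hx
      lia
    | step _ hw => exact ih hw

theorem edge_injOn (h : IsRooting G r par depth) :
    Set.InjOn (fun v => s(v, par v)) {v | v ≠ r} := by
  intro u hu v hv huv
  rcases Sym2.eq_iff.1 huv with ⟨h1, -⟩ | ⟨h1, h2⟩
  · exact h1
  · have := h.depth_par u hu
    have := h.depth_par v hv
    rw [h2] at *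
    rw [← h1] at *
    lia

theorem mem_edgeSet_iff (h : IsRooting G r par depth) {e : Sym2 V} :
    e ∈ G.edgeSet ↔ ∃ v, v ≠ r ∧ s(v, par v) = e := by
  constructor
  · induction e with | _ u v =>
    intro he
    rcases h.of_adj u v he with ⟨hu, rfl⟩ | ⟨hv, rfl⟩
    · exact ⟨u, hu, rfl⟩
    · exact ⟨v, hv, Sym2.eq_swap⟩
  · rintro ⟨v, hv, rfl⟩
    exact h.adj_par v hv

variable [Fintype V] [DecidableEq V]

open Classical in
theorem cutValue_eq (h : IsRooting G r par depth) (f : Sym2 V → ℕ) (X : Set V) :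
    cutValue G f X =
      ∑ v with v ≠ r, if (v ∈ X ↔ par v ∉ X) then f s(v, par v) else 0 := by
  rw [← Finset.sum_filter]
  unfold cutValue
  refine (Finset.sum_bij (fun v _ => s(v, par v)) ?_ ?_ ?_ ?_).symm
  · intro v hv
    simp only [Finset.mem_filter, Finset.mem_univ, true_and] at hv
    exact mk_mem_cutEdges.2 ⟨h.adj_par v hv.1, hv.2⟩
  · intro u hu v hv huv
    simp only [Finset.mem_filter, Finset.mem_univ, true_and] at hu hv
    exact h.edge_injOn hu.1 hv.1 huv
  · intro e he
    obtain ⟨v, hv, rfl⟩ := h.mem_edgeSet_iff.1 (cutEdges_subset_edgeSet he)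
    refine ⟨v, ?_, rfl⟩
    simp only [Finset.mem_filter, Finset.mem_univ, true_and]
    exact ⟨hv, (mk_mem_cutEdges.1 he).2⟩
  · intro v _
    rfl

theorem starSum_eq (h : IsRooting G r par depth) (f : Sym2 V → ℕ) (v : V) :
    starSum G f v = (if v = r then 0 else f s(v, par v)) +
      ∑ u ∈ children r par v, f s(u, par u) := by
  classical
  have h1 : ∑ u ∈ children r par v, f s(u, par u) = ∑ u ∈ children r par v, f s(v, u) :=
    Finset.sum_congr rfl fun u hu => by rw [(mem_children.1 hu).2, Sym2.eq_swap]
  rw [h1]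
  unfold starSum
  split_ifs with hv
  · rw [zero_add]
    refine Finset.sum_congr ?_ fun _ _ => rfl
    ext u
    simp only [Finset.mem_filter, Finset.mem_univ, true_and, mem_children]
    refine ⟨fun hu => ?_, fun hu => hu.2 ▸ (h.adj_par u hu.1).symm⟩
    rcases h.of_adj v u hu with ⟨h1, -⟩ | h1
    · exact absurd hv h1
    · exact h1
  · have hnot : par v ∉ children r par v := by
      rw [mem_children]
      rintro ⟨h1, h2⟩
      have := h.depth_par v hv
      have := h.depth_par _ h1
      rw [h2] at this
      lia
    rw [← Finset.sum_insert (f := fun u => f s(v, u)) hnot]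
    refine Finset.sum_congr ?_ fun _ _ => rfl
    ext u
    simp only [Finset.mem_filter, Finset.mem_univ, true_and, Finset.mem_insert, mem_children]
    refine ⟨fun hu => ?_, fun hu => ?_⟩
    · rcases h.of_adj v u hu with ⟨-, h1⟩ | h1
      · exact Or.inl h1.symm
      · exact Or.inr h1
    · rcases hu with rfl | hu
      · exact h.adj_par v hv
      · exact hu.2 ▸ (h.adj_par u hu.1).symm

theorem cutValue_singleton (h : IsRooting G r par depth) (f : Sym2 V → ℕ) (v : V) :
    cutValue G f {v} = (if v = r then 0 else f s(v, par v)) +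
      ∑ u ∈ children r par v, f s(u, par u) := by
  classical
  rw [h.cutValue_eq]
  trans ∑ u with u ≠ r,
    ((if u = v then f s(u, par u) else 0) + (if par u = v then f s(u, par u) else 0))
  · refine Finset.sum_congr rfl fun u hu => ?_
    have hne := h.par_ne (Finset.mem_filter.1 hu).2
    simp only [Set.mem_singleton_iff]
    by_cases h1 : u = v
    · subst h1
      simp [hne]
    · by_cases h2 : par u = v <;> simp [h1, h2]
  rw [Finset.sum_add_distrib]
  congr 1
  · rw [Finset.sum_ite_eq']
    by_cases hv : v = r <;> simp [hv]
  · rw [← Finset.sum_filter, Finset.filter_filter]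
    rfl

end IsRooting

/-! ### Distributing the flow over the children of one vertex -/

/-- `x = a u`, `y = b u`, `z = u + 1`, `w = t u` for a maximizer `u` of `a` over `C`, and
`x = y = z = w = 0` if `a` vanishes on `C`. -/
def IsArgmax {n : ℕ} (a b t : Fin n → ℕ) (C : Finset (Fin n)) (x y z w : ℕ) : Prop :=
  (x = 0 ∧ y = 0 ∧ z = 0 ∧ w = 0 ∧ ∀ u ∈ C, a u = 0) ∨
    ∃ u ∈ C, x = a u ∧ y = b u ∧ z = u.val + 1 ∧ w = t u ∧ 0 < x ∧ ∀ u' ∈ C, a u' ≤ x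

/-- The amounts `k` are obtained from `a` by greedily distributing `R₀` over the members of `C`
without exceeding `b`; the amount `R` is left. -/
structure IsGreedyShare {n : ℕ} (a b k : Fin n → ℕ) (C : Finset (Fin n)) (R₀ R : ℕ) : Prop where
  bounds : ∀ u ∈ C, a u ≤ k u ∧ k u ≤ b u
  even : Even R₀ → Even R ∧ ∀ u ∈ C, k u % 2 = a u % 2
  sum_eq : ∑ u ∈ C, k u + R = ∑ u ∈ C, a u + R₀
  exhausted : 0 < R → ∀ u ∈ C, k u = b u

/-- The flow values `k` on the edges to the children `C` of a nonterminal with flow `q` on the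
parent edge are admissible, and they match the three cases of the cut-system. -/
structure IsBalanced {n : ℕ} (a b t k : Fin n → ℕ) (C : Finset (Fin n)) (q ao B w : ℕ) :
    Prop where
  le : ∀ u ∈ C, k u ≤ b u ∧ (k u ≤ a u ∨ k u % 2 = a u % 2)
  even : Even (q + ∑ u ∈ C, k u)
  two_mul_le : ∀ u ∈ C, 2 * k u ≤ q + ∑ u ∈ C, k u
  le_sum : q ≤ ∑ u ∈ C, k u
  of_ge : ao ≤ q → q % 2 = ao % 2 → ∀ u ∈ C, a u ≤ k u ∧ k u % 2 = a u % 2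
  of_eq : q = B → ∀ u ∈ C, k u = b u
  of_le : q ≤ ao → 2 ≤ ao → ∃ u₀ ∈ C, w = t u₀ ∧ k u₀ ≤ a u₀ ∧ 2 ≤ a u₀ ∧
    (∀ u ∈ C, u ≠ u₀ → k u = b u) ∧ k u₀ = q + ∑ u ∈ C.erase u₀, k u

theorem Finset.sum_mod_two_congr {ι : Type*} {C : Finset ι} {a b : ι → ℕ}
    (h2 : ∀ u ∈ C, b u % 2 = a u % 2) : (∑ u ∈ C, b u) % 2 = (∑ u ∈ C, a u) % 2 := by
  rw [Finset.sum_nat_mod, Finset.sum_nat_mod C 2 a, Finset.sum_congr rfl h2]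

theorem IsGreedyShare.eq_of_sum_le {n : ℕ} {a b k : Fin n → ℕ} {C : Finset (Fin n)} {R₀ R : ℕ}
    (h : IsGreedyShare a b k C R₀ R) (hle : ∑ u ∈ C, b u ≤ ∑ u ∈ C, a u + R₀) :
    ∀ u ∈ C, k u = b u := by
  rcases Nat.eq_zero_or_pos R with hR | hR
  · have h1 := h.sum_eq
    have h2 : ∑ u ∈ C, k u ≤ ∑ u ∈ C, b u := Finset.sum_le_sum fun u hu => (h.bounds u hu).2
    exact (Finset.sum_eq_sum_iff_of_le fun u hu => (h.bounds u hu).2).1 (by lia)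
  · exact h.exhausted hR

theorem IsGreedyShare.sum_eq_of_le {n : ℕ} {a b k : Fin n → ℕ} {C : Finset (Fin n)} {R₀ R : ℕ}
    (h : IsGreedyShare a b k C R₀ R) (hle : ∑ u ∈ C, a u + R₀ ≤ ∑ u ∈ C, b u) :
    ∑ u ∈ C, k u = ∑ u ∈ C, a u + R₀ := by
  rcases Nat.eq_zero_or_pos R with hR | hR
  · have h1 := h.sum_eq
    lia
  · have h1 := h.sum_eq
    rw [Finset.sum_congr rfl (h.exhausted hR)] at h1 ⊢
    lia

section Balanced

variable {n : ℕ} {a b t k : Fin n → ℕ} {C : Finset (Fin n)} {A B mx mb m w ao q R₀ R red : ℕ}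

/-- When the parent edge carries more than the sum of the lower values, the children receive exactly
`q` in total. The parent edge then carries half of the flow at the vertex, and no child can exceed
that half. -/
theorem isBalanced_of_lt (hab : ∀ u ∈ C, a u ≤ b u) (hpar : ∀ u ∈ C, b u % 2 = a u % 2)
    (hA : A = ∑ u ∈ C, a u) (hB : B = ∑ u ∈ C, b u) (hm : IsArgmax a b t C mx mb m w)
    (hao : ao = max (mx + mb - B) (A % 2)) (hqB : q ≤ B) (hq : q ≤ ao ∨ q % 2 = ao % 2)
    (hlt : A < q) (hk : IsGreedyShare a b k C (q - A) R) :
    IsBalanced a b t k C q ao B w := by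
  have hBA : B % 2 = A % 2 := by rw [hA, hB, Finset.sum_mod_two_congr hpar]
  have hAB : A ≤ B := by rw [hA, hB]; exact Finset.sum_le_sum hab
  have hmx : mx ≤ A ∧ mb ≤ B ∧ mb % 2 = mx % 2 := by
    rcases hm with ⟨h1, h2, -⟩ | ⟨u, hu, h1, h2, -⟩
    · simp [h1, h2]
    · rw [hA, hB, h1, h2]
      exact ⟨Finset.single_le_sum (f := a) (fun _ _ => Nat.zero_le _) hu,
        Finset.single_le_sum (f := b) (fun _ _ => Nat.zero_le _) hu, hpar u hu⟩
  have haoA : ao ≤ A ∧ ao % 2 = A % 2 := by omega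
  have hqA : q % 2 = A % 2 := by omega
  have hsum : ∑ u ∈ C, k u = q := by
    have := hk.sum_eq_of_le (by lia)
    lia
  have heven := (hk.even (by rw [Nat.even_iff]; omega)).2
  have hle : ∀ u ∈ C, k u ≤ q := fun u hu => by
    rw [← hsum]
    exact Finset.single_le_sum (f := k) (fun _ _ => Nat.zero_le _) hu
  refine ⟨fun u hu => ⟨(hk.bounds u hu).2, Or.inr (heven u hu)⟩, ?_, fun u hu => ?_, hsum.ge,
    fun _ _ u hu => ⟨(hk.bounds u hu).1, heven u hu⟩, fun h => ?_, fun h _ => ?_⟩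
  · rw [hsum]
    exact ⟨q, rfl⟩
  · have := hle u hu
    lia
  · exact hk.eq_of_sum_le (by lia)
  · lia

/-- Here `A'` and `B'` are the sums over the siblings of the maximal child, and `D` is the amount by
which that child exceeds the rest, or just the parity defect. The even part of `D` is met by raising
siblings as far as their room `av` permits, and what remains is taken from the maximal child. The
equation `A + q + R₀ + red = 2 * mx` says that this child finally carries exactly half of the flow.
-/
theorem deficit_cases {A' B' D av : ℕ} (hA : mx + A' = A) (hB : mb + B' = B)
    (hle : A' ≤ B') (hpar : B' % 2 = A' % 2)
    (hD : D = max (2 * mx - (A + q)) ((A + q) % 2))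
    (hav : av = (B - mb) - (A - mx)) (hR₀ : R₀ = min (D - D % 2) av)
    (hred : red = max (D - av) (D % 2)) :
    R₀ % 2 = 0 ∧ A' + R₀ ≤ B' ∧
    ((2 * mx ≤ A + q ∧ R₀ = 0 ∧ red = (A + q) % 2) ∨
      (A + q + R₀ + red = 2 * mx ∧ red ≤ 1) ∨
      (A + q + R₀ + red = 2 * mx ∧ A' + R₀ = B')) := by
  have hav' : av = B' - A' := by lia
  clear hav
  have h1 : av % 2 = 0 := by omega
  have h2 : D % 2 = (A + q) % 2 := by omega
  rcases le_or_gt (2 * mx) (A + q) with h3 | h3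
  · have h4 : D = (A + q) % 2 := by omega
    have h5 : R₀ = 0 := by omega
    have h6 : red = (A + q) % 2 := by omega
    exact ⟨by lia, by lia, Or.inl ⟨h3, h5, h6⟩⟩
  · have h4 : D = 2 * mx - (A + q) := by omega
    clear hD
    rcases le_or_gt D av with h5 | h5
    · have h6 : R₀ = D - D % 2 := by omega
      have h7 : red = D % 2 := by omega
      exact ⟨by omega, by omega, Or.inr (Or.inl (by omega))⟩
    · have h6 : R₀ = av := by omega
      have h7 : red = D - av := by omega
      exact ⟨by omega, by omega, Or.inr (Or.inr (by omega))⟩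

/-- For a sibling `x ≤ y + R₀`. Without deficit `R₀ = 0`, and `2 * y ≤ A' + mx` suffices, up to
rounding to an even number. Otherwise the half is `q + A' + R₀`, which is at least `y + R₀`. -/
theorem two_mul_le_of_deficit_cases {A' K' x y : ℕ} (hA : mx + A' = A) (hK : K' = A' + R₀)
    (hred : red ≤ mx)
    (h : (2 * mx ≤ A + q ∧ R₀ = 0 ∧ red = (A + q) % 2) ∨ A + q + R₀ + red = 2 * mx)
    (hy : y ≤ A') (hy' : y ≤ mx) (hx : x + A' ≤ y + K') : 2 * x ≤ q + (mx - red + K') := by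
  rcases h with ⟨h1, h2, h3⟩ | h
  · subst h2
    omega
  · omega

theorem deficit_conclusions {A' B' : ℕ} (hA : mx + A' = A) (hB : mb + B' = B) (h0 : 0 < mx)
    (hm : mx ≤ mb)
    (hle : A' ≤ B') (hpar : B' % 2 = A' % 2) (hpar0 : mb % 2 = mx % 2)
    (hao : ao = max (mx - B') (A % 2)) (hq : q ≤ ao ∨ q % 2 = ao % 2)
    (hqA : q ≤ A) (hR2 : R₀ % 2 = 0) (hRav : A' + R₀ ≤ B')
    (h : (2 * mx ≤ A + q ∧ R₀ = 0 ∧ red = (A + q) % 2) ∨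
      (A + q + R₀ + red = 2 * mx ∧ red ≤ 1) ∨
      (A + q + R₀ + red = 2 * mx ∧ A' + R₀ = B')) :
    red ≤ mx ∧ (q + (mx - red + (A' + R₀))) % 2 = 0 ∧
    2 * (mx - red) ≤ q + (mx - red + (A' + R₀)) ∧ q ≤ mx - red + (A' + R₀) ∧
    (ao ≤ q → q % 2 = ao % 2 → red = 0) ∧ (q = B → red = 0 ∧ mx = mb ∧ B' ≤ A') ∧
    (q ≤ ao → 2 ≤ ao → A' + R₀ = B' ∧ mx = B' + q + red ∧ 2 ≤ mx) := by
  -- The congruences are replaced by explicit doubles, so that the remaining case distinctions are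
  -- nearly free of remainders.
  obtain ⟨d, rfl⟩ : ∃ d, B' = A' + 2 * d := ⟨(B' - A') / 2, by omega⟩
  obtain ⟨e, rfl⟩ : ∃ e, mb = mx + 2 * e := ⟨(mb - mx) / 2, by omega⟩
  obtain ⟨p, rfl⟩ : ∃ p, R₀ = 2 * p := ⟨R₀ / 2, by omega⟩
  clear hpar hpar0 hR2 hle hm
  have hA2 : ao % 2 = A % 2 := by omega
  have hao' : (ao = mx - (A' + 2 * d) ∧ A' + 2 * d < mx) ∨ (mx ≤ A' + 2 * d ∧ ao ≤ 1) := by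
    omega
  have hq2 : q ≤ ao ∨ (A + q) % 2 = 0 := by omega
  clear hao hq
  have h1 : red ≤ mx := by
    rcases h with h | h | h <;> rcases hq2 with h2 | h2 <;> rcases hao' with h3 | h3 <;> omega
  obtain ⟨y, rfl⟩ : ∃ y, mx = red + y := ⟨mx - red, by lia⟩
  rw [Nat.add_sub_cancel_left]
  refine ⟨h1, ?_, ?_, ?_, fun h2 h3 => ?_, fun h2 => ?_, fun h2 h3 => ?_⟩
  · clear hao' hq2
    rcases h with h | h | h <;> omega
  · clear hao' hq2
    rcases h with h | h | h <;> omega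
  · rcases h with h | h | h
    · clear hao'
      omega
    · clear hao' hq2
      omega
    · clear hao' hq2
      omega
  · have h4 : (A + q) % 2 = 0 := by omega
    clear hA2 hq2
    rcases h with h | h | h <;> rcases hao' with h5 | h5 <;> omega
  · clear hao' hq2 hA2
    rcases h with h | h | h <;> omega
  · clear hA2
    rcases hao' with h5 | h5
    · rcases h with h | h | h <;> omega
    · omega

theorem isBalanced_of_le (hab : ∀ u ∈ C, a u ≤ b u) (hpar : ∀ u ∈ C, b u % 2 = a u % 2)
    (hA : A = ∑ u ∈ C, a u) (hB : B = ∑ u ∈ C, b u) (hm : IsArgmax a b t C mx mb m w)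
    (hao : ao = max (mx + mb - B) (A % 2)) (hq : q ≤ ao ∨ q % 2 = ao % 2)
    (hle : q ≤ A) {D av : ℕ} (hD : D = max (2 * mx - (A + q)) ((A + q) % 2))
    (hav : av = (B - mb) - (A - mx)) (hR₀ : R₀ = min (D - D % 2) av)
    (hred : red = max (D - av) (D % 2))
    (hk : IsGreedyShare a b k (C.filter fun u => m ≠ u.val + 1) R₀ R)
    (hkm : ∀ u ∈ C, m = u.val + 1 → k u = a u - red) :
    IsBalanced a b t k C q ao B w := by
  rcases hm with ⟨rfl, rfl, rfl, rfl, h0⟩ | ⟨u₀, hu₀, hmx, hmb, rfl, rfl, hpos, hmax⟩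
  -- No child has positive `a`. Then `q ≤ A = 0`, there is neither deficit nor parity defect, and
  -- all flows below vanish.
  · have hA0 : A = 0 := by rw [hA]; exact Finset.sum_eq_zero h0
    have hq0 : q = 0 := by lia
    subst hq0
    have hR0 : R₀ = 0 := by omega
    have hfilter : (C.filter fun u => 0 ≠ u.val + 1) = C :=
      Finset.filter_true_of_mem fun u _ => by lia
    rw [hfilter] at hk
    have hs := hk.sum_eq
    have hk0 : ∀ u ∈ C, k u = 0 := by
      have : ∑ u ∈ C, k u = 0 := by lia
      simpa using this
    have hs0 : ∑ u ∈ C, k u = 0 := Finset.sum_eq_zero hk0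
    refine ⟨fun u hu => by simp [hk0 u hu], by simp [hs0], fun u hu => by simp [hk0 u hu],
      by simp, fun _ _ u hu => by simp [hk0 u hu, h0 u hu], fun h u hu => ?_, fun _ h => ?_⟩
    · have : ∑ u ∈ C, b u = 0 := by lia
      rw [hk0 u hu]
      exact ((Finset.sum_eq_zero_iff.1 this) u hu).symm
    · omega
  · have hfilter : (C.filter fun u => u₀.val + 1 ≠ u.val + 1) = C.erase u₀ := by
      ext u
      simp only [Finset.mem_filter, Finset.mem_erase, ne_eq, Nat.add_right_cancel_iff,
        Fin.val_inj]
      tauto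
    rw [hfilter] at hk
    have hk0 : k u₀ = mx - red := by rw [hkm u₀ hu₀ rfl, hmx]
    have habe : ∀ u ∈ C.erase u₀, a u ≤ b u := fun u hu => hab u (Finset.mem_of_mem_erase hu)
    have hpare : ∀ u ∈ C.erase u₀, b u % 2 = a u % 2 :=
      fun u hu => hpar u (Finset.mem_of_mem_erase hu)
    have hA' := Finset.add_sum_erase _ a hu₀
    have hB' := Finset.add_sum_erase _ b hu₀
    have hK' := Finset.add_sum_erase _ k hu₀
    have hpar' := Finset.sum_mod_two_congr hpare
    have hle' := Finset.sum_le_sum habe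
    have hab0 := hab u₀ hu₀
    have hpar0 := hpar u₀ hu₀
    have hKsum := hk.sum_eq_of_le
    have hKeq := hk.eq_of_sum_le
    rw [← hA, ← hmx] at hA'
    rw [← hB, ← hmb] at hB'
    rw [← hmx, ← hmb] at hab0 hpar0
    rw [hk0] at hK'
    have hsingle : ∀ u ∈ C.erase u₀, a u ≤ ∑ u ∈ C.erase u₀, a u ∧
        k u + (∑ u ∈ C.erase u₀, a u) ≤ a u + ∑ u ∈ C.erase u₀, k u := by
      intro u hu
      refine ⟨Finset.single_le_sum (f := a) (fun _ _ => Nat.zero_le _) hu, ?_⟩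
      have h1 := Finset.add_sum_erase _ a hu
      have h2 := Finset.add_sum_erase _ k hu
      have h3 : ∑ x ∈ (C.erase u₀).erase u, a x ≤ ∑ x ∈ (C.erase u₀).erase u, k x :=
        Finset.sum_le_sum fun x hx => (hk.bounds x (Finset.mem_of_mem_erase hx)).1
      lia
    generalize hA'' : ∑ u ∈ C.erase u₀, a u = A' at *
    generalize hB'' : ∑ u ∈ C.erase u₀, b u = B' at *
    generalize hK'' : ∑ u ∈ C.erase u₀, k u = K' at *
    obtain ⟨hR2, hRav, hD3⟩ := deficit_cases hA' hB' hle' hpar' hD hav hR₀ hred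
    have hK := hKsum hRav
    obtain ⟨hredmx, c1, c2, c3, c4, c5, c6⟩ := deficit_conclusions hA' hB' hpos hab0 hle' hpar' hpar0
      (by rw [hao, ← hB', Nat.add_comm mx mb, Nat.add_sub_add_left]) hq hle hR2 hRav hD3
    rw [← hK] at c1 c2 c3
    clear hD hav hR₀ hred hA hB hq hao
    have heven := (hk.even (Nat.even_iff.2 hR2)).2
    have hcases : ∀ u ∈ C, u = u₀ ∨ u ∈ C.erase u₀ := fun u hu => by
      by_cases h : u = u₀
      · exact Or.inl h
      · exact Or.inr (Finset.mem_erase.2 ⟨h, hu⟩)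
    refine ⟨fun u hu => ?_, ?_, fun u hu => ?_, ?_, fun h1 h2 u hu => ?_, fun h u hu => ?_,
      fun h1 h2 => ?_⟩
    · rcases hcases u hu with rfl | hu'
      · rw [hk0, ← hmx, ← hmb]
        lia
      · exact ⟨(hk.bounds u hu').2, Or.inr (heven u hu')⟩
    · rw [Nat.even_iff, ← hK']
      exact c1
    · rw [← hK']
      rcases hcases u hu with rfl | hu'
      · rwa [hk0]
      · have h3 := hsingle u hu'
        exact two_mul_le_of_deficit_cases hA' hK hredmx
          (hD3.imp_right fun h => h.elim And.left And.left) h3.1 (hmax u hu) h3.2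
    · rwa [← hK']
    · rcases hcases u hu with rfl | hu'
      · rw [hk0, c4 h1 h2, ← hmx]
        simp
      · exact ⟨(hk.bounds u hu').1, heven u hu'⟩
    · obtain ⟨h1, h2, h3⟩ := c5 h
      rcases hcases u hu with rfl | hu'
      · rw [hk0, ← hmb, h1, h2, Nat.sub_zero]
      · exact hKeq (h3.trans (Nat.le_add_right _ _)) u hu'
    · obtain ⟨h4, h5, h6⟩ := c6 h1 h2
      refine ⟨u₀, hu₀, rfl, by rw [hk0, ← hmx]; exact Nat.sub_le _ _, hmx ▸ h6,
        fun u hu hne => ?_, ?_⟩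
      · exact hKeq h4.ge u (Finset.mem_erase.2 ⟨hne, hu⟩)
      · rw [hk0, hK'', hK, h4, h5, Nat.add_sub_cancel, Nat.add_comm]

end Balanced

namespace IsRooting

variable {V : Type*} {G : SimpleGraph V} {r : V} {par : V → V} {depth : V → ℕ}

theorem down_induction (h : IsRooting G r par depth) {P : V → Prop} (hr : P r)
    (hs : ∀ v, v ≠ r → P (par v) → P v) (v : V) : P v := by
  induction hd : depth v using Nat.strong_induction_on generalizing v with
  | _ d ih =>
    by_cases hv : v = r
    · rwa [hv]
    · have := h.depth_par v hv
      exact hs v hv (ih _ (by lia) _ rfl)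

theorem up_induction [Fintype V] [DecidableEq V] (h : IsRooting G r par depth) {P : V → Prop}
    (hs : ∀ v, (∀ u ∈ children r par v, P u) → P v) (v : V) : P v := by
  induction hd : Finset.univ.sup depth - depth v using Nat.strong_induction_on generalizing v with
  | _ d ih =>
    refine hs v fun u hu => ?_
    obtain ⟨hur, rfl⟩ := mem_children.1 hu
    have h1 := h.depth_par u hur
    have h2 := Finset.le_sup (f := depth) (Finset.mem_univ u)
    exact ih _ (by lia) _ rfl

end IsRooting

/-! ### The dynamic program and the relation of labels to flow -/

/-- The quantities that the algorithm computes at the vertices. Those of `v` that concern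
an edge (`c`, `a`, `b`, `k`) belong to the edge between `v` and its parent. -/
structure Tables (n : ℕ) where
  (c a b ao A B mx mb m tin tt k lab red ex : Fin n → ℕ)

/-- The values computed from the leaves to the root: between `a` and `b` lie the amounts of flow
across an edge that are optimal for the subtree below. -/
structure IsBottomUp {n : ℕ} (r : Fin n) (par : Fin n → Fin n) (T : Finset (Fin n))
    (D : Tables n) : Prop where
  ao_eq : ∀ v, v ≠ r →
    -- At a terminal, `c + 1` forces `c < ao`: then `a = b = c`, and the labelling rule lets every
    -- terminal other than the root label itself.
    D.ao v = if v ∈ T then D.c v + 1 else max (D.mx v + D.mb v - D.B v) (D.A v % 2)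
  a_eq : ∀ v, v ≠ r → D.a v = min (D.ao v) (D.c v)
  b_eq : ∀ v, v ≠ r → D.b v =
    min (if v ∈ T then D.c v else D.B v) (D.a v + (D.c v - D.a v) / 2 + (D.c v - D.a v) / 2)
  tt_eq : ∀ v, v ≠ r → D.tt v = if v ∈ T then v.val + 1 else D.tin v
  A_eq : ∀ p, D.A p = ∑ u ∈ children r par p, D.a u
  B_eq : ∀ p, D.B p = ∑ u ∈ children r par p, D.b u
  argmax : ∀ p, IsArgmax D.a D.b D.tt (children r par p) (D.mx p) (D.mb p) (D.m p) (D.tin p)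

/-- The way in which the flow on the parent edge of `p` is distributed over the children. -/
def IsMode {n : ℕ} (T : Finset (Fin n)) (D : Tables n) (p : Fin n) (R₀ : ℕ) : Prop :=
  -- The value `ex p = 0` excepts no child, as children are encoded by `u + 1`.
  (p ∈ T ∧ R₀ = D.B p - D.A p ∧ D.ex p = 0) ∨
  (p ∉ T ∧ D.A p < D.k p ∧ R₀ = D.k p - D.A p ∧ D.ex p = 0) ∨
  -- The maximal child is excepted from the greedy distribution: its siblings may rise by at most
  -- `R₀`, while it is itself lowered by `red`. Here `q` is the deficit and `av` the room of the
  -- siblings.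
  (p ∉ T ∧ D.k p ≤ D.A p ∧ D.ex p = D.m p ∧ ∃ q av,
    q = max (2 * D.mx p - (D.A p + D.k p)) ((D.A p + D.k p) % 2) ∧
    av = (D.B p - D.mb p) - (D.A p - D.mx p) ∧
    R₀ = min (q - q % 2) av ∧ D.red p = max (q - av) (q % 2))

/-- The values computed from the root to the leaves: the flow and the labels of the cut-system. -/
structure IsTopDown {n : ℕ} (r : Fin n) (par : Fin n → Fin n) (T : Finset (Fin n))
    (D : Tables n) : Prop where
  mode : ∀ p, ∃ R₀ R, IsMode T D p R₀ ∧
    IsGreedyShare D.a D.b D.k ((children r par p).filter fun u => D.ex p ≠ u.val + 1) R₀ R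
  k_ex : ∀ p, ∀ u ∈ children r par p, D.ex p = u.val + 1 → D.k u = D.a u - D.red p
  lab_root : D.lab r = r.val + 1
  lab_eq : ∀ v, v ≠ r → D.lab v =
    if D.c v < D.ao v then D.tt v
    else if D.lab (par v) ≠ D.tt v ∧ D.c v < D.B v then 0 else D.lab (par v)

/-- The relation of the parent's label to the flow on the edge above `v`. -/
def IsUpper {n : ℕ} (r : Fin n) (par : Fin n → Fin n) (T : Finset (Fin n)) (D : Tables n)
    (v : Fin n) : Prop :=
  -- The three cases are: the parent is assigned to the terminal below `v`, it is uncovered, or it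
  -- is assigned to a terminal not below `v`. In the last case the edge has to carry as much as
  -- possible, away from that terminal.
  (D.lab (par v) = D.tt v ∧ D.lab (par v) ≠ 0 ∧ D.k v ≤ D.a v ∧ 2 ≤ D.a v) ∨
  (D.lab (par v) = 0 ∧ D.a v ≤ D.k v ∧ D.k v % 2 = D.a v % 2) ∨
  (∃ t ∈ T, D.lab (par v) = t.val + 1 ∧ ¬ IsDescendant r par v t ∧ D.k v = D.b v)

/-- The relation of the label of `v` to the flow on the edge above `v`. -/
def IsLower {n : ℕ} (r : Fin n) (par : Fin n → Fin n) (T : Finset (Fin n)) (D : Tables n)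
    (v : Fin n) : Prop :=
  (v ∈ T ∧ D.lab v = v.val + 1) ∨
  (v ∉ T ∧ D.lab v = D.tt v ∧ D.lab v ≠ 0 ∧ D.k v ≤ D.ao v ∧ 2 ≤ D.ao v) ∨
  (v ∉ T ∧ D.lab v = 0 ∧ D.ao v ≤ D.k v ∧ D.k v % 2 = D.ao v % 2 ∧ D.a v = D.ao v) ∨
  (v ∉ T ∧ D.lab v = D.lab (par v) ∧
    (∃ t ∈ T, D.lab v = t.val + 1 ∧ ¬ IsDescendant r par v t) ∧ D.k v = D.B v)

section Tables

variable {n : ℕ} {G : SimpleGraph (Fin n)} {r : Fin n} {par : Fin n → Fin n}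
  {depth : Fin n → ℕ} {T : Finset (Fin n)} {D : Tables n}

theorem IsArgmax.facts {a b t : Fin n → ℕ} {C : Finset (Fin n)} {x y z w : ℕ}
    (h : IsArgmax a b t C x y z w) (hpar : ∀ u ∈ C, b u % 2 = a u % 2) :
    x ≤ ∑ u ∈ C, a u ∧ y ≤ ∑ u ∈ C, b u ∧ y % 2 = x % 2 := by
  rcases h with ⟨rfl, rfl, -⟩ | ⟨u, hu, rfl, rfl, -⟩
  · simp
  · exact ⟨Finset.single_le_sum (f := a) (fun _ _ => Nat.zero_le _) hu,
      Finset.single_le_sum (f := b) (fun _ _ => Nat.zero_le _) hu, hpar u hu⟩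

/-- Since `mx + mb` is even, a positive value of `mx + mb - B` has the parity of `B`, which is that
of `A`; and it is at most `mx` because `mb ≤ B`. -/
theorem IsBottomUp.ao_facts (hD : IsBottomUp r par T D) {v : Fin n} (hv : v ≠ r) (hT : v ∉ T)
    (hab : ∀ u ∈ children r par v, D.a u ≤ D.b u)
    (hpar : ∀ u ∈ children r par v, D.b u % 2 = D.a u % 2) :
    D.ao v ≤ D.A v ∧ D.A v ≤ D.B v ∧ D.ao v % 2 = D.A v % 2 ∧ D.B v % 2 = D.A v % 2 := by
  have h1 := (hD.argmax v).facts hpar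
  have h2 : D.A v ≤ D.B v := by
    rw [hD.A_eq, hD.B_eq]
    exact Finset.sum_le_sum hab
  have h3 : D.B v % 2 = D.A v % 2 := by
    rw [hD.A_eq, hD.B_eq]
    exact Finset.sum_mod_two_congr hpar
  have h4 := hD.ao_eq v hv
  rw [if_neg hT] at h4
  rw [← hD.A_eq, ← hD.B_eq] at h1
  refine ⟨by omega, h2, by omega, h3⟩

/-- Induction from the leaves: the common parity of the children's values passes to the sums. If `a
= ao`, then `B` has the parity of `a`, so the minimum in `b` does too; if `a = c < ao`, then `b =
c`. -/
theorem IsBottomUp.bounds (hR : IsRooting G r par depth) (hD : IsBottomUp r par T D) (v : Fin n) :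
    v ≠ r → D.a v ≤ D.b v ∧ D.b v ≤ D.c v ∧ D.b v % 2 = D.a v % 2 := by
  refine hR.up_induction (P := fun v => v ≠ r → D.a v ≤ D.b v ∧ D.b v ≤ D.c v ∧
    D.b v % 2 = D.a v % 2) (fun v ih hv => ?_) v
  have ha := hD.a_eq v hv
  have hb := hD.b_eq v hv
  by_cases hT : v ∈ T
  · rw [if_pos hT] at hb
    omega
  · have hch : ∀ u ∈ children r par v, u ≠ r := fun u hu => (mem_children.1 hu).1
    obtain ⟨h1, h2, h3, h4⟩ := hD.ao_facts hv hT (fun u hu => (ih u hu (hch u hu)).1)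
      (fun u hu => (ih u hu (hch u hu)).2.2)
    rw [if_neg hT] at hb
    omega

theorem IsBottomUp.ao_facts' (hR : IsRooting G r par depth) (hD : IsBottomUp r par T D)
    {v : Fin n} (hv : v ≠ r) (hT : v ∉ T) :
    D.ao v ≤ D.A v ∧ D.A v ≤ D.B v ∧ D.ao v % 2 = D.A v % 2 ∧ D.B v % 2 = D.A v % 2 :=
  hD.ao_facts hv hT (fun u hu => (hD.bounds hR u (mem_children.1 hu).1).1)
    (fun u hu => (hD.bounds hR u (mem_children.1 hu).1).2.2)

theorem IsBottomUp.b_le (hD : IsBottomUp r par T D)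
    {v : Fin n} (hv : v ≠ r) (hT : v ∉ T) : D.b v ≤ D.B v := by
  have hb := hD.b_eq v hv
  rw [if_neg hT] at hb
  lia

/-- A positive `a` is inherited from a maximal child with positive `a`; following these children
ends at a terminal, which is what `tt` encodes. -/
theorem IsBottomUp.tt_facts (hR : IsRooting G r par depth) (hD : IsBottomUp r par T D)
    (v : Fin n) : v ≠ r → (0 < D.a v → D.tt v ≠ 0) ∧
      (D.tt v ≠ 0 → ∃ t ∈ T, D.tt v = t.val + 1 ∧ IsDescendant r par v t) := by
  refine hR.up_induction (P := fun v => v ≠ r → (0 < D.a v → D.tt v ≠ 0) ∧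
      (D.tt v ≠ 0 → ∃ t ∈ T, D.tt v = t.val + 1 ∧ IsDescendant r par v t))
      (fun v ih hv => ?_) v
  have ht := hD.tt_eq v hv
  by_cases hT : v ∈ T
  · rw [if_pos hT] at ht
    exact ⟨fun _ => by lia, fun _ => ⟨v, hT, ht, .refl⟩⟩
  · rw [if_neg hT] at ht
    have hfac := hD.ao_facts' hR hv hT
    have ha := hD.a_eq v hv
    have hA := hD.A_eq v
    rcases hD.argmax v with ⟨-, -, -, h1, h2⟩ | ⟨u, hu, h0, -, -, h1, h2, -⟩
    · rw [ht, h1]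
      rw [Finset.sum_eq_zero h2] at hA
      exact ⟨fun h => by lia, fun h => absurd rfl h⟩
    · obtain ⟨hur, hpu⟩ := mem_children.1 hu
      obtain ⟨h3, h4⟩ := ih u hu hur
      rw [ht, h1]
      refine ⟨fun _ => h3 (h0 ▸ h2), fun h => ?_⟩
      obtain ⟨t, htT, h5, h6⟩ := h4 h
      exact ⟨t, htT, h5, hpu ▸ IsDescendant.of_par hur h6⟩

/-- A terminal needs no balance, so the whole room `B - A` of its children is used. -/
theorem IsTopDown.k_eq_b (hB : IsBottomUp r par T D)
    (hD : IsTopDown r par T D) {p : Fin n} (hp : p ∈ T) : ∀ u ∈ children r par p,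
    D.k u = D.b u := by
  obtain ⟨R₀, R, ⟨-, h1, h2⟩ | h | h, hs⟩ := hD.mode p
  · have hf : ((children r par p).filter fun u => D.ex p ≠ u.val + 1) = children r par p :=
      Finset.filter_true_of_mem fun u _ => by lia
    rw [hf] at hs
    refine hs.eq_of_sum_le ?_
    rw [← hB.A_eq, ← hB.B_eq]
    lia
  · exact absurd hp h.1
  · exact absurd hp h.1

/-- Balance at the parent supplies the hypothesis on the incoming flow, namely that it is at most
`ao` or has its parity. The induction therefore runs downwards from the root, where the terminal `r`
makes the claim void. -/
theorem IsTopDown.balanced (hR : IsRooting G r par depth) (hB : IsBottomUp r par T D)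
    (hD : IsTopDown r par T D) (hr : r ∈ T) (p : Fin n) : p ∉ T →
    IsBalanced D.a D.b D.tt D.k (children r par p) (D.k p) (D.ao p) (D.B p) (D.tin p) := by
  refine hR.down_induction (P := fun p => p ∉ T → IsBalanced D.a D.b D.tt D.k
    (children r par p) (D.k p) (D.ao p) (D.B p) (D.tin p)) (fun h => absurd hr h)
    (fun p hp ih hpT => ?_) p
  have hpc : p ∈ children r par (par p) := mem_children.2 ⟨hp, rfl⟩
  have hbd := hB.bounds hR p hp
  have hkp : D.k p ≤ D.b p ∧ (D.k p ≤ D.a p ∨ D.k p % 2 = D.a p % 2) := by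
    by_cases hT : par p ∈ T
    · rw [hD.k_eq_b hB hT p hpc]
      exact ⟨le_rfl, Or.inr hbd.2.2⟩
    · exact (ih hT).le p hpc
  have hb := hB.b_le hp hpT
  have ha := hB.a_eq p hp
  have hao := hB.ao_eq p hp
  rw [if_neg hpT] at hao
  have hq : D.k p ≤ D.ao p ∨ D.k p % 2 = D.ao p % 2 := by
    rcases le_total (D.ao p) (D.c p) with h | h
    · rw [min_eq_left h] at ha
      rw [← ha]
      exact hkp.2
    · exact Or.inl (by lia)
  have hab : ∀ u ∈ children r par p, D.a u ≤ D.b u :=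
    fun u hu => (hB.bounds hR u (mem_children.1 hu).1).1
  have hpar : ∀ u ∈ children r par p, D.b u % 2 = D.a u % 2 :=
    fun u hu => (hB.bounds hR u (mem_children.1 hu).1).2.2
  obtain ⟨R₀, R, h | ⟨-, h1, h2, h3⟩ | ⟨-, h1, h2, q, av, h3, h4, h5, h6⟩, hs⟩ := hD.mode p
  · exact absurd h.1 hpT
  · have hf : ((children r par p).filter fun u => D.ex p ≠ u.val + 1) = children r par p :=
      Finset.filter_true_of_mem fun u _ => by lia
    rw [hf, h2] at hs
    exact isBalanced_of_lt hab hpar (hB.A_eq p) (hB.B_eq p) (hB.argmax p) hao (by lia) hq h1 hs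
  · have hke := hD.k_ex p
    rw [h2] at hke hs
    exact isBalanced_of_le hab hpar (hB.A_eq p) (hB.B_eq p) (hB.argmax p) hao hq h1 h3 h4 h5 h6
      hs hke

theorem IsTopDown.k_le (hR : IsRooting G r par depth) (hB : IsBottomUp r par T D)
    (hD : IsTopDown r par T D) (hr : r ∈ T) {v : Fin n} (hv : v ≠ r) : D.k v ≤ D.b v := by
  have hvc : v ∈ children r par (par v) := mem_children.2 ⟨hv, rfl⟩
  by_cases hT : par v ∈ T
  · exact (hD.k_eq_b hB hT v hvc).le
  · exact ((hD.balanced hR hB hr _ hT).le v hvc).1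

/-- The branches of the labelling rule move the invariant across a single edge, from its upper to
its lower end. -/
theorem IsUpper.isLower (hR : IsRooting G r par depth) (hB : IsBottomUp r par T D)
    (hD : IsTopDown r par T D) (hr : r ∈ T) (hc : ∀ v, v ≠ r → 1 ≤ D.c v) {v : Fin n}
    (hv : v ≠ r) (h : IsUpper r par T D v) : IsLower r par T D v := by
  have hlab := hD.lab_eq v hv
  have ha := hB.a_eq v hv
  have hao := hB.ao_eq v hv
  have htt := hB.tt_eq v hv
  have hbd := hB.bounds hR v hv
  have hk := hD.k_le hR hB hr hv
  have hc1 := hc v hv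
  obtain ⟨ht1, ht2⟩ := hB.tt_facts hR v hv
  by_cases hT : v ∈ T
  · rw [if_pos hT] at hao htt
    rw [if_pos (by lia)] at hlab
    exact Or.inl ⟨hT, hlab.trans htt⟩
  · rcases lt_or_ge (D.c v) (D.ao v) with hlt | hge
    · rw [if_pos hlt] at hlab
      -- Positivity of the capacity enters here: `a = c ≥ 1` gives a terminal below, and `ao > c`
      -- gives `2 ≤ ao`.
      exact Or.inr (Or.inl ⟨hT, hlab, hlab ▸ ht1 (by lia), by lia, by lia⟩)
    · rw [if_neg (by lia)] at hlab
      have ha' : D.a v = D.ao v := by lia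
      have hfac := hB.ao_facts' hR hv hT
      have hb := hB.b_eq v hv
      rw [if_neg hT] at hb
      rcases h with ⟨h1, h2, h3, h4⟩ | ⟨h1, h2, h3⟩ | ⟨t, htT, h1, h2, h3⟩
      · rw [if_neg (fun h => h.1 h1)] at hlab
        exact Or.inr (Or.inl ⟨hT, hlab.trans h1, hlab ▸ h2, by lia, by lia⟩)
      · rw [h1, ite_self] at hlab
        exact Or.inr (Or.inr (Or.inl ⟨hT, hlab, by lia, by lia, ha'⟩))
      · have hne : D.lab (par v) ≠ D.tt v := by
          intro he
          obtain ⟨t', -, h4, h5⟩ := ht2 (by lia)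
          have : t = t' := Fin.ext (by lia)
          exact h2 (this ▸ h5)
        rcases lt_or_ge (D.c v) (D.B v) with hlt | hge'
        · rw [if_pos ⟨hne, hlt⟩] at hlab
          exact Or.inr (Or.inr (Or.inl ⟨hT, hlab, by lia, by lia, ha'⟩))
        · rw [if_neg (fun h => absurd h.2 (by lia))] at hlab
          -- With `B ≤ c` and `B` of the parity of `a`, the rounding loses nothing, so `b = B`.
          exact Or.inr (Or.inr (Or.inr ⟨hT, hlab, ⟨t, htT, hlab.trans h1, h2⟩, by omega⟩))

/-- Balance at the parent moves the invariant past a vertex. In the second case the terminal lies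
below the maximal child `u₀`, so it is not below any sibling, and the siblings are filled up to `b`.
-/
theorem IsLower.isUpper (hR : IsRooting G r par depth) (hB : IsBottomUp r par T D)
    (hD : IsTopDown r par T D) (hr : r ∈ T) {v : Fin n}
    (hv : v ≠ r) (h : IsLower r par T D (par v)) : IsUpper r par T D v := by
  have hvc : v ∈ children r par (par v) := mem_children.2 ⟨hv, rfl⟩
  rcases h with ⟨h1, h2⟩ | ⟨h1, h2, h3, h4, h5⟩ | ⟨h1, h2, h3, h4, -⟩ | ⟨h1, h2, ⟨t, ht, h3, h4⟩, h5⟩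
  · refine Or.inr (Or.inr ⟨par v, h1, h2, fun hd => ?_, hD.k_eq_b hB h1 v hvc⟩)
    have := hR.depth_le hd
    have := hR.depth_par v hv
    lia
  · have hpr : par v ≠ r := fun h => h1 (h ▸ hr)
    have htt := hB.tt_eq _ hpr
    rw [if_neg h1] at htt
    obtain ⟨u₀, hu₀, g1, g2, g3, g4, -⟩ := (hD.balanced hR hB hr _ h1).of_le h4 h5
    by_cases hvu : v = u₀
    · subst hvu
      exact Or.inl ⟨by rw [h2, htt, g1], h3, g2, g3⟩
    · obtain ⟨t, htT, g5, g6⟩ := (hB.tt_facts hR u₀ (mem_children.1 hu₀).1).2 (by lia)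
      refine Or.inr (Or.inr ⟨t, htT, by lia, fun hd => hvu ?_, g4 v hvc hvu⟩)
      refine hR.eq_of_isDescendant hd g6 ?_
      have e1 := hR.depth_par v hv
      have e2 := hR.depth_par u₀ (mem_children.1 hu₀).1
      rw [(mem_children.1 hu₀).2] at e2
      lia
  · exact Or.inr (Or.inl ⟨h2, (hD.balanced hR hB hr _ h1).of_ge h3 h4 v hvc⟩)
  · exact Or.inr (Or.inr ⟨t, ht, h3, fun hd => h4 (IsDescendant.of_par hv hd),
      (hD.balanced hR hB hr _ h1).of_eq h5 v hvc⟩)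

theorem IsTopDown.isLower (hR : IsRooting G r par depth) (hB : IsBottomUp r par T D)
    (hD : IsTopDown r par T D) (hr : r ∈ T) (hc : ∀ v, v ≠ r → 1 ≤ D.c v) (v : Fin n) :
    IsLower r par T D v :=
  hR.down_induction (P := IsLower r par T D) (Or.inl ⟨hr, hD.lab_root⟩)
    (fun _ hv h => (h.isUpper hR hB hD hr hv).isLower hR hB hD hr hc hv) v

end Tables

/-! ### The labels form a cut-system, and its total flow is that at the terminals -/

/-- The members of the cut-system that is given by the labels. -/
def labelSet {n : ℕ} (lab : Fin n → ℕ) (t : Fin n) : Set (Fin n) :=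
  {v | lab v = t.val + 1}

/-- The data of an optimal solution on the tree `G` rooted at the terminal `r`. -/
structure IsSolved {n : ℕ} (G : SimpleGraph (Fin n)) (r : Fin n) (par : Fin n → Fin n)
    (depth : Fin n → ℕ) (T : Finset (Fin n)) (D : Tables n) : Prop where
  rooting : IsRooting G r par depth
  bottomUp : IsBottomUp r par T D
  topDown : IsTopDown r par T D
  root_mem : r ∈ T
  c_pos : ∀ v, v ≠ r → 1 ≤ D.c v

/-- The number of members of the cut-system whose cut contains the edge above `v`. -/
def cutMultiplicity {n : ℕ} (par : Fin n → Fin n) (lab : Fin n → ℕ) (v : Fin n) : ℕ :=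
  if lab v = lab (par v) then 0
  else (if lab v = 0 then 0 else 1) + (if lab (par v) = 0 then 0 else 1)

namespace IsSolved

variable {n : ℕ} {G : SimpleGraph (Fin n)} {r : Fin n} {par : Fin n → Fin n}
  {depth : Fin n → ℕ} {T : Finset (Fin n)} {D : Tables n}

theorem ne_root (h : IsSolved G r par depth T D) {v : Fin n} (hv : v ∉ T) : v ≠ r :=
  fun e => hv (e ▸ h.root_mem)

theorem isLower (h : IsSolved G r par depth T D) (v : Fin n) : IsLower r par T D v :=
  h.topDown.isLower h.rooting h.bottomUp h.root_mem h.c_pos v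

theorem isUpper (h : IsSolved G r par depth T D) {v : Fin n} (hv : v ≠ r) :
    IsUpper r par T D v :=
  (h.isLower (par v)).isUpper h.rooting h.bottomUp h.topDown h.root_mem hv

theorem balanced (h : IsSolved G r par depth T D) {v : Fin n} (hv : v ∉ T) :
    IsBalanced D.a D.b D.tt D.k (children r par v) (D.k v) (D.ao v) (D.B v) (D.tin v) :=
  h.topDown.balanced h.rooting h.bottomUp h.root_mem v hv

theorem lab_of_mem (h : IsSolved G r par depth T D) {v : Fin n} (hv : v ∈ T) :
    D.lab v = v.val + 1 := by
  rcases h.isLower v with h1 | h1 | h1 | h1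
  · exact h1.2
  all_goals exact absurd hv h1.1

theorem exists_of_lab_ne (h : IsSolved G r par depth T D) {v : Fin n} (hv : D.lab v ≠ 0) :
    ∃ t ∈ T, D.lab v = t.val + 1 := by
  rcases h.isLower v with h1 | h1 | h1 | ⟨-, -, ⟨t, ht, h1, -⟩, -⟩
  · exact ⟨v, h1.1, h1.2⟩
  · obtain ⟨t, ht, h2, -⟩ := (h.bottomUp.tt_facts h.rooting v (h.ne_root h1.1)).2 (by lia)
    exact ⟨t, ht, by lia⟩
  · exact absurd h1.2.1 hv
  · exact ⟨t, ht, h1⟩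

theorem mem_uncovered (h : IsSolved G r par depth T D) {v : Fin n} :
    v ∈ uncovered T (labelSet D.lab) ↔ D.lab v = 0 := by
  constructor
  · intro hv
    by_contra h0
    obtain ⟨t, ht, h1⟩ := h.exists_of_lab_ne h0
    exact hv t ht h1
  · intro h0 t _ h1
    have : D.lab v = t.val + 1 := h1
    lia

theorem reachable_of_lab_eq_tt (h : IsSolved G r par depth T D) (v : Fin n) :
    v ≠ r → ∀ t (hv : v ∈ labelSet D.lab t) (ht : t ∈ labelSet D.lab t), D.lab v = D.tt v →
      (G.induce (labelSet D.lab t)).Reachable ⟨v, hv⟩ ⟨t, ht⟩ := by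
  refine h.rooting.up_induction (P := fun v => v ≠ r → ∀ t (hv : v ∈ labelSet D.lab t)
      (ht : t ∈ labelSet D.lab t), D.lab v = D.tt v →
      (G.induce (labelSet D.lab t)).Reachable ⟨v, hv⟩ ⟨t, ht⟩) (fun v ih hvr t hv ht htt => ?_) v
  have hvt : D.lab v = t.val + 1 := hv
  obtain ⟨t', ht', h3, h4⟩ := (h.bottomUp.tt_facts h.rooting v hvr).2 (by lia)
  rcases h.isLower v with ⟨h1, h2⟩ | ⟨h1, -, h2, h5, h6⟩ | h1 | ⟨-, -, ⟨t'', -, h1, h2⟩, -⟩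
  · obtain rfl : v = t := Fin.ext (by lia)
    exact .rfl
  · obtain ⟨u, hu, g1, g2, g3, -⟩ := (h.balanced h1).of_le h5 h6
    obtain ⟨hur, hpu⟩ := mem_children.1 hu
    have htv := h.bottomUp.tt_eq v hvr
    rw [if_neg h1] at htv
    -- The maximal child has the same lower terminal as `v`. Whichever branch of the labelling rule
    -- applies to it, it gets this label, since the branch leaving it uncovered requires the
    -- parent's label to differ from it.
    have hlu : D.lab u = D.tt u := by
      rcases h.isLower u with e | e | e | e
      · have := h.bottomUp.tt_eq u hur
        rw [if_pos e.1] at this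
        exact e.2.trans this.symm
      · exact e.2.1
      · have hlab := h.topDown.lab_eq u hur
        split_ifs at hlab with e1 e2
        · exact hlab
        · exact absurd (by rw [hpu]; lia) e2.1
        · rw [hpu] at hlab
          lia
      · rw [e.2.1, hpu]
        lia
    have hlu' : D.lab u = t.val + 1 := by lia
    refine SimpleGraph.Reachable.trans (SimpleGraph.Adj.reachable
      (v := (⟨u, hlu'⟩ : labelSet D.lab t)) ?_)
      (ih u hu hur t hlu' ht hlu)
    have := h.rooting.adj_par u hur
    rw [hpu] at this
    exact this.symm
  · exact absurd hvt (by lia)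
  · obtain rfl : t' = t'' := Fin.ext (by lia)
    exact absurd h4 h2

/-- A vertex either owes its label to a terminal below, which is reached by descending, or inherits
it from its parent, which lies in the same set and is closer to the root. -/
theorem reachable (h : IsSolved G r par depth T D) (v : Fin n) :
    ∀ t (hv : v ∈ labelSet D.lab t) (ht : t ∈ labelSet D.lab t),
      (G.induce (labelSet D.lab t)).Reachable ⟨v, hv⟩ ⟨t, ht⟩ := by
  refine h.rooting.down_induction (P := fun v => ∀ t (hv : v ∈ labelSet D.lab t)
      (ht : t ∈ labelSet D.lab t), (G.induce (labelSet D.lab t)).Reachable ⟨v, hv⟩ ⟨t, ht⟩)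
      (fun t hv ht => ?_) (fun v hvr ih t hv ht => ?_) v
  · have hvt : D.lab r = t.val + 1 := hv
    obtain rfl : r = t := Fin.ext (by have := h.topDown.lab_root; lia)
    exact .rfl
  · have hvt : D.lab v = t.val + 1 := hv
    rcases h.isLower v with ⟨-, h2⟩ | ⟨h1, h2, -⟩ | ⟨-, h2, -⟩ | ⟨-, h2, -⟩
    · obtain rfl : v = t := Fin.ext (by lia)
      exact .rfl
    · exact h.reachable_of_lab_eq_tt v hvr t hv ht h2
    · lia
    · have hp : D.lab (par v) = t.val + 1 := by lia
      refine SimpleGraph.Reachable.trans (SimpleGraph.Adj.reachable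
        (v := (⟨par v, hp⟩ : labelSet D.lab t)) ?_)
        (ih t hp ht)
      exact h.rooting.adj_par v hvr

theorem isCutSystem (h : IsSolved G r par depth T D) : IsCutSystem G T (labelSet D.lab) := by
  refine ⟨fun t ht => ⟨?_, ?_⟩, fun t _ t' _ hne => ?_⟩
  · ext v
    simp only [labelSet, Set.mem_inter_iff, Set.mem_ofPred_eq, Finset.mem_coe,
      Set.mem_singleton_iff]
    constructor
    · rintro ⟨h1, h2⟩
      have := h.lab_of_mem h2
      exact Fin.ext (by lia)
    · rintro rfl
      exact ⟨h.lab_of_mem ht, ht⟩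
  · have htl := h.lab_of_mem ht
    refine SimpleGraph.connected_iff_exists_forall_reachable _ |>.2 ⟨⟨t, htl⟩, ?_⟩
    rintro ⟨v, hv⟩
    exact (h.reachable v t hv htl).symm
  · refine Set.disjoint_left.2 fun v h1 h2 => hne (Fin.ext ?_)
    have h1 : D.lab v = t.val + 1 := h1
    have h2 : D.lab v = t'.val + 1 := h2
    lia

theorem isFeasibleFlow (h : IsSolved G r par depth T D) (hG : G.IsTree) {c f : Sym2 (Fin n) → ℕ}
    (hc : ∀ v, v ≠ r → c s(v, par v) = D.c v) (hf : ∀ v, v ≠ r → f s(v, par v) = D.k v) :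
    IsFeasibleFlow G T c f := by
  constructor
  · refine isIntegralFlow_of_isPairable hG.isAcyclic fun v hv => ?_
    have hb := h.balanced hv
    have hvr := h.ne_root hv
    have hS : starSum G f v = D.k v + ∑ u ∈ children r par v, D.k u := by
      rw [h.rooting.starSum_eq, if_neg hvr, hf v hvr]
      congr 1
      exact Finset.sum_congr rfl fun u hu => hf u (mem_children.1 hu).1
    refine ⟨hS ▸ hb.even, fun u hu => ?_⟩
    rw [hS]
    rcases h.rooting.of_adj v u hu with ⟨-, rfl⟩ | ⟨h1, h2⟩
    · rw [hf v hvr]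
      have := hb.le_sum
      lia
    · have := hb.two_mul_le u (mem_children.2 ⟨h1, h2⟩)
      rwa [← hf u h1, h2, Sym2.eq_swap] at this
  · intro e he
    obtain ⟨v, hv, rfl⟩ := h.rooting.mem_edgeSet_iff.1 he
    rw [hc v hv, hf v hv]
    exact (h.topDown.k_le h.rooting h.bottomUp h.root_mem hv).trans
      (h.bottomUp.bounds h.rooting v hv).2.1

theorem sum_cutValue_labelSet (h : IsSolved G r par depth T D) (g : Sym2 (Fin n) → ℕ) :
    ∑ t ∈ T, cutValue G g (labelSet D.lab t) =
      ∑ v with v ≠ r, g s(v, par v) * cutMultiplicity par D.lab v := by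
  classical
  have hone : ∀ v, ∑ t ∈ T, (if D.lab v = t.val + 1 then 1 else 0) =
      if D.lab v = 0 then 0 else 1 := by
    intro v
    split_ifs with h0
    · exact Finset.sum_eq_zero fun t _ => if_neg (by lia)
    · obtain ⟨t, ht, h1⟩ := h.exists_of_lab_ne h0
      rw [Finset.sum_eq_single t (fun t' _ hne => if_neg fun h2 => hne (Fin.ext (by lia)))
        (fun h2 => absurd ht h2), if_pos h1]
  rw [Finset.sum_congr rfl fun t _ => h.rooting.cutValue_eq g (labelSet D.lab t), Finset.sum_comm]
  refine Finset.sum_congr rfl fun v _ => ?_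
  unfold cutMultiplicity
  by_cases heq : D.lab v = D.lab (par v)
  · rw [if_pos heq, mul_zero]
    refine Finset.sum_eq_zero fun t _ => if_neg ?_
    simp only [labelSet, Set.mem_ofPred_eq, heq]
    tauto
  · rw [if_neg heq, ← hone, ← hone, ← Finset.sum_add_distrib, Finset.mul_sum]
    refine Finset.sum_congr rfl fun t _ => ?_
    simp only [labelSet, Set.mem_ofPred_eq]
    by_cases h1 : D.lab v = t.val + 1
    · have h2 : ¬ D.lab (par v) = t.val + 1 := fun h2 => heq (by lia)
      simp [h1, h2]
    · by_cases h2 : D.lab (par v) = t.val + 1 <;> simp [h1, h2]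

/-- Signs are put on the two ends of each edge: at a covered vertex, minus on the edge towards its
terminal and plus on the others; zero at uncovered vertices. Summed around a vertex the signed flow
is `f({v})` at a terminal and zero elsewhere. Summed along an edge the signs give the number of cuts
containing it. Double counting concludes. -/
theorem sum_cutValue_singleton (h : IsSolved G r par depth T D) {f : Sym2 (Fin n) → ℕ}
    (hf : ∀ v, v ≠ r → f s(v, par v) = D.k v) :
    ∑ t ∈ T, cutValue G f {t} = ∑ v with v ≠ r, D.k v * cutMultiplicity par D.lab v := by
  -- For the edge above `v`, `up v` is the sign at its lower end and `dn v` that at its upper end.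
  let up : Fin n → ℤ := fun v => if D.lab v = 0 then 0 else if D.lab v = D.tt v then 1 else -1
  let dn : Fin n → ℤ := fun v =>
    if D.lab (par v) = 0 then 0 else if D.lab (par v) = D.tt v then -1 else 1
  have hdn : ∀ v, v ≠ r → ∀ t : Fin n, D.lab (par v) = t.val + 1 → ¬ IsDescendant r par v t →
      dn v = 1 := by
    intro v hv t h1 h2
    have h3 : D.lab (par v) ≠ D.tt v := by
      intro h3
      obtain ⟨t', -, h4, h5⟩ := (h.bottomUp.tt_facts h.rooting v hv).2 (by lia)
      obtain rfl : t = t' := Fin.ext (by lia)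
      exact h2 h5
    simp only [dn, if_neg h3, if_neg (show D.lab (par v) ≠ 0 by lia)]
  have hupT : ∀ v, v ≠ r → v ∈ T → up v = 1 := by
    intro v hv hT
    have h1 := h.lab_of_mem hT
    have h2 := h.bottomUp.tt_eq v hv
    rw [if_pos hT] at h2
    simp only [up, if_neg (show D.lab v ≠ 0 by lia), if_pos (h1.trans h2.symm)]
  have hupO : ∀ v, v ≠ r → ∀ t : Fin n, D.lab v = t.val + 1 → ¬ IsDescendant r par v t →
      up v = -1 := by
    intro v hv t h1 h2
    have h3 : D.lab v ≠ D.tt v := by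
      intro h3
      obtain ⟨t', -, h4, h5⟩ := (h.bottomUp.tt_facts h.rooting v hv).2 (by lia)
      obtain rfl : t = t' := Fin.ext (by lia)
      exact h2 h5
    simp only [up, if_neg h3, if_neg (show D.lab v ≠ 0 by lia)]
  -- At a nonterminal this says that the edge towards its terminal carries as much as all other
  -- edges together. That edge is the one to the maximal child `u₀` if the terminal lies below, and
  -- the parent edge otherwise.
  have hlocal : ∀ v, (if v ∈ T then (cutValue G f {v} : ℤ) else 0) =
      (if v = r then 0 else up v * D.k v) + ∑ u ∈ children r par v, dn u * D.k u := by
    intro v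
    by_cases hT : v ∈ T
    · rw [if_pos hT, h.rooting.cutValue_singleton]
      push_cast
      congr 1
      · split_ifs with hv
        · rfl
        · rw [hupT v hv hT, hf v hv, one_mul]
      · refine Finset.sum_congr rfl fun u hu => ?_
        obtain ⟨hur, rfl⟩ := mem_children.1 hu
        rw [hf u hur, hdn u hur (par u) (h.lab_of_mem hT), one_mul]
        intro hd
        have := h.rooting.depth_le hd
        have := h.rooting.depth_par u hur
        lia
    · have hv := h.ne_root hT
      rw [if_neg hT, if_neg hv]
      have hb := h.balanced hT
      rcases h.isLower v with h1 | ⟨-, h2, h3, h4, h5⟩ | ⟨-, h2, -⟩ | ⟨-, -, ⟨t, ht, h3, h4⟩, h5⟩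
      · exact absurd h1.1 hT
      · obtain ⟨u₀, hu₀, g1, g2, g3, g4, g5⟩ := hb.of_le h4 h5
        obtain ⟨hu₀r, hpu₀⟩ := mem_children.1 hu₀
        have htv := h.bottomUp.tt_eq v hv
        rw [if_neg hT] at htv
        have e1 : up v = 1 := by simp only [up, if_neg h3, if_pos h2]
        have e2 : dn u₀ = -1 := by
          simp only [dn, hpu₀, if_neg h3, if_pos (show D.lab v = D.tt u₀ by lia)]
        have e3 : ∀ u ∈ (children r par v).erase u₀, dn u * (D.k u : ℤ) = D.k u := by
          intro u hu
          obtain ⟨hne, hu⟩ := Finset.mem_erase.1 hu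
          obtain ⟨hur, hpu⟩ := mem_children.1 hu
          obtain ⟨t, -, h6, h7⟩ := (h.bottomUp.tt_facts h.rooting u₀ hu₀r).2 (by lia)
          rw [hdn u hur t (by rw [hpu]; lia), one_mul]
          intro hd
          refine hne (h.rooting.eq_of_isDescendant hd h7 ?_)
          have d1 := h.rooting.depth_par u hur
          have d2 := h.rooting.depth_par u₀ hu₀r
          rw [hpu] at d1
          rw [hpu₀] at d2
          lia
        rw [← Finset.add_sum_erase _ _ hu₀, Finset.sum_congr rfl e3, e1, e2, g5]
        push_cast
        ring
      · have e1 : up v = 0 := by simp only [up, if_pos h2]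
        rw [e1, zero_mul, zero_add]
        refine (Finset.sum_eq_zero fun u hu => ?_).symm
        simp only [dn, (mem_children.1 hu).2, if_pos h2, zero_mul]
      · have e3 : ∀ u ∈ children r par v, dn u * (D.k u : ℤ) = D.b u := by
          intro u hu
          obtain ⟨hur, rfl⟩ := mem_children.1 hu
          rw [hdn u hur t h3 fun hd => h4 (hd.of_par hur), one_mul, hb.of_eq h5 u hu]
        rw [Finset.sum_congr rfl e3, hupO v hv t h3 h4, h5, h.bottomUp.B_eq]
        push_cast
        ring
  have hmult : ∀ v, v ≠ r → (cutMultiplicity par D.lab v : ℤ) = up v + dn v := by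
    intro v hv
    have hdesc : ∀ t : Fin n, ¬ IsDescendant r par v t → D.tt v ≠ t.val + 1 := by
      intro t ht h1
      obtain ⟨t', -, h2, h3⟩ := (h.bottomUp.tt_facts h.rooting v hv).2 (by lia)
      obtain rfl : t = t' := Fin.ext (by lia)
      exact ht h3
    have hlt : v ∈ T → D.lab v = D.tt v ∧ D.lab v ≠ 0 := by
      intro hT
      have h1 := h.lab_of_mem hT
      have h2 := h.bottomUp.tt_eq v hv
      rw [if_pos hT] at h2
      lia
    simp only [cutMultiplicity, up, dn]
    have hlow : (D.lab v = D.tt v ∧ D.lab v ≠ 0) ∨ D.lab v = 0 ∨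
        (D.lab v = D.lab (par v) ∧ D.lab v ≠ D.tt v ∧ D.lab v ≠ 0) := by
      rcases h.isLower v with h1 | h1 | h1 | ⟨-, h1, ⟨t, -, h2, h3⟩, -⟩
      · exact Or.inl (hlt h1.1)
      · exact Or.inl ⟨h1.2.1, h1.2.2.1⟩
      · exact Or.inr (Or.inl h1.2.1)
      · have := hdesc t h3
        exact Or.inr (Or.inr ⟨h1, by lia, by lia⟩)
    have hupp : (D.lab (par v) = D.tt v ∧ D.lab (par v) ≠ 0 ∧ D.lab v = D.tt v) ∨
        (D.lab (par v) = 0 ∧ D.lab (par v) = 0) ∨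
        (D.lab (par v) ≠ D.tt v ∧ D.lab (par v) ≠ 0) := by
      rcases h.isUpper hv with ⟨h1, h2, -⟩ | h1 | ⟨t, -, h1, h2, -⟩
      · refine Or.inl ⟨h1, h2, ?_⟩
        have hlab := h.topDown.lab_eq v hv
        split_ifs at hlab with e1 e2
        · exact hlab
        · exact absurd h1 e2.1
        · exact hlab.trans h1
      · exact Or.inr (Or.inl ⟨h1.1, h1.1⟩)
      · have := hdesc t h2
        exact Or.inr (Or.inr ⟨by lia, by lia⟩)
    rcases hlow with ⟨h1, h2⟩ | h1 | ⟨h1, h2, h3⟩ <;>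
      rcases hupp with ⟨h4, h5, h6⟩ | ⟨h4, h5⟩ | ⟨h4, h5⟩ <;>
      split_ifs <;> lia
  have hmain : ((∑ t ∈ T, cutValue G f {t} : ℕ) : ℤ) =
      ((∑ v with v ≠ r, D.k v * cutMultiplicity par D.lab v : ℕ) : ℤ) := by
    have e1 : ((∑ t ∈ T, cutValue G f {t} : ℕ) : ℤ) =
        ∑ v, (if v ∈ T then (cutValue G f {v} : ℤ) else 0) := by
      rw [← Finset.sum_filter]
      push_cast
      exact Finset.sum_congr (by ext; simp) fun _ _ => rfl
    rw [e1, Finset.sum_congr rfl fun v _ => hlocal v, Finset.sum_add_distrib, sum_sum_children]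
    have e2 : ∑ v, (if v = r then 0 else up v * (D.k v : ℤ)) = ∑ v with v ≠ r, up v * D.k v := by
      rw [Finset.sum_filter]
      exact Finset.sum_congr rfl fun v _ => by by_cases hv : v = r <;> simp [hv]
    rw [e2, ← Finset.sum_add_distrib]
    push_cast
    refine Finset.sum_congr rfl fun v hv => ?_
    rw [hmult v (Finset.mem_filter.1 hv).2]
    ring
  exact_mod_cast hmain

end IsSolved

/-! ### Slack edges and odd components -/

/-- `x` can be reached downwards from `w` through vertices with label `0`. -/
inductive IsUncoveredBelow {V : Type*} (r : V) (par : V → V) (lab : V → ℕ) (w : V) : V → Prop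
  | refl : IsUncoveredBelow r par lab w w
  | step {x : V} (hx : x ≠ r) (h0 : lab x = 0) (h : IsUncoveredBelow r par lab w (par x)) :
      IsUncoveredBelow r par lab w x

namespace IsSolved

variable {n : ℕ} {G : SimpleGraph (Fin n)} {r : Fin n} {par : Fin n → Fin n}
  {depth : Fin n → ℕ} {T : Finset (Fin n)} {D : Tables n}

theorem _root_.IsUncoveredBelow.lab_eq_zero {w x : Fin n}
    (hx : IsUncoveredBelow r par D.lab w x) (hw : D.lab w = 0) : D.lab x = 0 := by
  cases hx with
  | refl => exact hw
  | step _ h0 _ => exact h0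

theorem _root_.IsUncoveredBelow.eq_or_par {w x : Fin n}
    (hx : IsUncoveredBelow r par D.lab w x) : x = w ∨ IsUncoveredBelow r par D.lab w (par x) := by
  cases hx with
  | refl => exact Or.inl rfl
  | step _ _ h => exact Or.inr h

/-- The top vertices of the uncovered components whose parent edge is not saturated. -/
def slackTops (r : Fin n) (par : Fin n → Fin n) (D : Tables n) : Finset (Fin n) :=
  {v | v ≠ r ∧ D.lab v = 0 ∧ D.lab (par v) ≠ 0 ∧ D.k v + 1 = D.c v}

theorem mem_slackTops {v : Fin n} : v ∈ slackTops r par D ↔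
    v ≠ r ∧ D.lab v = 0 ∧ D.lab (par v) ≠ 0 ∧ D.k v + 1 = D.c v := by
  simp [slackTops]

/-- A label changes along an edge in two ways only. If `c < ao`, then `a = c` and the flow reaches
`c`. If the vertex becomes uncovered below a covered parent, then `k = b`, and as `c < B` the
rounding in `b` loses at most one unit. -/
theorem mul_cutMultiplicity_le (h : IsSolved G r par depth T D) {v : Fin n} (hv : v ≠ r) :
    D.c v * cutMultiplicity par D.lab v ≤
      D.k v * cutMultiplicity par D.lab v + if v ∈ slackTops r par D then 1 else 0 := by
  have hlab := h.topDown.lab_eq v hv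
  have ha := h.bottomUp.a_eq v hv
  have hbd := h.bottomUp.bounds h.rooting v hv
  have hle : D.c v ≤ D.k v → D.c v * cutMultiplicity par D.lab v ≤
      D.k v * cutMultiplicity par D.lab v + if v ∈ slackTops r par D then 1 else 0 :=
    fun hck => (Nat.mul_le_mul_right _ hck).trans (Nat.le_add_right _ _)
  have heq : D.lab v = D.lab (par v) → D.c v * cutMultiplicity par D.lab v ≤
      D.k v * cutMultiplicity par D.lab v + if v ∈ slackTops r par D then 1 else 0 :=
    fun he => by simp [cutMultiplicity, he]
  rcases h.isUpper hv with ⟨h1, h2, -⟩ | ⟨h1, h2, -⟩ | ⟨t, -, h1, -, h2⟩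
  · refine heq ?_
    split_ifs at hlab with e1 e2
    · lia
    · exact absurd h1 e2.1
    · exact hlab
  · split_ifs at hlab with e1 e2
    · exact hle (by lia)
    · exact heq (by lia)
    · exact heq hlab
  · split_ifs at hlab with e1 e2
    · exact hle (by lia)
    · have hT : v ∉ T := by
        intro hT
        have := h.bottomUp.ao_eq v hv
        rw [if_pos hT] at this
        lia
      have hb := h.bottomUp.b_eq v hv
      rw [if_neg hT] at hb
      rcases le_or_gt (D.c v) (D.k v) with hck | hck
      · exact hle hck
      · have hmem : v ∈ slackTops r par D :=
          mem_slackTops.2 ⟨hv, hlab, by lia, by omega⟩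
        have hN : cutMultiplicity par D.lab v = 1 := by
          simp only [cutMultiplicity]
          split_ifs <;> lia
        have := (mem_slackTops.1 hmem).2.2.2
        rw [hN, if_pos hmem]
        lia
    · exact heq hlab

/-- An uncovered walk cannot leave through the top vertex, as the parent of that vertex is covered;
all its vertices thus lie below. -/
theorem isUncoveredBelow_of_walk (h : IsSolved G r par depth T D) {w : Fin n}
    (hw : D.lab (par w) ≠ 0) {x y : uncovered T (labelSet D.lab)}
    (p : (G.induce (uncovered T (labelSet D.lab))).Walk x y)
    (hx : IsUncoveredBelow r par D.lab w x) : IsUncoveredBelow r par D.lab w y := by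
  induction p with
  | nil => exact hx
  | @cons u v _ hadj p ih =>
    refine ih ?_
    have hadj' : G.Adj u.1 v.1 := hadj
    have hv0 : D.lab v.1 = 0 := h.mem_uncovered.1 v.2
    rcases h.rooting.of_adj _ _ hadj' with ⟨h1, h2⟩ | ⟨h1, h2⟩
    · cases hx with
      | refl => exact absurd (h2 ▸ hv0) hw
      | step _ _ hpar => exact h2 ▸ hpar
    · exact .step h1 hv0 (h2 ▸ hx)

theorem reachable_of_isUncoveredBelow (h : IsSolved G r par depth T D) {w x : Fin n}
    (hw : w ∈ uncovered T (labelSet D.lab)) (hx : IsUncoveredBelow r par D.lab w x) :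
    ∃ hx : x ∈ uncovered T (labelSet D.lab),
      (G.induce (uncovered T (labelSet D.lab))).Reachable ⟨x, hx⟩ ⟨w, hw⟩ := by
  induction hx with
  | refl => exact ⟨hw, .rfl⟩
  | @step x hx h0 _ ih =>
    obtain ⟨hp, hr⟩ := ih
    refine ⟨h.mem_uncovered.2 h0, SimpleGraph.Reachable.trans (SimpleGraph.Adj.reachable ?_) hr⟩
    exact h.rooting.adj_par x hx

theorem image_supp_eq (h : IsSolved G r par depth T D) {w : Fin n}
    (hw : w ∈ uncovered T (labelSet D.lab)) (hpw : D.lab (par w) ≠ 0) :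
    Subtype.val '' ((G.induce (uncovered T (labelSet D.lab))).connectedComponentMk
      ⟨w, hw⟩).supp = {x | IsUncoveredBelow r par D.lab w x} := by
  ext x
  simp only [Set.mem_image, SimpleGraph.ConnectedComponent.mem_supp_iff,
    SimpleGraph.ConnectedComponent.eq, Set.mem_ofPred_eq]
  constructor
  · rintro ⟨y, hy, rfl⟩
    obtain ⟨p⟩ := hy.symm
    exact h.isUncoveredBelow_of_walk hpw p .refl
  · intro hx
    obtain ⟨h1, h2⟩ := h.reachable_of_isUncoveredBelow hw hx
    exact ⟨⟨x, h1⟩, h2, rfl⟩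

/-- Inside the component `a = ao ≡ A` modulo `2`, so summing over it the contributions of inner
edges cancel. The cut edges below satisfy `c = a`. What remains is `c + a` at the top edge, where `c
= k + 1` and `k = b ≡ a`. -/
theorem odd_cutValue (h : IsSolved G r par depth T D) {c : Sym2 (Fin n) → ℕ}
    (hc : ∀ v, v ≠ r → c s(v, par v) = D.c v) {w : Fin n} (hw : w ∈ slackTops r par D) :
    Odd (cutValue G c {x | IsUncoveredBelow r par D.lab w x}) := by
  classical
  obtain ⟨hwr, hw0, hpw, hkc⟩ := mem_slackTops.1 hw
  set W : Finset (Fin n) := Finset.univ.filter (IsUncoveredBelow r par D.lab w) with hW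
  have hmemW : ∀ x, x ∈ W ↔ IsUncoveredBelow r par D.lab w x := fun x => by simp [hW]
  have hwW : w ∈ W := (hmemW w).2 .refl
  have hpwW : par w ∉ W := fun hp => hpw (((hmemW _).1 hp).lab_eq_zero hw0)
  -- An edgewise identity that expresses the cut by sums of `a` and `A` over the component. Its only
  -- nontrivial case is a covered child of an uncovered vertex, which by the labelling rule has `c <
  -- ao`, hence `a = c`.
  have hterm : ∀ v ∈ Finset.univ.filter (· ≠ r),
      (if (v ∈ {x | IsUncoveredBelow r par D.lab w x} ↔
        par v ∉ {x | IsUncoveredBelow r par D.lab w x}) then c s(v, par v) else 0) +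
        (if v ∈ W.erase w then D.a v else 0) =
      (if par v ∈ W then D.a v else 0) + if v = w then D.c w else 0 := by
    intro v hv
    have hvr : v ≠ r := (Finset.mem_filter.1 hv).2
    simp only [Set.mem_ofPred_eq, ← hmemW, Finset.mem_erase]
    by_cases hvw : v = w
    · subst hvw
      simp [hwW, hpwW, hc v hvr]
    · by_cases hvW : v ∈ W
      · have hp : par v ∈ W := by
          rw [hmemW] at hvW ⊢
          cases hvW with
          | refl => exact absurd rfl hvw
          | step _ _ hp => exact hp
        simp [hvW, hp, hvw]
      · by_cases hp : par v ∈ W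
        · have hac : D.a v = D.c v := by
            have hp0 := ((hmemW _).1 hp).lab_eq_zero hw0
            have hlab := h.topDown.lab_eq v hvr
            have ha := h.bottomUp.a_eq v hvr
            have hv0 : D.lab v ≠ 0 := fun h0 => hvW ((hmemW v).2 (.step hvr h0 ((hmemW _).1 hp)))
            split_ifs at hlab with e1 e2
            · lia
            · exact absurd hlab hv0
            · exact absurd (hlab.trans hp0) hv0
          simp [hvW, hp, hvw, hc v hvr, hac]
        · simp [hvW, hp, hvw]
  have hsum := Finset.sum_congr rfl hterm
  rw [Finset.sum_add_distrib, Finset.sum_add_distrib] at hsum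
  have h1 : ∑ v with v ≠ r, (if v ∈ W.erase w then D.a v else 0) = ∑ v ∈ W.erase w, D.a v := by
    rw [← Finset.sum_filter, Finset.filter_filter]
    refine Finset.sum_congr ?_ fun _ _ => rfl
    ext v
    simp only [Finset.mem_filter, Finset.mem_univ, true_and, and_iff_right_iff_imp,
      Finset.mem_erase, hmemW]
    rintro ⟨h1, h2⟩
    cases h2 with
    | refl => exact absurd rfl h1
    | step h3 _ _ => exact h3
  have h2 : ∑ v with v ≠ r, (if par v ∈ W then D.a v else 0) = ∑ v ∈ W, D.A v := by
    rw [← sum_sum_children r par fun v => if par v ∈ W then D.a v else 0]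
    rw [← Finset.sum_subset (Finset.subset_univ W)]
    · refine Finset.sum_congr rfl fun p hp => ?_
      rw [h.bottomUp.A_eq]
      exact Finset.sum_congr rfl fun u hu => by rw [(mem_children.1 hu).2, if_pos hp]
    · intro p _ hp
      exact Finset.sum_eq_zero fun u hu => by rw [(mem_children.1 hu).2, if_neg hp]
  have h3 : ∑ v with v ≠ r, (if v = w then D.c w else 0) = D.c w := by
    rw [Finset.sum_ite_eq']
    simp [hwr]
  have h4 : (∑ v ∈ W, D.A v) % 2 = (∑ v ∈ W, D.a v) % 2 := by
    refine Finset.sum_mod_two_congr fun v hv => ?_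
    have hv0 := ((hmemW v).1 hv).lab_eq_zero hw0
    rcases h.isLower v with g | g | ⟨hT, -, -, -, g⟩ | ⟨-, -, ⟨t, -, g, -⟩, -⟩
    · lia
    · exact absurd hv0 g.2.2.1
    · rw [g]
      exact (h.bottomUp.ao_facts' h.rooting (h.ne_root hT) hT).2.2.1.symm
    · lia
  have h5 := Finset.add_sum_erase W D.a hwW
  have h6 : D.k w = D.b w := by
    rcases h.isUpper hwr with ⟨g1, g2, -⟩ | g | ⟨t, -, -, -, g⟩
    · have hlab := h.topDown.lab_eq w hwr
      split_ifs at hlab with e1 e2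
      · lia
      · exact absurd g1 e2.1
      · lia
    · exact absurd g.1 hpw
    · exact g
  have h7 := (h.bottomUp.bounds h.rooting w hwr).2.2
  rw [h1, h2, h3, ← h.rooting.cutValue_eq] at hsum
  rw [Nat.odd_iff]
  omega

/-- Two top vertices in one component would lie below each other, while the parent of each is
covered; so a component has only one. -/
theorem card_slackTops_le (h : IsSolved G r par depth T D) {c : Sym2 (Fin n) → ℕ}
    (hc : ∀ v, v ≠ r → c s(v, par v) = D.c v) :
    (slackTops r par D).card ≤ cutSystemKappa G T c (labelSet D.lab) := by
  unfold cutSystemKappa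
  rw [← Fintype.card_coe, ← Nat.card_eq_fintype_card]
  have hunc : ∀ w : slackTops r par D, w.1 ∈ uncovered T (labelSet D.lab) :=
    fun w => h.mem_uncovered.2 (mem_slackTops.1 w.2).2.1
  refine Nat.card_le_card_of_injective (fun w =>
    ⟨(G.induce (uncovered T (labelSet D.lab))).connectedComponentMk ⟨w.1, hunc w⟩, ?_⟩) ?_
  · rw [h.image_supp_eq (hunc w) (mem_slackTops.1 w.2).2.2.1]
    exact h.odd_cutValue hc w.2
  · intro w w' hww
    have heq := congrArg Subtype.val hww
    simp only [SimpleGraph.ConnectedComponent.eq] at heq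
    obtain ⟨p⟩ := heq
    obtain ⟨-, hw0, hpw, -⟩ := mem_slackTops.1 w.2
    have hb := h.isUncoveredBelow_of_walk hpw p .refl
    rcases hb.eq_or_par with hb | hb
    · exact Subtype.ext hb.symm
    · exact absurd (hb.lab_eq_zero hw0) (mem_slackTops.1 w'.2).2.2.1

theorem flowValue_eq (h : IsSolved G r par depth T D) (hG : G.IsTree) {c f : Sym2 (Fin n) → ℕ}
    (hc : ∀ v, v ≠ r → c s(v, par v) = D.c v) (hf : ∀ v, v ≠ r → f s(v, par v) = D.k v) :
    flowValue G T f = cutSystemValue G T c (labelSet D.lab) := by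
  refine le_antisymm (flowValue_le_cutSystemValue (h.isFeasibleFlow hG hc hf) h.isCutSystem) ?_
  have h1 : cutSystemGamma G T c (labelSet D.lab) ≤
      ∑ t ∈ T, cutValue G f {t} + cutSystemKappa G T c (labelSet D.lab) := by
    have h2 : ∑ v with v ≠ r, D.c v * cutMultiplicity par D.lab v ≤
        ∑ v with v ≠ r, (D.k v * cutMultiplicity par D.lab v +
          if v ∈ slackTops r par D then 1 else 0) :=
      Finset.sum_le_sum fun v hv => h.mul_cutMultiplicity_le (Finset.mem_filter.1 hv).2
    rw [Finset.sum_add_distrib, ← h.sum_cutValue_singleton hf, Finset.sum_boole] at h2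
    have h3 : ((Finset.univ.filter (· ≠ r)).filter (· ∈ slackTops r par D)).card ≤
        (slackTops r par D).card :=
      Finset.card_le_card fun v hv => (Finset.mem_filter.1 hv).2
    have h4 := h.card_slackTops_le hc
    unfold cutSystemGamma
    rw [h.sum_cutValue_labelSet, Finset.sum_congr rfl fun v hv => by
      rw [hc v (Finset.mem_filter.1 hv).2]]
    simp only [Nat.cast_id] at h2
    lia
  have h5 : (cutSystemGamma G T c (labelSet D.lab) : ℚ) ≤
      ∑ t ∈ T, (cutValue G f {t} : ℚ) + cutSystemKappa G T c (labelSet D.lab) := by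
    exact_mod_cast h1
  unfold flowValue cutSystemValue
  linarith

end IsSolved

/-- Equality in the weak duality certifies optimality on both sides. -/
theorem isMaximumFlow_and_isMinimumCutSystem {V : Type*} [Fintype V] {G : SimpleGraph V}
    {T : Finset V} {c f : Sym2 V → ℕ} {X : V → Set V} (hf : IsFeasibleFlow G T c f)
    (hX : IsCutSystem G T X) (he : flowValue G T f = cutSystemValue G T c X) :
    IsMaximumFlow G T c f ∧ IsMinimumCutSystem G T c X :=
  ⟨⟨hf, fun _ hf' => (flowValue_le_cutSystemValue hf' hX).trans_eq he.symm⟩,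
    hX, fun _ hX' => he.symm.trans_le (flowValue_le_cutSystemValue hf hX')⟩

/-! ### A program logic with running times for the machine -/

namespace RAM

/-- The value of an expression. -/
def Expr.val (s : State) : Expr → ℕ
  | const k => k
  | var x => s.var x
  | read a i => s.arr a (i.val s)
  | add p q => p.val s + q.val s
  | sub p q => p.val s - q.val s
  | half p => p.val s / 2

/-- The evaluation of an expression respects the bounds for indices and numbers. -/
def Expr.Ok (S B : ℕ) (s : State) : Expr → Prop
  | const k => k < B
  | var x => s.var x < B
  | read a i => i.Ok S B s ∧ i.val s < S ∧ s.arr a (i.val s) < B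
  | add p q => p.Ok S B s ∧ q.Ok S B s ∧ p.val s + q.val s < B
  | sub p q => p.Ok S B s ∧ q.Ok S B s
  | half p => p.Ok S B s

theorem Expr.Ok.eval {S B : ℕ} {s : State} {p : Expr} (h : p.Ok S B s) :
    p.Eval S B s (p.val s) := by
  induction p with
  | const k => exact .const h
  | var x => exact .var h
  | read a i ih => exact .read (ih h.1) h.2.1 h.2.2
  | add p q ihp ihq => exact .add (ihp h.1) (ihq h.2.1) h.2.2
  | sub p q ihp ihq => exact .sub (ihp h.1) (ihq h.2)
  | half p ih => exact .half (ih h)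

/-- A sufficient condition for a loop-free program to end in a state satisfying `Q`. -/
def Cmd.wp (S B : ℕ) : Cmd → (State → Prop) → State → Prop
  | skip, Q, s => Q s
  -- The stored value enters as a variable with an equation, so nested substitutions keep the
  -- expressions small.
  | assign x p, Q, s => p.Ok S B s ∧ ∀ v, v = p.val s → Q (s.setVar x v)
  | write a i p, Q, s => (i.Ok S B s ∧ i.val s < S) ∧ p.Ok S B s ∧
      ∀ v, v = p.val s → Q (s.setArr a (i.val s) v)
  | seq C D, Q, s => C.wp S B (D.wp S B Q) s
  | ite p q C D, Q, s => (p.Ok S B s ∧ q.Ok S B s) ∧ (p.val s < q.val s → C.wp S B Q s) ∧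
      (¬ p.val s < q.val s → D.wp S B Q s)
  | loop _ _ _, _, _ => False

/-- A bound for the running time of a loop-free program. -/
def Cmd.time : Cmd → ℕ
  | skip => 1
  | assign _ p => p.cost + 1
  | write _ i p => i.cost + p.cost + 1
  | seq C D => C.time + D.time
  | ite p q C D => p.cost + q.cost + 1 + (C.time + D.time)
  | loop _ _ _ => 0

/-- Within `t` units of time, the program ends in a state satisfying `Q`. -/
def Runs (S B : ℕ) (C : Cmd) (s : State) (t : ℕ) (Q : State → Prop) : Prop :=
  ∃ k s', Exec S B C s k s' ∧ k ≤ t ∧ Q s'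

variable {S B : ℕ}

theorem Cmd.wp.runs {C : Cmd} {Q : State → Prop} {s : State} (h : C.wp S B Q s) :
    Runs S B C s C.time Q := by
  induction C generalizing Q s with
  | skip => exact ⟨1, s, .skip, le_rfl, h⟩
  | assign x p => exact ⟨_, _, .assign h.1.eval, le_rfl, h.2 _ rfl⟩
  | write a i p =>
    exact ⟨_, _, .write h.1.1.eval h.1.2 h.2.1.eval, le_rfl, h.2.2 _ rfl⟩
  | seq C D ihC ihD =>
    obtain ⟨k, s', h1, h2, h3⟩ := ihC h
    obtain ⟨l, s'', h4, h5, h6⟩ := ihD h3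
    exact ⟨_, _, .seq h1 h4, Nat.add_le_add h2 h5, h6⟩
  | ite p q C D ihC ihD =>
    by_cases hc : p.val s < q.val s
    · obtain ⟨k, s', h1, h2, h3⟩ := ihC (h.2.1 hc)
      refine ⟨_, _, .ite_true h.1.1.eval h.1.2.eval hc h1, ?_, h3⟩
      simp only [Cmd.time]
      lia
    · obtain ⟨k, s', h1, h2, h3⟩ := ihD (h.2.2 hc)
      refine ⟨_, _, .ite_false h.1.1.eval h.1.2.eval hc h1, ?_, h3⟩
      simp only [Cmd.time]
      lia
  | loop p q C => exact h.elim

theorem Runs.mono {C : Cmd} {s : State} {t t' : ℕ} {Q Q' : State → Prop} (h : Runs S B C s t Q)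
    (ht : t ≤ t') (hQ : ∀ s, Q s → Q' s) : Runs S B C s t' Q' := by
  obtain ⟨k, s', h1, h2, h3⟩ := h
  exact ⟨k, s', h1, h2.trans ht, hQ s' h3⟩

theorem Runs.seq {C D : Cmd} {s : State} {t u : ℕ} {P Q : State → Prop} (hC : Runs S B C s t P)
    (hD : ∀ s', P s' → Runs S B D s' u Q) : Runs S B (Cmd.seq C D) s (t + u) Q := by
  obtain ⟨k, s', h1, h2, h3⟩ := hC
  obtain ⟨l, s'', h4, h5, h6⟩ := hD s' h3
  exact ⟨_, _, .seq h1 h4, Nat.add_le_add h2 h5, h6⟩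

theorem Runs.ite {p q : Expr} {C D : Cmd} {s : State} {t : ℕ} {Q : State → Prop}
    (hp : p.Ok S B s) (hq : q.Ok S B s) (hC : p.val s < q.val s → Runs S B C s t Q)
    (hD : ¬ p.val s < q.val s → Runs S B D s t Q) :
    Runs S B (Cmd.ite p q C D) s (p.cost + q.cost + 1 + t) Q := by
  by_cases hc : p.val s < q.val s
  · obtain ⟨k, s', h1, h2, h3⟩ := hC hc
    exact ⟨_, _, .ite_true hp.eval hq.eval hc h1, Nat.add_le_add_left h2 _, h3⟩
  · obtain ⟨k, s', h1, h2, h3⟩ := hD hc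
    exact ⟨_, _, .ite_false hp.eval hq.eval hc h1, Nat.add_le_add_left h2 _, h3⟩

/-- The rule for loops: the invariant contains a bound for the number of iterations. -/
theorem Runs.loop {p q : Expr} {C : Cmd} {t : ℕ} {I : ℕ → State → Prop} {Q : State → Prop}
    (hok : ∀ j s, I j s → p.Ok S B s ∧ q.Ok S B s)
    (hbody : ∀ j s, I j s → p.val s < q.val s → ∃ i, j = i + 1 ∧ Runs S B C s t (I i))
    (hexit : ∀ j s, I j s → ¬ p.val s < q.val s → Q s) (j : ℕ) {s : State} (hI : I j s) :
    Runs S B (Cmd.loop p q C) s ((p.cost + q.cost + 1 + t) * (j + 1)) Q := by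
  induction j generalizing s with
  | zero =>
    obtain ⟨hp, hq⟩ := hok _ s hI
    by_cases hc : p.val s < q.val s
    · obtain ⟨i, hi, -⟩ := hbody _ s hI hc
      lia
    · exact ⟨_, _, .loop_false hp.eval hq.eval hc, by lia, hexit _ s hI hc⟩
  | succ j ih =>
    obtain ⟨hp, hq⟩ := hok _ s hI
    by_cases hc : p.val s < q.val s
    · obtain ⟨i, hi, k, s', h1, h2, h3⟩ := hbody _ s hI hc
      obtain rfl : j = i := by lia
      obtain ⟨l, s'', h4, h5, h6⟩ := ih h3
      refine ⟨_, _, .loop_true hp.eval hq.eval hc h1 h4, ?_, h6⟩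
      rw [Nat.mul_add_one _ (j + 1)]
      lia
    · refine ⟨_, _, .loop_false hp.eval hq.eval hc, ?_, hexit _ s hI hc⟩
      rw [Nat.mul_add_one]
      lia

@[simp]
theorem State.setVar_var (s : State) (x v y : ℕ) :
    (s.setVar x v).var y = if y = x then v else s.var y := by
  simp [State.setVar, Function.update_apply]

@[simp]
theorem State.setVar_arr (s : State) (x v : ℕ) : (s.setVar x v).arr = s.arr := rfl

@[simp]
theorem State.setArr_var (s : State) (a j v : ℕ) : (s.setArr a j v).var = s.var := rfl

@[simp]
theorem State.setArr_arr (s : State) (a j v b : ℕ) :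
    (s.setArr a j v).arr b = if b = a then Function.update (s.arr a) j v else s.arr b := by
  simp [State.setArr, Function.update_apply]

end RAM

/-! ### Finding the root and scanning the edges -/

/-- The bounds on the size of an instance with root `r`, edge indices `ix` and capacities `cv`
(indexed by the lower end-vertices of the edges) under which the program does not fail. -/
structure IsLayout {n : ℕ} (r : Fin n) (ix cv : Fin n → ℕ) (M Z S B : ℕ) : Prop where
  n_le_S : n ≤ S
  Z_le_B : 16 * Z ≤ B
  add_le : n + M + 2 ≤ Z
  sq_le : n * n + n ≤ Z
  mul_le : n * M ≤ Z
  ix_lt : ∀ v, v ≠ r → ix v + 1 < n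
  ix_inj : ∀ u v, u ≠ r → v ≠ r → ix u = ix v → u = v
  ix_surj : ∀ i, i + 1 < n → ∃ v, v ≠ r ∧ ix v = i
  cv_le : ∀ v, v ≠ r → cv v ≤ M

/-- The state contains the instance, and the number `r + 1` in variable `1`. -/
structure HasInput {n : ℕ} (r : Fin n) (par : Fin n → Fin n) (ix cv : Fin n → ℕ)
    (T : Finset (Fin n)) (s : RAM.State) : Prop where
  var_zero : s.var 0 = n
  var_one : s.var 1 = r.val
  ends : ∀ v, v ≠ r → (s.arr 0 (ix v) = v.val ∧ s.arr 1 (ix v) = (par v).val) ∨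
    (s.arr 0 (ix v) = (par v).val ∧ s.arr 1 (ix v) = v.val)
  cap : ∀ v, v ≠ r → s.arr 2 (ix v) = cv v
  term : ∀ v : Fin n, s.arr 3 v.val = if v ∈ T then 1 else 0

theorem HasInput.congr {n : ℕ} {r : Fin n} {par : Fin n → Fin n} {ix cv : Fin n → ℕ}
    {T : Finset (Fin n)} {s s' : RAM.State} (h : HasInput r par ix cv T s)
    (h0 : s'.var 0 = s.var 0) (h1 : s'.var 1 = s.var 1) (h2 : s'.arr 0 = s.arr 0)
    (h3 : s'.arr 1 = s.arr 1) (h4 : s'.arr 2 = s.arr 2) (h5 : s'.arr 3 = s.arr 3) :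
    HasInput r par ix cv T s' := by
  obtain ⟨g0, g1, g2, g3, g4⟩ := h
  constructor
  · rw [h0, g0]
  · rw [h1, g1]
  · rwa [h2, h3]
  · rwa [h4]
  · rwa [h5]

namespace TreeFlow

open RAM Cmd Expr

/-- Find a terminal `r` and put `r + 1` into variable `1`. -/
def rootBody : Cmd :=
  -- The shift by one lets `0` mean that there is no terminal; a later terminal overwrites an
  -- earlier one.
  seq (ite (const 0) (read 3 (var 2)) (assign 1 (add (var 2) (const 1))) skip)
    (assign 2 (add (var 2) (const 1)))

/-- Add an edge to the degrees (array `6`) and to the sums of edge indices (array `7`) at its two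
end-vertices. -/
def edgeBody : Cmd :=
  seq (assign 3 (read 0 (var 2))) <|
  seq (assign 4 (read 1 (var 2))) <|
  seq (write 6 (var 3) (add (read 6 (var 3)) (const 1))) <|
  seq (write 7 (var 3) (add (read 7 (var 3)) (var 2))) <|
  seq (write 6 (var 4) (add (read 6 (var 4)) (const 1))) <|
  seq (write 7 (var 4) (add (read 7 (var 4)) (var 2))) <|
  assign 2 (add (var 2) (const 1))

/-- Append a vertex to the queue (array `8`) if it is a leaf. -/
def leafBody : Cmd :=
  seq (ite (read 6 (var 2)) (const 2)
    (seq (write 8 (var 5) (var 2)) (assign 5 (add (var 5) (const 1)))) skip)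
    (assign 2 (add (var 2) (const 1)))

/-- The sum of the weights of the edges at `v` with index less than `i`. -/
def incidence {n : ℕ} (r : Fin n) (par : Fin n → Fin n) (ix w : Fin n → ℕ) (i : ℕ) (v : Fin n) :
    ℕ :=
  (if v ≠ r ∧ ix v < i then w v else 0) + ∑ u ∈ children r par v with ix u < i, w u

section

variable {n : ℕ} {r : Fin n} {par : Fin n → Fin n} {ix cv : Fin n → ℕ} {T : Finset (Fin n)}
  {M Z S B : ℕ} {G : SimpleGraph (Fin n)} {depth : Fin n → ℕ}

theorem incidence_zero (w : Fin n → ℕ) (v : Fin n) : incidence r par ix w 0 v = 0 := by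
  simp [incidence]

/-- By injectivity of the indices, raising the threshold past `ix u` adds just the edge above `u`,
which is seen from its two ends. -/
theorem incidence_succ (hL : IsLayout r ix cv M Z S B)
    (w : Fin n → ℕ) {u : Fin n} (hu : u ≠ r) (v : Fin n) :
    incidence r par ix w (ix u + 1) v = incidence r par ix w (ix u) v +
      ((if v = u then w u else 0) + if v = par u then w u else 0) := by
  have h1 : ∀ x, x ≠ r → (ix x < ix u + 1 ↔ ix x < ix u ∨ x = u) := by
    intro x hx
    refine ⟨fun h => ?_, fun h => ?_⟩
    · rcases Nat.lt_succ_iff_lt_or_eq.1 h with h | h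
      · exact Or.inl h
      · exact Or.inr (hL.ix_inj x u hx hu h)
    · rcases h with h | rfl <;> lia
  have h2 : (if v ≠ r ∧ ix v < ix u + 1 then w v else 0) =
      (if v ≠ r ∧ ix v < ix u then w v else 0) + if v = u then w u else 0 := by
    by_cases hv : v = u
    · subst hv
      simp [hu]
    · by_cases hvr : v = r
      · simp [hvr, Ne.symm hu]
      · simp [h1 v hvr, hv]
  have h3 : ∑ x ∈ children r par v with ix x < ix u + 1, w x =
      ∑ x ∈ children r par v with ix x < ix u, w x + if v = par u then w u else 0 := by
    by_cases hv : v = par u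
    · have hins : ((children r par v).filter fun x => ix x < ix u + 1) =
          insert u ((children r par v).filter fun x => ix x < ix u) := by
        ext x
        simp only [Finset.mem_filter, Finset.mem_insert]
        refine ⟨fun h => ?_, fun h => ?_⟩
        · rcases (h1 x (mem_children.1 h.1).1).1 h.2 with h' | h'
          · exact Or.inr ⟨h.1, h'⟩
          · exact Or.inl h'
        · rcases h with rfl | h
          · exact ⟨mem_children.2 ⟨hu, hv.symm⟩, by lia⟩
          · exact ⟨h.1, by lia⟩
      rw [hins, Finset.sum_insert (by simp), if_pos hv, add_comm]
    · rw [if_neg hv, add_zero]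
      refine Finset.sum_congr (Finset.filter_congr fun x hx => ?_) fun _ _ => rfl
      obtain ⟨hxr, hxv⟩ := mem_children.1 hx
      rw [h1 x hxr, or_iff_left]
      rintro rfl
      exact hv hxv.symm
  unfold incidence
  rw [h2, h3]
  lia

theorem incidence_le (hR : IsRooting G r par depth) {w : Fin n → ℕ} {b : ℕ}
    (hw : ∀ v, v ≠ r → w v ≤ b) (i : ℕ) (v : Fin n) : incidence r par ix w i v ≤ n * b := by
  have h1 : incidence r par ix w i v ≤ ∑ u ∈ insert v (children r par v), b := by
    rw [Finset.sum_insert (fun h => hR.par_ne (mem_children.1 h).1 (mem_children.1 h).2)]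
    refine Nat.add_le_add ?_ ?_
    · split_ifs with h
      · exact hw v h.1
      · exact Nat.zero_le _
    · exact (Finset.sum_le_sum_of_subset (Finset.filter_subset _ _)).trans
        (Finset.sum_le_sum fun u hu => hw u (mem_children.1 hu).1)
  refine h1.trans ?_
  rw [Finset.sum_const, smul_eq_mul]
  refine Nat.mul_le_mul_right _ ((Finset.card_le_univ _).trans_eq (Fintype.card_fin n))

/-- The invariant of the loop over the edges. -/
structure EdgeInv (r : Fin n) (par : Fin n → Fin n) (ix cv : Fin n → ℕ) (T : Finset (Fin n))
    (i : ℕ) (s : State) : Prop where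
  input : HasInput r par ix cv T s
  var_two : s.var 2 = i
  deg : ∀ v : Fin n, s.arr 6 v.val = (if v = r then 2 else 0) + incidence r par ix (fun _ => 1) i v
  sum : ∀ v : Fin n, s.arr 7 v.val = incidence r par ix ix i v
  zero : ∀ a, 8 ≤ a → ∀ j, s.arr a j = 0

theorem update_update_add (f : ℕ → ℕ) {x y : ℕ} (hxy : x ≠ y) (c z : ℕ) :
    Function.update (Function.update f x (f x + c)) y (f y + c) z =
      f z + ((if z = x then c else 0) + if z = y then c else 0) := by
  by_cases h1 : z = y
  · subst h1
    simp [Ne.symm hxy]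
  · by_cases h2 : z = x
    · subst h2
      simp [h1]
    · simp [h1, h2]

theorem EdgeInv.body (hL : IsLayout r ix cv M Z S B) (hR : IsRooting G r par depth) {i : ℕ}
    {s : State} (h : EdgeInv r par ix cv T i s) (hi : i + 1 < n) :
    edgeBody.wp S B (EdgeInv r par ix cv T (i + 1)) s := by
  obtain ⟨u, hu, rfl⟩ := hL.ix_surj i hi
  have hdeg : ∀ v : Fin n, s.arr 6 v.val ≤ n + 2 := fun v => by
    have h1 := incidence_le (ix := ix) hR (w := fun _ => 1) (b := 1) (fun _ _ => le_rfl) (ix u) v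
    have h2 := h.deg v
    split_ifs at h2 <;> lia
  have hsum : ∀ v : Fin n, s.arr 7 v.val ≤ n * n := fun v => by
    rw [h.sum]
    exact incidence_le hR (fun v hv => by have := hL.ix_lt v hv; lia) _ _
  -- The list may give either orientation of the edge. The updates at its ends commute, so one
  -- computation serves both.
  have key : ∀ x y : Fin n, s.arr 0 (ix u) = x.val → s.arr 1 (ix u) = y.val →
      (x = u ∧ y = par u ∨ x = par u ∧ y = u) →
      edgeBody.wp S B (EdgeInv r par ix cv T (ix u + 1)) s := by
    intro x y hx hy hxy
    have hne : x.val ≠ y.val := by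
      have := hR.par_ne hu
      rw [Ne, Fin.val_inj]
      rcases hxy with ⟨rfl, rfl⟩ | ⟨rfl, rfl⟩
      · exact this.symm
      · exact this
    have hdx := hdeg x
    have hdy := hdeg y
    have hsx := hsum x
    have hsy := hsum y
    have hS := hL.n_le_S
    have hB := hL.Z_le_B
    have hZ1 := hL.add_le
    have hZ2 := hL.sq_le
    have hvar := h.var_two
    simp only [edgeBody, Cmd.wp, Expr.Ok, Expr.val, State.setVar_var, State.setVar_arr,
      State.setArr_var, State.setArr_arr, hvar, Nat.reduceEqDiff, reduceIte, hx]
    refine ⟨⟨by lia, by lia, by lia⟩, fun x' hx' => ⟨⟨by lia, by lia, by lia⟩, fun y' hy' => ?_⟩⟩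
    subst hx'
    rw [hy] at hy'
    subst hy'
    simp only [Function.update_of_ne hne.symm]
    refine ⟨⟨by lia, by lia⟩, ⟨⟨by lia, by lia, by lia⟩, by lia, by lia⟩, fun d1 hd1 =>
      ⟨⟨by lia, by lia⟩, ⟨⟨by lia, by lia, by lia⟩, by lia, by lia⟩, fun e1 he1 =>
      ⟨⟨by lia, by lia⟩, ⟨⟨by lia, by lia, by lia⟩, by lia, by lia⟩, fun d2 hd2 =>
      ⟨⟨by lia, by lia⟩, ⟨⟨by lia, by lia, by lia⟩, by lia, by lia⟩, fun e2 he2 =>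
      ⟨⟨by lia, by lia, by lia⟩, fun j hj => ?_⟩⟩⟩⟩⟩
    have hsel : ∀ (v : Fin n) (c : ℕ), ((if v.val = x.val then c else 0) +
        if v.val = y.val then c else 0) = ((if v = u then c else 0) + if v = par u then c else 0) := by
      intro v c
      simp only [Fin.val_inj]
      rcases hxy with ⟨rfl, rfl⟩ | ⟨rfl, rfl⟩
      · rfl
      · exact add_comm _ _
    subst hd1 hd2 he1 he2 hj
    refine ⟨h.input.congr ?_ ?_ ?_ ?_ ?_ ?_, ?_, fun v => ?_, fun v => ?_, fun a ha j => ?_⟩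
    · simp
    · simp
    · simp
    · simp
    · simp
    · simp
    · simp
    · simp only [State.setVar_arr, State.setArr_arr, Nat.reduceEqDiff, reduceIte]
      rw [update_update_add _ hne, hsel v, h.deg, incidence_succ hL _ hu, add_assoc]
    · simp only [State.setVar_arr, State.setArr_arr, Nat.reduceEqDiff, reduceIte]
      rw [update_update_add _ hne, hsel v, h.sum, incidence_succ hL _ hu]
    · simp only [State.setVar_arr, State.setArr_arr, if_neg (show a ≠ 6 by lia),
        if_neg (show a ≠ 7 by lia)]
      exact h.zero a ha j
  rcases h.input.ends u hu with ⟨h1, h2⟩ | ⟨h1, h2⟩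
  · exact key u (par u) h1 h2 (Or.inl ⟨rfl, rfl⟩)
  · exact key (par u) u h1 h2 (Or.inr ⟨rfl, rfl⟩)

end

end TreeFlow

namespace TreeFlow

open RAM Cmd Expr

/-- Find a terminal. -/
def findRoot : Cmd :=
  seq (assign 2 (const 0)) (loop (var 2) (var 0) rootBody)

/-- Compute the degrees and the sums of edge indices; the degree of the root is increased by `2`
so that the root never enters the queue. -/
def countEdges : Cmd :=
  seq (assign 1 (sub (var 1) (const 1))) <|
  seq (write 6 (var 1) (const 2)) <|
  seq (assign 2 (const 0)) <|
  -- The test `i + 1 < n` reflects that a tree has `n - 1` edges.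
  loop (add (var 2) (const 1)) (var 0) edgeBody

/-- Initialize the queue with the leaves. -/
def findLeaves : Cmd :=
  seq (assign 2 (const 0)) <|
  seq (assign 5 (const 0)) <|
  seq (loop (var 2) (var 0) leafBody) <|
  assign 2 (const 0)

section

variable {n : ℕ} {r : Fin n} {par : Fin n → Fin n} {ix cv : Fin n → ℕ} {T : Finset (Fin n)}
  {M Z S B : ℕ} {G : SimpleGraph (Fin n)} {depth : Fin n → ℕ}

theorem findRoot_runs {s₀ : State} (hS : n ≤ S) (hB : n + 2 ≤ B) (h0 : s₀.var 0 = n)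
    (h1 : s₀.var 1 = 0) (hterm : ∀ v : Fin n, s₀.arr 3 v.val = if v ∈ T then 1 else 0) :
    Runs S B findRoot s₀ (2 + (3 + rootBody.time) * (n + 1)) fun s => s.arr = s₀.arr ∧
      s.var 0 = n ∧ ((s.var 1 = 0 ∧ T = ∅) ∨ ∃ t ∈ T, s.var 1 = t.val + 1) := by
  let I : ℕ → State → Prop := fun j s => s.arr = s₀.arr ∧ s.var 0 = n ∧ ∃ i, i + j = n ∧
    s.var 2 = i ∧ ((s.var 1 = 0 ∧ ∀ t ∈ T, i ≤ t.val) ∨ ∃ t ∈ T, s.var 1 = t.val + 1)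
  have hinit : Runs S B (assign 2 (const 0)) s₀ 2 (I n) := by
    refine Cmd.wp.runs (C := assign 2 (const 0)) ?_
    simp only [Cmd.wp, Expr.Ok, Expr.val]
    refine ⟨by lia, fun v hv => ⟨rfl, by simpa using h0, 0, by lia, by simpa using hv,
      Or.inl ⟨by simpa using h1, fun _ _ => Nat.zero_le _⟩⟩⟩
  refine hinit.seq fun s hs => ?_
  refine (Runs.loop (I := I) (t := rootBody.time) (fun j s h => ?_) (fun j s h hlt => ?_)
    (fun j s h hlt => ?_) n hs)
  · obtain ⟨ha, hn, i, hi, h2, -⟩ := h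
    simp only [Expr.Ok]
    lia
  · obtain ⟨ha, hn, i, hi, h2, h3⟩ := h
    simp only [Expr.val] at hlt
    obtain ⟨j, rfl⟩ : ∃ j', j = j' + 1 := ⟨j - 1, by lia⟩
    refine ⟨j, rfl, Cmd.wp.runs ?_⟩
    have hti := hterm ⟨i, by lia⟩
    have hle : s₀.arr 3 i ≤ 1 := by
      rw [hti]
      split_ifs <;> simp
    simp only [rootBody, Cmd.wp, Expr.Ok, Expr.val, State.setVar_var, Nat.reduceEqDiff, reduceIte,
      h2, ha]
    refine ⟨⟨by lia, by lia, by lia, by lia⟩, fun hpos => ⟨⟨by lia, by lia, by lia⟩,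
      fun v hv => ⟨⟨by lia, by lia, by lia⟩, fun w hw => ⟨by simpa using ha, by simpa using hn,
        i + 1, by lia, by simpa using hw, Or.inr ⟨⟨i, by lia⟩, ?_, by simpa using hv⟩⟩⟩⟩,
      fun hpos => ⟨⟨by lia, by lia, by lia⟩, fun w hw => ⟨by simpa using ha, by simpa using hn,
        i + 1, by lia, by simpa using hw, ?_⟩⟩⟩
    · by_contra hT
      rw [if_neg hT] at hti
      simp only at hti
      lia
    · have hT : (⟨i, by lia⟩ : Fin n) ∉ T := by
        intro hT
        rw [if_pos hT] at hti
        simp only at hti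
        lia
      rcases h3 with ⟨h3, h4⟩ | ⟨t, ht, h3⟩
      · refine Or.inl ⟨by simpa using h3, fun t ht => ?_⟩
        have h5 := h4 t ht
        have h6 : t.val ≠ i := fun h6 => hT (by
          have : t = ⟨i, by lia⟩ := Fin.ext h6
          exact this ▸ ht)
        lia
      · exact Or.inr ⟨t, ht, by simpa using h3⟩
  · obtain ⟨ha, hn, i, hi, h2, h3⟩ := h
    simp only [Expr.val] at hlt
    refine ⟨ha, hn, h3.imp_left fun h3 => ⟨h3.1, Finset.eq_empty_of_forall_notMem fun t ht => ?_⟩⟩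
    have := h3.2 t ht
    lia

theorem countEdges_runs (hL : IsLayout r ix cv M Z S B) (hR : IsRooting G r par depth)
    {s₀ : State} (h0 : s₀.var 0 = n) (h1 : s₀.var 1 = r.val + 1)
    (hends : ∀ v, v ≠ r → (s₀.arr 0 (ix v) = v.val ∧ s₀.arr 1 (ix v) = (par v).val) ∨
      (s₀.arr 0 (ix v) = (par v).val ∧ s₀.arr 1 (ix v) = v.val))
    (hcap : ∀ v, v ≠ r → s₀.arr 2 (ix v) = cv v)
    (hterm : ∀ v : Fin n, s₀.arr 3 v.val = if v ∈ T then 1 else 0)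
    (hzero : ∀ a, 6 ≤ a → ∀ j, s₀.arr a j = 0) :
    Runs S B countEdges s₀ (4 + (3 + (2 + (5 + edgeBody.time) * n)))
      (EdgeInv r par ix cv T (n - 1)) := by
  have hS := hL.n_le_S
  have hB := hL.Z_le_B
  have hZ := hL.add_le
  have hr := r.isLt
  have hinit : Runs S B (assign 1 (sub (var 1) (const 1))) s₀ 4 fun s => s.var 0 = n ∧
      s.var 1 = r.val ∧ s.arr = s₀.arr := by
    refine Cmd.wp.runs (C := assign 1 (sub (var 1) (const 1))) ?_
    simp only [Cmd.wp, Expr.Ok, Expr.val, h1]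
    exact ⟨⟨by lia, by lia⟩, fun v hv => ⟨by simpa using h0, by simpa using hv, rfl⟩⟩
  refine hinit.seq fun s hs => ?_
  have hwrite : Runs S B (write 6 (var 1) (const 2)) s 3 fun s => s.var 0 = n ∧
      s.var 1 = r.val ∧ (∀ a, a ≠ 6 → s.arr a = s₀.arr a) ∧
      ∀ v : Fin n, s.arr 6 v.val = if v = r then 2 else 0 := by
    refine Cmd.wp.runs (C := write 6 (var 1) (const 2)) ?_
    simp only [Cmd.wp, Expr.Ok, Expr.val, hs.2.1]
    refine ⟨⟨by lia, by lia⟩, by lia, fun v hv => ⟨by simpa using hs.1, by simpa using hs.2.1,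
      fun a ha => by simp [ha, hs.2.2], fun u => ?_⟩⟩
    simp [Function.update_apply, Fin.val_inj, hs.2.2, hzero, hv]
  refine hwrite.seq fun s hs => ?_
  have hstart : Runs S B (assign 2 (const 0)) s 2 (EdgeInv r par ix cv T 0) := by
    refine Cmd.wp.runs (C := assign 2 (const 0)) ?_
    simp only [Cmd.wp, Expr.Ok, Expr.val]
    obtain ⟨g0, g1, g2, g3⟩ := hs
    refine ⟨by lia, fun v hv => ⟨⟨by simpa using g0, by simpa using g1, ?_, ?_, ?_⟩,
      by simpa using hv, ?_, ?_, ?_⟩⟩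
    · simpa [g2] using hends
    · simpa [g2] using hcap
    · simpa [g2] using hterm
    · simpa [incidence_zero] using g3
    · simpa [incidence_zero, g2] using fun v : Fin n => hzero 7 (by lia) v
    · intro a ha j
      simpa [g2 a (by lia)] using hzero a (by lia) j
  refine hstart.seq fun s hs => ?_
  refine (Runs.loop (I := fun j s => ∃ i, i + j + 1 = n ∧ EdgeInv r par ix cv T i s)
    (t := edgeBody.time) (fun j s h => ?_) (fun j s h hlt => ?_)
    (fun j s h hlt => ?_) (n - 1) ⟨0, by lia, hs⟩).mono ?_ (fun s h => h)
  · obtain ⟨i, hi, h⟩ := h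
    simp only [Expr.Ok, Expr.val, h.var_two, h.input.var_zero]
    lia
  · obtain ⟨i, hi, h⟩ := h
    simp only [Expr.val, h.var_two, h.input.var_zero] at hlt
    obtain ⟨j, rfl⟩ : ∃ j', j = j' + 1 := ⟨j - 1, by lia⟩
    exact ⟨j, rfl, (h.body hL hR hlt).runs.mono le_rfl fun s hs => ⟨i + 1, by lia, hs⟩⟩
  · obtain ⟨i, hi, h⟩ := h
    simp only [Expr.val, h.var_two, h.input.var_zero] at hlt
    obtain rfl : i = n - 1 := by lia
    exact h
  · rw [Nat.sub_add_cancel (by lia)]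
    exact le_rfl

/-! ### The queue of leaves -/

/-- The state of the queue `O` (array `8`) after `q` of its vertices have been removed. -/
structure QueueInv (r : Fin n) (par : Fin n → Fin n) (ix cv : Fin n → ℕ) (T : Finset (Fin n))
    (q : ℕ) (O : List (Fin n)) (s : State) : Prop where
  input : HasInput r par ix cv T s
  var_two : s.var 2 = q
  var_five : s.var 5 = O.length
  le : q ≤ O.length
  nodup : O.Nodup
  root : r ∉ O
  order : ∀ i (h : i < O.length), s.arr 8 i = (O[i]).val
  before : ∀ i (h : i < O.length), ∀ u ∈ children r par O[i], u ∈ O.take i ∧ u ∈ O.take q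
  complete : ∀ v, v ≠ r → (∀ u ∈ children r par v, u ∈ O.take q) → v ∈ O
  deg : ∀ v : Fin n, s.arr 6 v.val =
    (if v = r then 2 else 1) + ((children r par v).filter (· ∉ O.take q)).card
  sum : ∀ v : Fin n, s.arr 7 v.val =
    (if v = r then 0 else ix v) + ∑ u ∈ children r par v with u ∉ O.take q, ix u

theorem QueueInv.length_le {q : ℕ} {O : List (Fin n)} {s : State}
    (h : QueueInv r par ix cv T q O s) : O.length < n := by
  have h1 : (r :: O).Nodup := List.nodup_cons.2 ⟨h.root, h.nodup⟩
  have h2 := h1.length_le_card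
  simpa using h2

theorem findLeaves_runs (hL : IsLayout r ix cv M Z S B)
    {s₀ : State} (h₀ : EdgeInv r par ix cv T (n - 1) s₀) :
    Runs S B findLeaves s₀ (2 + (2 + ((3 + leafBody.time) * (n + 1) + 2)))
      fun s => (∃ O, QueueInv r par ix cv T 0 O s) ∧ ∀ a, 9 ≤ a → ∀ j, s.arr a j = 0 := by
  have hS := hL.n_le_S
  have hB := hL.Z_le_B
  have hZ := hL.add_le
  have hdeg : ∀ v : Fin n, s₀.arr 6 v.val =
      (if v = r then 2 else 1) + (children r par v).card := by
    intro v
    rw [h₀.deg, incidence, Finset.filter_true_of_mem fun u hu =>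
      show ix u < n - 1 from by have := hL.ix_lt u (mem_children.1 hu).1; lia,
      Finset.sum_const, smul_eq_mul, mul_one]
    by_cases hv : v = r
    · simp [hv]
    · have := hL.ix_lt v hv
      rw [if_neg hv, if_pos ⟨hv, by lia⟩, if_neg hv]
      lia
  have hsum : ∀ v : Fin n, s₀.arr 7 v.val =
      (if v = r then 0 else ix v) + ∑ u ∈ children r par v, ix u := by
    intro v
    rw [h₀.sum, incidence, Finset.filter_true_of_mem fun u hu =>
      show ix u < n - 1 from by have := hL.ix_lt u (mem_children.1 hu).1; lia]
    by_cases hv : v = r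
    · simp [hv]
    · have := hL.ix_lt v hv
      rw [if_neg hv, if_pos ⟨hv, by lia⟩]
  have hdegn : ∀ v : Fin n, s₀.arr 6 v.val ≤ n + 2 := by
    intro v
    have h1 := (children r par v).card_le_univ
    rw [Fintype.card_fin] at h1
    rw [hdeg]
    split_ifs <;> lia
  let I : ℕ → State → Prop := fun j s => (∀ a, a ≠ 8 → s.arr a = s₀.arr a) ∧
    s.var 0 = s₀.var 0 ∧ s.var 1 = s₀.var 1 ∧ ∃ i, i + j = n ∧ s.var 2 = i ∧
    ∃ O : List (Fin n), O.Nodup ∧ s.var 5 = O.length ∧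
      (∀ v, v ∈ O ↔ v.val < i ∧ s₀.arr 6 v.val < 2) ∧ ∀ i (h : i < O.length), s.arr 8 i = (O[i]).val
  have hinit : Runs S B (assign 2 (const 0)) s₀ 2 fun s => s.arr = s₀.arr ∧
      s.var 0 = s₀.var 0 ∧ s.var 1 = s₀.var 1 ∧ s.var 2 = 0 := by
    refine Cmd.wp.runs (C := assign 2 (const 0)) ?_
    simp only [Cmd.wp, Expr.Ok, Expr.val]
    exact ⟨by lia, fun v hv => by simp [hv]⟩
  refine hinit.seq fun s hs => ?_
  have hstart : Runs S B (assign 5 (const 0)) s 2 (I n) := by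
    refine Cmd.wp.runs (C := assign 5 (const 0)) ?_
    simp only [Cmd.wp, Expr.Ok, Expr.val]
    exact ⟨by lia, fun v hv => ⟨by simp [hs], by simp [hs], by simp [hs], 0, by simp,
      by simp [hs], [], by simp, by simp [hv], by simp, by simp⟩⟩
  refine hstart.seq fun s hs => ?_
  have hvar0 := h₀.input.var_zero
  have hassign : ∀ s, ((∃ O, QueueInv r par ix cv T 0 O (s.setVar 2 0)) ∧
      ∀ a, 9 ≤ a → ∀ j, s.arr a j = 0) → Runs S B (assign 2 (const 0)) s 2
      fun s => (∃ O, QueueInv r par ix cv T 0 O s) ∧ ∀ a, 9 ≤ a → ∀ j, s.arr a j = 0 := by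
    intro s h
    refine Cmd.wp.runs (C := assign 2 (const 0)) ?_
    simp only [Cmd.wp, Expr.Ok, Expr.val]
    refine ⟨by lia, fun v hv => ?_⟩
    subst hv
    exact h
  refine Runs.seq (P := fun s => (∃ O, QueueInv r par ix cv T 0 O (s.setVar 2 0)) ∧
    ∀ a, 9 ≤ a → ∀ j, s.arr a j = 0) ?_ hassign
  refine (Runs.loop (I := I) (t := leafBody.time) (fun j s h => ?_) (fun j s h hlt => ?_)
    (fun j s h hlt => ?_) n hs)
  · obtain ⟨-, hn, -, i, hi, h2, -⟩ := h
    simp only [Expr.Ok]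
    lia
  · obtain ⟨ha, hn, hr, i, hi, h2, O, hO, h5, hmem, hord⟩ := h
    simp only [Expr.val] at hlt
    obtain ⟨j, rfl⟩ : ∃ j', j = j' + 1 := ⟨j - 1, by lia⟩
    refine ⟨j, rfl, Cmd.wp.runs ?_⟩
    have hd := hdegn ⟨i, by lia⟩
    have hnot : (⟨i, by lia⟩ : Fin n) ∉ O := by
      rw [hmem]
      simp
    have hlen : O.length < n := by
      have h1 : ((⟨i, by lia⟩ : Fin n) :: O).Nodup := List.nodup_cons.2 ⟨hnot, hO⟩
      simpa using h1.length_le_card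
    have hsplit : ∀ v : Fin n, v.val < i + 1 ↔ v.val < i ∨ v = ⟨i, by lia⟩ := by
      intro v
      rw [Fin.ext_iff]
      lia
    simp only [leafBody, Cmd.wp, Expr.Ok, Expr.val, State.setVar_var, State.setArr_var,
      Nat.reduceEqDiff, reduceIte, h2, h5, ha 6 (by lia)]
    simp only at hd
    refine ⟨⟨⟨by lia, by lia, by lia⟩, by lia⟩, fun hpos => ⟨⟨by lia, by lia⟩, by lia, fun v hv =>
      ⟨⟨by lia, by lia, by lia⟩, fun w hw => ⟨⟨by lia, by lia, by lia⟩, fun x hx =>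
        ⟨fun a h8 => by simp [h8, ha], by simpa using hn, by simpa using hr, i + 1, by lia,
        by simpa using hx, O ++ [⟨i, by lia⟩], ?_, by simp [hw], fun v => ?_,
        fun l hl => ?_⟩⟩⟩⟩, fun hpos => ⟨⟨by lia, by lia, by lia⟩, fun x hx =>
        ⟨fun a h8 => by simp [h8, ha], by simpa using hn, by simpa using hr, i + 1, by lia,
        by simpa using hx, O, hO, by simpa using h5, fun v => ?_, by simpa using hord⟩⟩⟩
    · rw [List.nodup_append]
      simp only [List.nodup_singleton, true_and, hO]
      intro a ha b hb
      rw [List.mem_singleton] at hb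
      rintro rfl
      exact hnot (hb ▸ ha)
    · rw [List.mem_append, List.mem_singleton, hmem, hsplit]
      constructor
      · rintro (h | rfl)
        · exact ⟨Or.inl h.1, h.2⟩
        · exact ⟨Or.inr rfl, hpos⟩
      · rintro ⟨h | h, h'⟩
        · exact Or.inl ⟨h, h'⟩
        · exact Or.inr h
    · rw [List.length_append, List.length_singleton] at hl
      simp only [State.setVar_arr, State.setArr_arr, reduceIte]
      rcases Nat.lt_succ_iff_lt_or_eq.1 hl with hl | rfl
      · rw [Function.update_of_ne (by lia), List.getElem_append_left hl, hord]
      · simp [hv]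
    · rw [hmem, hsplit]
      constructor
      · exact fun h => ⟨Or.inl h.1, h.2⟩
      · rintro ⟨h | rfl, h'⟩
        · exact ⟨h, h'⟩
        · exact absurd h' hpos
  · obtain ⟨ha, hn, hr, i, hi, h2, O, hO, h5, hmem, hord⟩ := h
    simp only [Expr.val] at hlt
    obtain rfl : i = n := by lia
    -- The degree is one for the parent edge plus the number of children, and at least two at the
    -- root; so degree below two means a childless vertex other than the root.
    have hmem' : ∀ v, v ∈ O ↔ v ≠ r ∧ children r par v = ∅ := by
      intro v
      rw [hmem, hdeg, ← Finset.card_eq_zero]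
      by_cases hv : v = r
      · simp only [hv, if_true]
        lia
      · simp [hv]
    refine ⟨⟨O, h₀.input.congr ?_ ?_ ?_ ?_ ?_ ?_, ?_, ?_, by lia, hO, ?_, ?_, ?_, ?_, ?_, ?_⟩,
      fun a h9 l => ?_⟩
    · simpa using hn
    · simpa using hr
    · simp [ha]
    · simp [ha]
    · simp [ha]
    · simp [ha]
    · simp
    · simpa using h5
    · simp [hmem']
    · simpa using hord
    · intro l hl u hu
      rw [((hmem' O[l]).1 (List.getElem_mem hl)).2] at hu
      exact absurd hu (Finset.notMem_empty u)
    · intro v hv hch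
      refine (hmem' v).2 ⟨hv, Finset.eq_empty_of_forall_notMem fun u hu => ?_⟩
      simpa using hch u hu
    · intro v
      simp [ha, hdeg]
    · intro v
      simp [ha, hsum]
    · rw [ha a (by lia)]
      exact h₀.zero a (by lia) l

end

end TreeFlow

/-! ### Tables and queue during leaf elimination -/

theorem IsArgmax.congr {n : ℕ} {a b t a' b' t' : Fin n → ℕ} {C : Finset (Fin n)} {x y z w : ℕ}
    (h : IsArgmax a b t C x y z w) (hag : ∀ u ∈ C, a' u = a u ∧ b' u = b u ∧ t' u = t u) :
    IsArgmax a' b' t' C x y z w := by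
  rcases h with ⟨h1, h2, h3, h4, h5⟩ | ⟨u, hu, h1, h2, h3, h4, h5, h6⟩
  · exact Or.inl ⟨h1, h2, h3, h4, fun u hu => (hag u hu).1.trans (h5 u hu)⟩
  · obtain ⟨g1, g2, g3⟩ := hag u hu
    exact Or.inr ⟨u, hu, h1.trans g1.symm, h2.trans g2.symm, h3, h4.trans g3.symm, h5,
      fun u' hu' => (hag u' hu').1.trans_le (h6 u' hu')⟩

theorem IsArgmax.insert {n : ℕ} {a b t a' b' t' : Fin n → ℕ} {C : Finset (Fin n)}
    {x y z w x' y' z' w' : ℕ} {v : Fin n} (h : IsArgmax a b t C x y z w)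
    (hag : ∀ u ∈ C, a' u = a u ∧ b' u = b u ∧ t' u = t u)
    (hx : (x < a' v ∧ x' = a' v ∧ y' = b' v ∧ z' = v.val + 1 ∧ w' = t' v) ∨
      (¬ x < a' v ∧ x' = x ∧ y' = y ∧ z' = z ∧ w' = w)) :
    IsArgmax a' b' t' (insert v C) x' y' z' w' := by
  have h' := h.congr hag
  have hle : ∀ u ∈ C, a' u ≤ x := by
    rcases h' with ⟨h1, h2, h3, h4, h5⟩ | ⟨u, hu, h1, h2, h3, h4, h5, h6⟩
    · exact fun u hu => (h5 u hu).le.trans (Nat.zero_le _)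
    · exact h6
  rcases hx with ⟨g0, g1, g2, g3, g4⟩ | ⟨g0, rfl, rfl, rfl, rfl⟩
  · refine Or.inr ⟨v, Finset.mem_insert_self _ _, g1, g2, g3, g4, by lia, fun u hu => ?_⟩
    rcases Finset.mem_insert.1 hu with rfl | hu
    · exact g1.ge
    · exact (hle u hu).trans (by lia)
  · rcases h' with ⟨h1, h2, h3, h4, h5⟩ | ⟨u, hu, h1, h2, h3, h4, h5, h6⟩
    · refine Or.inl ⟨h1, h2, h3, h4, fun u hu => ?_⟩
      rcases Finset.mem_insert.1 hu with rfl | hu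
      · lia
      · exact h5 u hu
    · refine Or.inr ⟨u, Finset.mem_insert_of_mem hu, h1, h2, h3, h4, h5, fun u' hu' => ?_⟩
      rcases Finset.mem_insert.1 hu' with rfl | hu'
      · lia
      · exact h6 u' hu'

namespace TreeFlow

open RAM Cmd Expr

/-- The value of `max p q`. -/
def maxExpr (p q : Expr) : Expr := add p (sub q p)

/-- The value of `min p q`. -/
def minExpr (p q : Expr) : Expr := sub p (sub p q)

/-- The remainder of `p` modulo `2`. -/
def modExpr (p : Expr) : Expr := sub p (add (half p) (half p))

section

variable {n : ℕ} {r : Fin n} {par : Fin n → Fin n} {ix cv : Fin n → ℕ} {T : Finset (Fin n)}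
  {M Z S B : ℕ} {G : SimpleGraph (Fin n)} {depth : Fin n → ℕ}

/-- The tables of the state are correct for the vertices in `D`, and the sums and maxima over
the children account for the children in `D`. -/
structure TableInv (r : Fin n) (par : Fin n → Fin n) (cv : Fin n → ℕ) (T : Finset (Fin n))
    (D : Finset (Fin n)) (s : State) : Prop where
  sum_a : ∀ v : Fin n, s.arr 9 v = ∑ u ∈ children r par v with u ∈ D, s.arr 16 u
  sum_b : ∀ v : Fin n, s.arr 10 v = ∑ u ∈ children r par v with u ∈ D, s.arr 17 u
  argmax : ∀ v : Fin n, IsArgmax (fun u : Fin n => s.arr 16 u) (fun u : Fin n => s.arr 17 u)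
    (fun u : Fin n => s.arr 15 u) ((children r par v).filter (· ∈ D))
    (s.arr 11 v) (s.arr 12 v) (s.arr 13 v) (s.arr 14 v)
  tin_le : ∀ v : Fin n, s.arr 14 v ≤ n
  ao_eq : ∀ v ∈ D, s.arr 18 v.val =
    if v ∈ T then cv v + 1 else max (s.arr 11 v + s.arr 12 v - s.arr 10 v) (s.arr 9 v % 2)
  a_eq : ∀ v ∈ D, s.arr 16 v.val = min (s.arr 18 v) (cv v)
  b_eq : ∀ v ∈ D, s.arr 17 v.val = min (if v ∈ T then cv v else s.arr 10 v)
    (s.arr 16 v + (cv v - s.arr 16 v) / 2 + (cv v - s.arr 16 v) / 2)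
  tt_eq : ∀ v ∈ D, s.arr 15 v.val = if v ∈ T then v.val + 1 else s.arr 14 v

theorem tableInv_empty {s : State} (h : ∀ a, 9 ≤ a → ∀ j, s.arr a j = 0) :
    TableInv r par cv T ∅ s := by
  constructor
  · simp [h]
  · simp [h]
  · exact fun v => Or.inl (by simp [h])
  · simp [h]
  all_goals simp

theorem TableInv.le (hL : IsLayout r ix cv M Z S B) {D : Finset (Fin n)} {s : State}
    (h : TableInv r par cv T D s) (hr : r ∉ D) {v : Fin n} (hv : v ∈ D) :
    s.arr 16 v ≤ M ∧ s.arr 17 v ≤ M := by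
  have h1 := h.a_eq v hv
  have h2 := h.b_eq v hv
  have h3 := hL.cv_le v fun e => hr (e ▸ hv)
  omega

theorem TableInv.sums_le (hL : IsLayout r ix cv M Z S B) {D : Finset (Fin n)} {s : State}
    (h : TableInv r par cv T D s) (hr : r ∉ D) (v : Fin n) :
    s.arr 9 v ≤ Z ∧ s.arr 10 v ≤ Z ∧ s.arr 11 v ≤ M ∧ s.arr 12 v ≤ M ∧ s.arr 13 v ≤ n := by
  have hcard : ∀ g : Fin n → ℕ, (∀ u ∈ D, g u ≤ M) →
      ∑ u ∈ children r par v with u ∈ D, g u ≤ Z := by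
    intro g hg
    refine (Finset.sum_le_card_nsmul _ _ M fun u hu => hg u (Finset.mem_filter.1 hu).2).trans ?_
    refine le_trans (Nat.mul_le_mul_right _ ?_) hL.mul_le
    exact (Finset.card_le_univ _).trans_eq (Fintype.card_fin n)
  refine ⟨?_, ?_, ?_⟩
  · rw [h.sum_a]
    exact hcard _ fun u hu => (h.le hL hr hu).1
  · rw [h.sum_b]
    exact hcard _ fun u hu => (h.le hL hr hu).2
  · rcases h.argmax v with ⟨h1, h2, h3, -, -⟩ | ⟨u, hu, h1, h2, h3, -⟩
    · rw [h1, h2, h3]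
      simp
    · rw [h1, h2, h3]
      exact ⟨(h.le hL hr (Finset.mem_filter.1 hu).2).1, (h.le hL hr (Finset.mem_filter.1 hu).2).2,
        u.isLt⟩

theorem TableInv.congr {D : Finset (Fin n)} {s s' : State} (h : TableInv r par cv T D s)
    (hs : ∀ a, 9 ≤ a → a ≤ 18 → s'.arr a = s.arr a) : TableInv r par cv T D s' := by
  obtain ⟨h1, h2, h3, h4, h5, h6, h7, h8⟩ := h
  have e9 := hs 9 (by lia) (by lia)
  have e10 := hs 10 (by lia) (by lia)
  have e11 := hs 11 (by lia) (by lia)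
  have e12 := hs 12 (by lia) (by lia)
  have e13 := hs 13 (by lia) (by lia)
  have e14 := hs 14 (by lia) (by lia)
  have e15 := hs 15 (by lia) (by lia)
  have e16 := hs 16 (by lia) (by lia)
  have e17 := hs 17 (by lia) (by lia)
  have e18 := hs 18 (by lia) (by lia)
  constructor
  all_goals simp only [e9, e10, e11, e12, e13, e14, e15, e16, e17, e18]
  all_goals assumption

/-- Only the entries of `v` and the sums of its parent are changed. As the parent has not been
eliminated yet, the equations already established are not disturbed, and those of `v` become final.
-/
theorem TableInv.step {D : Finset (Fin n)} {s s' : State} (h : TableInv r par cv T D s)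
    {v : Fin n} (hvr : v ≠ r) (hv : v ∉ D) (hp : par v ∉ D) (hne : par v ≠ v)
    {ao t a b x y z w : ℕ}
    (hao : ao = if v ∈ T then cv v + 1 else
      max (s.arr 11 v + s.arr 12 v - s.arr 10 v) (s.arr 9 v % 2))
    (ht : t = if v ∈ T then v.val + 1 else s.arr 14 v)
    (ha : a = min ao (cv v))
    (hb : b = min (if v ∈ T then cv v else s.arr 10 v) (a + (cv v - a) / 2 + (cv v - a) / 2))
    (hx : (s.arr 11 (par v) < a ∧ x = a ∧ y = b ∧ z = v.val + 1 ∧ w = t) ∨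
      (¬ s.arr 11 (par v) < a ∧ x = s.arr 11 (par v) ∧ y = s.arr 12 (par v) ∧
        z = s.arr 13 (par v) ∧ w = s.arr 14 (par v)))
    (h18 : s'.arr 18 = Function.update (s.arr 18) v ao)
    (h15 : s'.arr 15 = Function.update (s.arr 15) v t)
    (h16 : s'.arr 16 = Function.update (s.arr 16) v a)
    (h17 : s'.arr 17 = Function.update (s.arr 17) v b)
    (h9 : s'.arr 9 = Function.update (s.arr 9) (par v) (s.arr 9 (par v) + a))
    (h10 : s'.arr 10 = Function.update (s.arr 10) (par v) (s.arr 10 (par v) + b))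
    (h11 : s'.arr 11 = Function.update (s.arr 11) (par v) x)
    (h12 : s'.arr 12 = Function.update (s.arr 12) (par v) y)
    (h13 : s'.arr 13 = Function.update (s.arr 13) (par v) z)
    (h14 : s'.arr 14 = Function.update (s.arr 14) (par v) w) :
    TableInv r par cv T (insert v D) s' := by
  have hupd : ∀ (g : ℕ → ℕ) (i : Fin n) (c : ℕ) (u : Fin n), u ≠ i →
      Function.update g i.val c u.val = g u.val :=
    fun g i c u hu => Function.update_of_ne (fun e => hu (Fin.ext e)) _ _
  have hD : ∀ u ∈ D, u ≠ v := fun u hu e => hv (e ▸ hu)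
  have hDp : ∀ u ∈ insert v D, u ≠ par v := by
    intro u hu
    rcases Finset.mem_insert.1 hu with rfl | hu
    · exact hne.symm
    · exact fun e => hp (e ▸ hu)
  have hfilter : ∀ u : Fin n, u ≠ par v → (children r par u).filter (· ∈ insert v D) =
      (children r par u).filter (· ∈ D) := by
    intro u hu
    refine Finset.filter_congr fun u' hu' => ?_
    rw [Finset.mem_insert, or_iff_right]
    rintro rfl
    exact hu (mem_children.1 hu').2.symm
  have hfilterp : (children r par (par v)).filter (· ∈ insert v D) =
      insert v ((children r par (par v)).filter (· ∈ D)) := by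
    ext u
    simp only [Finset.mem_filter, Finset.mem_insert]
    refine ⟨fun hu => hu.2.imp_right fun h => ⟨hu.1, h⟩, fun hu => ?_⟩
    rcases hu with rfl | hu
    · exact ⟨mem_children.2 ⟨hvr, rfl⟩, Or.inl rfl⟩
    · exact ⟨hu.1, Or.inr hu.2⟩
  have hnotin : v ∉ (children r par (par v)).filter (· ∈ D) :=
    fun h => hv (Finset.mem_filter.1 h).2
  have hsum : ∀ (g : ℕ → ℕ) (c : ℕ) (u : Fin n),
      ∑ x ∈ children r par u with x ∈ insert v D, Function.update g v c x =
        (∑ x ∈ children r par u with x ∈ D, g x) + if u = par v then c else 0 := by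
    intro g c u
    have h1 : ∀ w, ∑ x ∈ children r par w with x ∈ D, Function.update g v c x =
        ∑ x ∈ children r par w with x ∈ D, g x := fun w =>
      Finset.sum_congr rfl fun x hx => hupd _ _ _ _ (hD x (Finset.mem_filter.1 hx).2)
    by_cases hu : u = par v
    · subst hu
      rw [hfilterp, Finset.sum_insert hnotin, h1, if_pos rfl, Function.update_self, add_comm]
    · rw [hfilter u hu, h1, if_neg hu, add_zero]
  have htn : t ≤ n := by
    rw [ht]
    split_ifs
    · exact v.isLt
    · exact h.tin_le v
  have hag : ∀ u ∈ D, s'.arr 16 u = s.arr 16 u ∧ s'.arr 17 u = s.arr 17 u ∧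
      s'.arr 15 u = s.arr 15 u := fun u hu => by
    rw [h16, h17, h15]
    exact ⟨hupd _ _ _ _ (hD u hu), hupd _ _ _ _ (hD u hu), hupd _ _ _ _ (hD u hu)⟩
  refine ⟨fun u => ?_, fun u => ?_, fun u => ?_, fun u => ?_, fun u hu => ?_, fun u hu => ?_,
    fun u hu => ?_, fun u hu => ?_⟩
  · rw [h9, h16, hsum, ← h.sum_a]
    by_cases hu : u = par v
    · subst hu
      simp
    · rw [hupd _ _ _ _ hu, if_neg hu, add_zero]
  · rw [h10, h17, hsum, ← h.sum_b]
    by_cases hu : u = par v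
    · subst hu
      simp
    · rw [hupd _ _ _ _ hu, if_neg hu, add_zero]
  · by_cases hu : u = par v
    · subst hu
      rw [hfilterp]
      refine (h.argmax (par v)).insert (fun u hu => hag u (Finset.mem_filter.1 hu).2) ?_
      simpa [h11, h12, h13, h14, h15, h16, h17] using hx
    · rw [hfilter u hu, h11, h12, h13, h14, hupd _ _ _ _ hu, hupd _ _ _ _ hu, hupd _ _ _ _ hu,
        hupd _ _ _ _ hu]
      exact (h.argmax u).congr fun x hx => hag x (Finset.mem_filter.1 hx).2
  · rw [h14]
    by_cases hu : u = par v
    · subst hu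
      rw [Function.update_self]
      rcases hx with ⟨-, -, -, -, rfl⟩ | ⟨-, -, -, -, rfl⟩
      · exact htn
      · exact h.tin_le _
    · rw [hupd _ _ _ _ hu]
      exact h.tin_le u
  · rw [h18, h11, h12, h10, h9, hupd _ _ _ _ (hDp u hu), hupd _ _ _ _ (hDp u hu),
      hupd _ _ _ _ (hDp u hu), hupd _ _ _ _ (hDp u hu)]
    rcases Finset.mem_insert.1 hu with rfl | hu
    · rw [Function.update_self, hao]
    · rw [hupd _ _ _ _ (hD u hu), h.ao_eq u hu]
  · rw [h16, h18]
    rcases Finset.mem_insert.1 hu with rfl | hu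
    · rw [Function.update_self, Function.update_self, ha]
    · rw [hupd _ _ _ _ (hD u hu), hupd _ _ _ _ (hD u hu), h.a_eq u hu]
  · rw [h16, h17, h10, hupd _ _ _ _ (hDp u hu)]
    rcases Finset.mem_insert.1 hu with rfl | hu
    · rw [Function.update_self, Function.update_self, hb]
    · rw [hupd _ _ _ _ (hD u hu), hupd _ _ _ _ (hD u hu), h.b_eq u hu]
  · rw [h15, h14, hupd _ _ _ _ (hDp u hu)]
    rcases Finset.mem_insert.1 hu with rfl | hu
    · rw [Function.update_self, ht]
    · rw [hupd _ _ _ _ (hD u hu), h.tt_eq u hu]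

/-- The facts about the next vertex in the queue. -/
theorem QueueInv.next {q : ℕ} {O : List (Fin n)} {s : State} (h : QueueInv r par ix cv T q O s)
    (hq : q < O.length) :
    O[q] ≠ r ∧ O[q] ∉ O.take q ∧ par O[q] ∉ O.take q ∧ s.arr 7 (O[q]).val = ix O[q] := by
  have hmem : O[q] ∈ O := List.getElem_mem hq
  have hr : O[q] ≠ r := fun e => h.root (e ▸ hmem)
  have hnot : O[q] ∉ O.take q := by
    intro hin
    obtain ⟨i, hi, he⟩ := List.mem_take_iff_getElem.1 hin
    have := (h.nodup.getElem_inj_iff).1 he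
    lia
  have hpar : par O[q] ∉ O.take q := by
    intro hin
    obtain ⟨i, hi, he⟩ := List.mem_take_iff_getElem.1 hin
    have h1 := (h.before i (by lia) O[q] (mem_children.2 ⟨hr, he.symm⟩)).1
    obtain ⟨j, hj, he'⟩ := List.mem_take_iff_getElem.1 h1
    have := (h.nodup.getElem_inj_iff).1 he'
    lia
  refine ⟨hr, hnot, hpar, ?_⟩
  rw [h.sum, if_neg hr, Finset.filter_false_of_mem, Finset.sum_empty, add_zero]
  intro u hu
  rw [not_not]
  exact (h.before q hq u hu).1

/-- The stored degree of the parent drops below two exactly when its last child is removed and it is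
not the root. Until then it is not in the queue, so appending it preserves distinctness and the
order of children before parents. -/
theorem QueueInv.step {q : ℕ} {O O' : List (Fin n)} {s s' : State}
    (h : QueueInv r par ix cv T q O s) (hq : q < O.length)
    (hin : HasInput r par ix cv T s') (h2 : s'.var 2 = q + 1) (h5 : s'.var 5 = O'.length)
    (h6 : s'.arr 6 = Function.update (s.arr 6) (par O[q]) (s.arr 6 (par O[q]) - 1))
    (h7 : s'.arr 7 = Function.update (s.arr 7) (par O[q]) (s.arr 7 (par O[q]) - ix O[q]))
    (hO : (s.arr 6 (par O[q]) - 1 < 2 ∧ O' = O ++ [par O[q]] ∧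
        s'.arr 8 = Function.update (s.arr 8) O.length (par O[q]).val) ∨
      (¬ s.arr 6 (par O[q]) - 1 < 2 ∧ O' = O ∧ s'.arr 8 = s.arr 8)) :
    QueueInv r par ix cv T (q + 1) O' s' := by
  obtain ⟨hvr, hvq, hpq, -⟩ := h.next hq
  have hmemv : O[q] ∈ O := List.getElem_mem hq
  set v := O[q] with hvdef
  have htake : ∀ u, u ∈ O.take (q + 1) ↔ u ∈ O.take q ∨ u = v := by
    intro u
    rw [← List.take_concat_get' O q hq, List.mem_append, List.mem_singleton]
  have hlen : O.length ≤ O'.length := by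
    rcases hO with ⟨-, rfl, -⟩ | ⟨-, rfl, -⟩ <;> simp
  have htakeO : ∀ i, i ≤ O.length → O'.take i = O.take i := by
    intro i hi
    rcases hO with ⟨-, rfl, -⟩ | ⟨-, rfl, -⟩
    · exact List.take_append_of_le_length hi
    · rfl
  have htake' : ∀ u, u ∈ O'.take (q + 1) ↔ u ∈ O.take q ∨ u = v := by
    intro u
    rw [htakeO _ hq, htake]
  have hget : ∀ i (hi : i < O.length), O'[i]'(by lia) = O[i] := by
    intro i hi
    rcases hO with ⟨-, rfl, -⟩ | ⟨-, rfl, -⟩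
    · exact List.getElem_append_left hi
    · rfl
  have hvch : v ∈ (children r par (par v)).filter (· ∉ O.take q) :=
    Finset.mem_filter.2 ⟨mem_children.2 ⟨hvr, rfl⟩, hvq⟩
  have hfilter : ∀ u : Fin n, (children r par u).filter (· ∉ O'.take (q + 1)) =
      ((children r par u).filter (· ∉ O.take q)).erase v := by
    intro u
    ext x
    simp only [Finset.mem_filter, htake', Finset.mem_erase]
    tauto
  have hdeg : ∀ u : Fin n, s'.arr 6 u.val =
      (if u = r then 2 else 1) + ((children r par u).filter (· ∉ O'.take (q + 1))).card := by
    intro u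
    rw [h6, hfilter]
    by_cases hu : u = par v
    · subst hu
      have hc := Finset.card_erase_add_one hvch
      rw [Function.update_self, h.deg]
      lia
    · rw [Function.update_of_ne (fun e => hu (Fin.ext e)), h.deg, Finset.erase_eq_of_notMem]
      intro hv
      exact hu (mem_children.1 (Finset.mem_filter.1 hv).1).2.symm
  have hpdeg : s'.arr 6 (par v).val = s.arr 6 (par v) - 1 := by
    rw [h6, Function.update_self]
  have hpO : par v ∉ O := by
    intro hin
    obtain ⟨i, hi, he⟩ := List.getElem_of_mem hin
    exact hvq (h.before i hi v (mem_children.2 ⟨hvr, he.symm⟩)).2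
  have hfull : s.arr 6 (par v) - 1 < 2 → par v ≠ r ∧
      ∀ u ∈ children r par (par v), u ∈ O.take (q + 1) := by
    intro hlt
    rw [← hpdeg, hdeg] at hlt
    split_ifs at hlt with hr
    · lia
    · refine ⟨hr, fun u hu => ?_⟩
      have h0 : ((children r par (par v)).filter (· ∉ O'.take (q + 1))).card = 0 := by lia
      rw [Finset.card_eq_zero, Finset.filter_eq_empty_iff] at h0
      have := h0 hu
      rwa [not_not, htakeO _ hq] at this
  refine ⟨hin, h2, h5, by lia, ?_, ?_, fun i hi => ?_, fun i hi u hu => ?_, fun u hu hch => ?_,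
    hdeg, fun u => ?_⟩
  · rcases hO with ⟨-, rfl, -⟩ | ⟨-, rfl, -⟩
    · refine List.nodup_append.2 ⟨h.nodup, List.nodup_singleton _, fun a ha b hb => ?_⟩
      rw [List.mem_singleton] at hb
      rintro rfl
      exact hpO (hb ▸ ha)
    · exact h.nodup
  · rcases hO with ⟨hlt, rfl, -⟩ | ⟨-, rfl, -⟩
    · rw [List.mem_append, List.mem_singleton, not_or]
      exact ⟨h.root, (hfull hlt).1.symm⟩
    · exact h.root
  · rcases hO with ⟨-, rfl, h8⟩ | ⟨-, rfl, h8⟩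
    · rw [List.length_append, List.length_singleton] at hi
      rw [h8]
      rcases Nat.lt_succ_iff_lt_or_eq.1 hi with hi | rfl
      · rw [Function.update_of_ne (by lia), List.getElem_append_left hi, h.order]
      · simp
    · rw [h8, h.order i hi]
  · rcases Nat.lt_or_ge i O.length with hi' | hi'
    · rw [hget i hi'] at hu
      rw [htakeO i hi'.le]
      exact (h.before i hi' u hu).imp id fun hin => (htake' u).2 (Or.inl hin)
    · rcases hO with ⟨hlt, rfl, -⟩ | ⟨-, rfl, -⟩
      · rw [List.length_append, List.length_singleton] at hi
        obtain rfl : i = O.length := by lia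
        have hO' : (O ++ [par v])[O.length]'(by simp) = par v := by simp
        rw [hO'] at hu
        rw [htakeO _ le_rfl, htakeO _ hq, List.take_length]
        exact ⟨List.mem_of_mem_take ((hfull hlt).2 u hu), (hfull hlt).2 u hu⟩
      · lia
  · simp only [htake'] at hch
    by_cases hup : u = par v
    · have hlt : s.arr 6 (par v) - 1 < 2 := by
        rw [← hpdeg, hdeg, ← hup, if_neg hu, Finset.filter_false_of_mem]
        · simp
        · intro x hx
          rw [not_not, htake']
          exact hch x hx
      rcases hO with ⟨-, rfl, -⟩ | ⟨hlt', -⟩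
      · simp [hup]
      · exact absurd hlt hlt'
    · have huO : u ∈ O := by
        refine h.complete u hu fun x hx => ?_
        rcases hch x hx with h1 | rfl
        · exact h1
        · exact absurd (mem_children.1 hx).2.symm hup
      rcases hO with ⟨-, rfl, -⟩ | ⟨-, rfl, -⟩
      · exact List.mem_append_left _ huO
      · exact huO
  · rw [h7, hfilter]
    by_cases hu : u = par v
    · subst hu
      have hc := Finset.add_sum_erase _ ix hvch
      rw [Function.update_self, h.sum]
      lia
    · rw [Function.update_of_ne (fun e => hu (Fin.ext e)), h.sum, Finset.erase_eq_of_notMem]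
      intro hv
      exact hu (mem_children.1 (Finset.mem_filter.1 hv).1).2.symm

/-- At the end, all vertices except for the root have been in the queue. -/
theorem QueueInv.mem {O : List (Fin n)} {s : State}
    (h : QueueInv r par ix cv T O.length O s) (hR : IsRooting G r par depth) (v : Fin n) :
    v ≠ r → v ∈ O := by
  refine hR.up_induction (P := fun v => v ≠ r → v ∈ O) (fun v ih hv => ?_) v
  refine h.complete v hv fun u hu => ?_
  rw [List.take_length]
  exact ih u hu (mem_children.1 hu).1

end

end TreeFlow

namespace RAM

/-- Admissible evaluation bounds the result as well; this rules out an overflow in the sums inside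
`maxExpr` and `modExpr`. -/
theorem Expr.Ok.lt {S B : ℕ} {s : State} {p : Expr} (h : p.Ok S B s) : p.val s < B := by
  induction p with
  | const k => exact h
  | var x => exact h
  | read a i ih => exact h.2.2
  | add p q ihp ihq => exact h.2.2
  | sub p q ihp ihq => exact (Nat.sub_le _ _).trans_lt (ihp h.1)
  | half p ih => exact (Nat.div_le_self _ _).trans_lt (ih h)

end RAM

namespace TreeFlow

open RAM Cmd Expr

section

variable {S B : ℕ} {s : State} {p q : Expr}

theorem maxExpr_val : (maxExpr p q).val s = max (p.val s) (q.val s) := by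
  simp only [maxExpr, Expr.val]
  lia

theorem maxExpr_ok : (maxExpr p q).Ok S B s ↔ p.Ok S B s ∧ q.Ok S B s := by
  simp only [maxExpr, Expr.Ok, Expr.val]
  refine ⟨fun h => ⟨h.1, h.2.1.1⟩, fun h => ⟨h.1, ⟨h.2, h.1⟩, ?_⟩⟩
  have := h.1.lt
  have := h.2.lt
  lia

theorem minExpr_val : (minExpr p q).val s = min (p.val s) (q.val s) := by
  simp only [minExpr, Expr.val]
  lia

theorem minExpr_ok : (minExpr p q).Ok S B s ↔ p.Ok S B s ∧ q.Ok S B s := by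
  simp only [minExpr, Expr.Ok]
  tauto

theorem modExpr_val : (modExpr p).val s = p.val s % 2 := by
  simp only [modExpr, Expr.val]
  lia

theorem modExpr_ok : (modExpr p).Ok S B s ↔ p.Ok S B s := by
  simp only [modExpr, Expr.Ok, Expr.val]
  refine ⟨fun h => h.1, fun h => ⟨h, h, h, ?_⟩⟩
  have := h.lt
  lia

end

/-! ### The elimination program -/

/-- Find the edge `4` between the vertex `3` and its parent `6`, and its capacity `7`. -/
def loadEdge : Cmd :=
  seq (assign 4 (read 7 (var 3))) <|
  -- The orientation of the edge is unknown, so the parent is the sum of both ends minus the vertex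
  -- itself.
  seq (assign 6 (sub (add (read 0 (var 4)) (read 1 (var 4))) (var 3))) <|
  assign 7 (read 2 (var 4))

/-- Take the next vertex from the queue, and compute its values in the tables. -/
def peelLoad : Cmd :=
  seq (assign 3 (read 8 (var 2))) <|
  seq loadEdge <|
  seq (ite (const 0) (read 3 (var 3))
    (seq (assign 8 (add (var 7) (const 1))) <|
      seq (assign 9 (var 7)) <|
      assign 10 (add (var 3) (const 1)))
    (seq (assign 8 (maxExpr (sub (add (read 11 (var 3)) (read 12 (var 3))) (read 10 (var 3)))
        (modExpr (read 9 (var 3))))) <|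
      seq (assign 9 (read 10 (var 3))) <|
      assign 10 (read 14 (var 3)))) <|
  seq (assign 11 (minExpr (var 8) (var 7))) <|
  assign 12 (minExpr (var 9)
    (add (add (var 11) (half (sub (var 7) (var 11)))) (half (sub (var 7) (var 11)))))

/-- Store the values of the vertex, and add them to the sums of the parent. -/
def peelStore : Cmd :=
  seq (write 18 (var 3) (var 8)) <|
  seq (write 15 (var 3) (var 10)) <|
  seq (write 16 (var 3) (var 11)) <|
  seq (write 17 (var 3) (var 12)) <|
  seq (write 9 (var 6) (add (read 9 (var 6)) (var 11))) <|
  seq (write 10 (var 6) (add (read 10 (var 6)) (var 12))) <|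
  seq (ite (read 11 (var 6)) (var 11)
    (seq (assign 13 (var 11)) <|
      seq (assign 14 (var 12)) <|
      seq (assign 15 (add (var 3) (const 1))) <|
      assign 16 (var 10))
    (seq (assign 13 (read 11 (var 6))) <|
      seq (assign 14 (read 12 (var 6))) <|
      seq (assign 15 (read 13 (var 6))) <|
      assign 16 (read 14 (var 6)))) <|
  seq (write 11 (var 6) (var 13)) <|
  seq (write 12 (var 6) (var 14)) <|
  seq (write 13 (var 6) (var 15)) <|
  write 14 (var 6) (var 16)

/-- Remove the vertex from the tree, and append its parent to the queue if that becomes a leaf. -/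
def peelRemove : Cmd :=
  seq (write 6 (var 6) (sub (read 6 (var 6)) (const 1))) <|
  seq (write 7 (var 6) (sub (read 7 (var 6)) (var 4))) <|
  seq (assign 2 (add (var 2) (const 1))) <|
  ite (read 6 (var 6)) (const 2)
    (seq (write 8 (var 5) (var 6)) (assign 5 (add (var 5) (const 1)))) skip

/-- Compute the tables from the leaves to the root. -/
def peel : Cmd :=
  loop (var 2) (var 5) (seq peelLoad (seq peelStore peelRemove))

section

variable {n : ℕ} {r : Fin n} {par : Fin n → Fin n} {ix cv : Fin n → ℕ} {T : Finset (Fin n)}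
  {M Z S B : ℕ} {G : SimpleGraph (Fin n)} {depth : Fin n → ℕ}

theorem loadEdge_wp (hL : IsLayout r ix cv M Z S B) {s : State} {Q : State → Prop}
    (h : HasInput r par ix cv T s) {v : Fin n} (hv : v ≠ r) (h3 : s.var 3 = v.val)
    (h7 : s.arr 7 v.val = ix v)
    (hQ : Q (((s.setVar 4 (ix v)).setVar 6 (par v).val).setVar 7 (cv v))) :
    loadEdge.wp S B Q s := by
  have hS := hL.n_le_S
  have hB := hL.Z_le_B
  have hZ1 := hL.add_le
  have hi := hL.ix_lt v hv
  have hc := hL.cv_le v hv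
  have hcap := h.cap v hv
  have hpn := (par v).isLt
  have hvn := v.isLt
  have hsum : s.arr 0 (ix v) + s.arr 1 (ix v) = (par v).val + v.val := by
    rcases h.ends v hv with ⟨h1, h2⟩ | ⟨h1, h2⟩ <;> lia
  simp only [loadEdge, Cmd.wp, Expr.Ok, Expr.val, State.setVar_var, State.setVar_arr, h3, h7,
    Nat.reduceEqDiff, reduceIte]
  refine ⟨by lia, fun e he => ?_⟩
  subst he
  rw [hsum, hcap]
  refine ⟨by lia, fun w hw => ⟨by lia, fun c hc => ?_⟩⟩
  obtain rfl : w = (par v).val := by lia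
  rwa [hc]

/-- The effect of `peelLoad`. -/
structure IsLoaded (r : Fin n) (par : Fin n → Fin n) (ix cv : Fin n → ℕ) (T : Finset (Fin n))
    (v : Fin n) (s s' : State) : Prop where
  arr_eq : s'.arr = s.arr
  var_zero : s'.var 0 = s.var 0
  var_one : s'.var 1 = s.var 1
  var_two : s'.var 2 = s.var 2
  var_three : s'.var 3 = v.val
  var_four : s'.var 4 = ix v
  var_five : s'.var 5 = s.var 5
  var_six : s'.var 6 = (par v).val
  var_eight : s'.var 8 = if v ∈ T then cv v + 1 else
      max (s.arr 11 v + s.arr 12 v - s.arr 10 v) (s.arr 9 v % 2)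
  var_ten : s'.var 10 = if v ∈ T then v.val + 1 else s.arr 14 v
  var_eleven : s'.var 11 = min (s'.var 8) (cv v)
  var_twelve : s'.var 12 = min (if v ∈ T then cv v else s.arr 10 v)
    (s'.var 11 + (cv v - s'.var 11) / 2 + (cv v - s'.var 11) / 2)

theorem peelLoad_wp (hL : IsLayout r ix cv M Z S B) {q : ℕ} {O : List (Fin n)} {s : State}
    (h : QueueInv r par ix cv T q O s) (hq : q < O.length)
    (ht : TableInv r par cv T (O.take q).toFinset s) :
    peelLoad.wp S B (IsLoaded r par ix cv T O[q] s) s := by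
  have hS := hL.n_le_S
  have hB := hL.Z_le_B
  have hZ1 := hL.add_le
  have hlen := h.length_le
  obtain ⟨hvr, -, -, h7⟩ := h.next hq
  have h8 := h.order q hq
  have h2 := h.var_two
  have hr : r ∉ (O.take q).toFinset := fun hin =>
    h.root (List.mem_of_mem_take (List.mem_toFinset.1 hin))
  obtain ⟨b9, b10, b11, b12, -⟩ := ht.sums_le hL hr O[q]
  have b14 := ht.tin_le O[q]
  have hterm := h.input.term O[q]
  have hc := hL.cv_le _ hvr
  have hvn := O[q].isLt
  generalize O[q] = v at *
  unfold peelLoad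
  simp only [Cmd.wp, Expr.Ok, Expr.val, h2, h8]
  refine ⟨by lia, fun x hx => ?_⟩
  subst hx
  refine loadEdge_wp hL (h.input.congr (by simp) (by simp) rfl rfl rfl rfl) hvr (by simp)
    (by simpa using h7) ?_
  simp only [maxExpr_ok, maxExpr_val, modExpr_ok, modExpr_val, minExpr_ok, minExpr_val, Expr.Ok,
    Expr.val, State.setVar_var, State.setVar_arr, Nat.reduceEqDiff, reduceIte]
  have hb : ∀ ao a bo : ℕ, a = min ao (cv v) → bo ≤ Z → bo < B ∧
      ((a < B ∧ (cv v < B ∧ a < B) ∧ a + (cv v - a) / 2 < B) ∧ (cv v < B ∧ a < B) ∧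
        a + (cv v - a) / 2 + (cv v - a) / 2 < B) := by
    intro ao a bo ha hbo
    omega
  refine ⟨⟨by lia, by lia, by lia, ?_⟩, fun hT => ⟨by lia, fun ao hao => ⟨by lia, fun bo hbo =>
    ⟨by lia, fun t ht => ⟨by lia, fun a ha => ⟨hb ao a bo ha (by lia), fun b hb => ?_⟩⟩⟩⟩⟩,
    fun hT => ⟨⟨⟨⟨by lia, by lia, by lia⟩, by lia⟩, by lia⟩, fun ao hao => ⟨by lia, fun bo hbo =>
    ⟨by lia, fun t ht => ⟨by lia, fun a ha => ⟨hb ao a bo ha (by lia), fun b hb => ?_⟩⟩⟩⟩⟩⟩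
  · rw [hterm]
    split_ifs <;> lia
  · have hvT : v ∈ T := by
      by_contra hvT
      simp [hterm, hvT] at hT
    constructor <;> simp [hvT, hao, hbo, ht, ha, hb]
  · have hvT : v ∉ T := by
      intro hvT
      simp [hterm, hvT] at hT
    constructor <;> simp [hvT, hao, hbo, ht, ha, hb, h2]

theorem peelStore_wp (hL : IsLayout r ix cv M Z S B) (hR : IsRooting G r par depth)
    {D : Finset (Fin n)} {v : Fin n} {s₀ s : State} (h : IsLoaded r par ix cv T v s₀ s)
    (ht : TableInv r par cv T D s₀) (hr : r ∉ D) (hvr : v ≠ r) (hv : v ∉ D) (hp : par v ∉ D) :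
    peelStore.wp S B (fun s' => TableInv r par cv T (insert v D) s' ∧
      (∀ a, a < 9 → s'.arr a = s.arr a) ∧ ∀ x, x < 13 → s'.var x = s.var x) s := by
  have hS := hL.n_le_S
  have hB := hL.Z_le_B
  have hZ1 := hL.add_le
  have hvn := v.isLt
  have hpn := (par v).isLt
  have hc := hL.cv_le v hvr
  obtain ⟨-, d10, -⟩ := ht.sums_le hL hr v
  obtain ⟨-, -, d11, d12, -⟩ := ht.sums_le hL hr v
  obtain ⟨b9, b10, b11, b12, b13⟩ := ht.sums_le hL hr (par v)
  have b14 := ht.tin_le (par v)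
  have d14 := ht.tin_le v
  obtain ⟨ha, -, -, -, h3, -, -, h6, h8, h10, h11, h12⟩ := h
  have key : ∀ s' : State, (∃ x y z w,
      ((s.arr 11 (par v) < s.var 11 ∧ x = s.var 11 ∧ y = s.var 12 ∧ z = v.val + 1 ∧
        w = s.var 10) ∨
      (¬ s.arr 11 (par v) < s.var 11 ∧ x = s.arr 11 (par v) ∧ y = s.arr 12 (par v) ∧
        z = s.arr 13 (par v) ∧ w = s.arr 14 (par v))) ∧
      s'.arr 18 = Function.update (s.arr 18) v (s.var 8) ∧
      s'.arr 15 = Function.update (s.arr 15) v (s.var 10) ∧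
      s'.arr 16 = Function.update (s.arr 16) v (s.var 11) ∧
      s'.arr 17 = Function.update (s.arr 17) v (s.var 12) ∧
      s'.arr 9 = Function.update (s.arr 9) (par v) (s.arr 9 (par v) + s.var 11) ∧
      s'.arr 10 = Function.update (s.arr 10) (par v) (s.arr 10 (par v) + s.var 12) ∧
      s'.arr 11 = Function.update (s.arr 11) (par v) x ∧
      s'.arr 12 = Function.update (s.arr 12) (par v) y ∧
      s'.arr 13 = Function.update (s.arr 13) (par v) z ∧
      s'.arr 14 = Function.update (s.arr 14) (par v) w) →
      TableInv r par cv T (insert v D) s' := by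
    rintro s' ⟨x, y, z, w, hx, g1, g2, g3, g4, g5, g6, g7, g8, g9, g10⟩
    rw [ha] at hx g1 g2 g3 g4 g5 g6 g7 g8 g9 g10
    exact ht.step hvr hv hp (hR.par_ne hvr) h8 h10 h11 h12 hx g1 g2 g3 g4 g5 g6 g7 g8 g9 g10
  have e8 : s.var 8 < B := by
    rw [h8]
    split_ifs <;> omega
  have e10 : s.var 10 < B := by
    rw [h10]
    split_ifs <;> omega
  have e11 : s.var 11 ≤ M := by lia
  have e12 : s.var 12 ≤ Z := by
    rw [h12]
    split_ifs <;> omega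
  rw [← ha] at b9 b10 b11 b12 b13 b14
  unfold peelStore
  simp only [Cmd.wp, Expr.Ok, Expr.val, State.setVar_var, State.setVar_arr, State.setArr_var,
    State.setArr_arr, Nat.reduceEqDiff, reduceIte, h3, h6]
  refine ⟨by lia, by lia, fun x1 hx1 => ⟨by lia, by lia, fun x2 hx2 => ⟨by lia, by lia,
    fun x3 hx3 => ⟨by lia, by lia, fun x4 hx4 => ⟨by lia, by lia, fun x5 hx5 => ⟨by lia, by lia,
    fun x6 hx6 => ⟨by lia, fun hlt => ⟨by lia, fun x hx => ⟨by lia, fun y hy => ⟨by lia,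
    fun z hz => ⟨by lia, fun w hw => ⟨by lia, by lia, fun y1 hy1 => ⟨by lia, by lia, fun y2 hy2 =>
    ⟨by lia, by lia, fun y3 hy3 => ⟨by lia, by lia, fun y4 hy4 => ⟨key _ ⟨x, y, z, w,
    Or.inl ⟨hlt, hx, hy, hz, hw⟩, ?_⟩, ?_, ?_⟩⟩⟩⟩⟩⟩⟩⟩⟩, fun hlt =>
    ⟨by lia, fun x hx => ⟨by lia, fun y hy => ⟨by lia,
    fun z hz => ⟨by lia, fun w hw => ⟨by lia, by lia, fun y1 hy1 => ⟨by lia, by lia, fun y2 hy2 =>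
    ⟨by lia, by lia, fun y3 hy3 => ⟨by lia, by lia, fun y4 hy4 => ⟨key _ ⟨x, y, z, w,
    Or.inr ⟨hlt, hx, hy, hz, hw⟩, ?_⟩, ?_, ?_⟩⟩⟩⟩⟩⟩⟩⟩⟩⟩⟩⟩⟩⟩⟩⟩
  · subst_vars
    simp
  · intro a h9
    simp only [show ∀ b, 9 ≤ b → a ≠ b from fun b hb => by lia, Nat.reduceLeDiff, reduceIte]
  · intro x h13
    simp only [show ∀ b, 13 ≤ b → x ≠ b from fun b hb => by lia, Nat.reduceLeDiff, reduceIte]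
  · subst_vars
    simp
  · intro a h9
    simp only [show ∀ b, 9 ≤ b → a ≠ b from fun b hb => by lia, Nat.reduceLeDiff, reduceIte]
  · intro x h13
    simp only [show ∀ b, 13 ≤ b → x ≠ b from fun b hb => by lia, Nat.reduceLeDiff, reduceIte]

theorem peelRemove_wp (hL : IsLayout r ix cv M Z S B)
    {q : ℕ} {O : List (Fin n)} {s : State} (h : QueueInv r par ix cv T q O s)
    (hq : q < O.length) (h4 : s.var 4 = ix O[q]) (h6 : s.var 6 = (par O[q]).val) :
    peelRemove.wp S B (fun s' => (∃ O', O'.take (q + 1) = O.take (q + 1) ∧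
      QueueInv r par ix cv T (q + 1) O' s') ∧
      ∀ a, 9 ≤ a → s'.arr a = s.arr a) s := by
  have hS := hL.n_le_S
  have hB := hL.Z_le_B
  have hZ1 := hL.add_le
  have hZ2 := hL.sq_le
  have hpn := (par O[q]).isLt
  have hlen := h.length_le
  obtain ⟨hvr, -⟩ := h.next hq
  have hix := hL.ix_lt _ hvr
  have hdeg : s.arr 6 (par O[q]).val ≤ n + 2 := by
    have h1 := ((children r par (par O[q])).filter (· ∉ O.take q)).card_le_univ
    rw [Fintype.card_fin] at h1
    rw [h.deg]
    split_ifs <;> lia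
  have hsum : s.arr 7 (par O[q]).val ≤ n * n + n := by
    rw [h.sum]
    have h1 : ∑ u ∈ children r par (par O[q]) with u ∉ O.take q, ix u ≤ n * n := by
      refine (Finset.sum_le_card_nsmul _ _ n fun u hu => ?_).trans (Nat.mul_le_mul_right _
        ((Finset.card_le_univ _).trans_eq (Fintype.card_fin n)))
      have := hL.ix_lt u (mem_children.1 (Finset.mem_filter.1 hu).1).1
      lia
    split_ifs with h2
    · lia
    · have := hL.ix_lt _ h2
      lia
  have h2 := h.var_two
  have h5 := h.var_five
  unfold peelRemove
  simp only [Cmd.wp, Expr.Ok, Expr.val, State.setVar_var, State.setVar_arr, State.setArr_var,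
    State.setArr_arr, Nat.reduceEqDiff, reduceIte, h6, h2, h4, h5, Function.update_self]
  refine ⟨by lia, by lia, fun d hd => ⟨by lia, by lia, fun e he => ⟨by lia, fun w hw =>
    ⟨by lia, fun hlt => ⟨by lia, by lia, fun x hx => ⟨by lia, fun y hy =>
      ⟨⟨O ++ [par O[q]], List.take_append_of_le_length hq, h.step hq
        (h.input.congr ?_ ?_ ?_ ?_ ?_ ?_) ?_ ?_ ?_ ?_ (Or.inl ⟨by lia, rfl, ?_⟩)⟩, ?_⟩⟩⟩,
    fun hlt => ⟨⟨O, rfl, h.step hq (h.input.congr ?_ ?_ ?_ ?_ ?_ ?_) ?_ ?_ ?_ ?_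
      (Or.inr ⟨by lia, rfl, ?_⟩)⟩, ?_⟩⟩⟩⟩⟩
  all_goals try
    subst_vars
    simp [h5]
  all_goals
    intro a h9
    simp only [show ∀ b, b ≤ 8 → a ≠ b from fun b hb => by lia, Nat.reduceLeDiff, reduceIte]

/-- Each iteration removes one vertex, and the root never enters the queue, so fewer than `n`
iterations occur. -/
theorem peel_runs (hL : IsLayout r ix cv M Z S B) (hR : IsRooting G r par depth)
    {s : State} {O : List (Fin n)} (h : QueueInv r par ix cv T 0 O s)
    (ht : TableInv r par cv T ∅ s) :
    Runs S B peel s ((3 + (peelLoad.time + (peelStore.time + peelRemove.time))) * (n + 1))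
      fun s => ∃ O : List (Fin n), QueueInv r par ix cv T O.length O s ∧
        TableInv r par cv T O.toFinset s := by
  have hS := hL.n_le_S
  have hB := hL.Z_le_B
  have hZ1 := hL.add_le
  refine (Runs.loop (I := fun j s => ∃ q O, q + j = n ∧ QueueInv r par ix cv T q O s ∧
    TableInv r par cv T (O.take q).toFinset s)
    (t := (peelLoad.time + (peelStore.time + peelRemove.time)))
    (fun j s h => ?_) (fun j s h hlt => ?_)
    (fun j s h hlt => ?_) n ⟨0, O, by lia, h, by simpa using ht⟩)
  · obtain ⟨q, O, hj, h, -⟩ := h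
    have := h.length_le
    have := h.le
    simp only [Expr.Ok, h.var_two, h.var_five]
    lia
  · obtain ⟨q, O, hj, h, ht⟩ := h
    have hlen := h.length_le
    simp only [Expr.val, h.var_two, h.var_five] at hlt
    obtain ⟨j, rfl⟩ : ∃ j', j = j' + 1 := ⟨j - 1, by lia⟩
    obtain ⟨hvr, hv, hp, -⟩ := h.next hlt
    have hr : r ∉ (O.take q).toFinset := fun hin =>
      h.root (List.mem_of_mem_take (List.mem_toFinset.1 hin))
    have hins : insert O[q] (O.take q).toFinset = (O.take (q + 1)).toFinset := by
      rw [← List.take_concat_get' O q hlt, List.toFinset_append]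
      ext x
      simp [or_comm]
    refine ⟨j, rfl, (peelLoad_wp hL h hlt ht).runs.seq fun s₁ h₁ => ?_⟩
    refine (peelStore_wp hL hR h₁ ht hr hvr (by simpa using hv) (by simpa using hp)).runs.seq
      fun s₂ h₂ => ?_
    obtain ⟨h₂, harr, hvar⟩ := h₂
    rw [h₁.arr_eq] at harr
    have hq : QueueInv r par ix cv T q O s₂ := by
      have e0 := (hvar 0 (by lia)).trans h₁.var_zero
      have e1 := (hvar 1 (by lia)).trans h₁.var_one
      obtain ⟨g1, g2, g3, g4, g5, g6, g7, g8, g9, g10, g11⟩ := h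
      refine ⟨g1.congr e0 e1 (harr 0 (by lia)) (harr 1 (by lia)) (harr 2 (by lia))
        (harr 3 (by lia)), ?_, ?_, g4, g5, g6, ?_, g8, g9, ?_, ?_⟩
      · rw [hvar 2 (by lia), h₁.var_two, g2]
      · rw [hvar 5 (by lia), h₁.var_five, g3]
      · rwa [harr 8 (by lia)]
      · rwa [harr 6 (by lia)]
      · rwa [harr 7 (by lia)]
    refine (peelRemove_wp hL hq hlt ((hvar 4 (by lia)).trans h₁.var_four)
      ((hvar 6 (by lia)).trans h₁.var_six)).runs.mono le_rfl fun s₃ h₃ => ?_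
    obtain ⟨⟨O', hO', h₃⟩, harr'⟩ := h₃
    refine ⟨q + 1, O', by lia, h₃, ?_⟩
    rw [hO', ← hins]
    exact h₂.congr fun a ha _ => harr' a ha
  · obtain ⟨q, O, hj, h, ht⟩ := h
    simp only [Expr.val, h.var_two, h.var_five] at hlt
    have := h.le
    obtain rfl : q = O.length := by lia
    rw [List.take_length] at ht
    exact ⟨O, h, ht⟩

end

end TreeFlow

/-! ### The pass from the root to the leaves -/

theorem isGreedyShare_empty {n : ℕ} (a b k : Fin n → ℕ) (R : ℕ) : IsGreedyShare a b k ∅ R R := by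
  constructor <;> simp

theorem IsGreedyShare.congr {n : ℕ} {a b k k' : Fin n → ℕ} {C : Finset (Fin n)} {R₀ R : ℕ}
    (h : IsGreedyShare a b k C R₀ R) (hk : ∀ u ∈ C, k' u = k u) : IsGreedyShare a b k' C R₀ R := by
  refine ⟨fun u hu => ?_, fun he => ⟨(h.even he).1, fun u hu => ?_⟩, ?_, fun hR u hu => ?_⟩
  · rw [hk u hu]
    exact h.bounds u hu
  · rw [hk u hu]
    exact (h.even he).2 u hu
  · rw [Finset.sum_congr rfl hk]
    exact h.sum_eq
  · rw [hk u hu]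
    exact h.exhausted hR u hu

theorem IsGreedyShare.le {n : ℕ} {a b k : Fin n → ℕ} {C : Finset (Fin n)} {R₀ R : ℕ}
    (h : IsGreedyShare a b k C R₀ R) : R ≤ R₀ := by
  have h1 := h.sum_eq
  have h2 : ∑ u ∈ C, a u ≤ ∑ u ∈ C, k u := Finset.sum_le_sum fun u hu => (h.bounds u hu).1
  lia

/-- The increment is the whole even difference `b - a` or all of the remainder. So an even remainder
stays even, and a positive one means that `v` has been filled. -/
theorem IsGreedyShare.insert {n : ℕ} {a b k k' : Fin n → ℕ} {C : Finset (Fin n)} {R₀ R R' : ℕ}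
    (h : IsGreedyShare a b k C R₀ R) {v : Fin n} (hv : v ∉ C) (hk : ∀ u ∈ C, k' u = k u)
    (hab : a v ≤ b v) (hpar : b v % 2 = a v % 2) (hkv : k' v = a v + min R (b v - a v))
    (hR : R' = R - min R (b v - a v)) : IsGreedyShare a b k' (insert v C) R₀ R' := by
  have h' := h.congr hk
  refine ⟨fun u hu => ?_, fun he => ⟨?_, fun u hu => ?_⟩, ?_, fun h0 u hu => ?_⟩
  · rcases Finset.mem_insert.1 hu with rfl | hu
    · lia
    · exact h'.bounds u hu
  · have := (h'.even he).1
    rw [Nat.even_iff] at this ⊢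
    omega
  · rcases Finset.mem_insert.1 hu with rfl | hu
    · have := (h'.even he).1
      rw [Nat.even_iff] at this
      omega
    · exact (h'.even he).2 u hu
  · rw [Finset.sum_insert hv, Finset.sum_insert hv]
    have := h'.sum_eq
    lia
  · rcases Finset.mem_insert.1 hu with rfl | hu
    · lia
    · exact h'.exhausted (by lia) u hu

/-- The top-down values are correct for the vertices in `E`; the amount `R p` is still to be
distributed over the children of `p` outside of `E`. -/
structure IsTopDownOn {n : ℕ} (r : Fin n) (par : Fin n → Fin n) (T E : Finset (Fin n))
    (D : Tables n) (R : Fin n → ℕ) : Prop where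
  share : ∀ p, p = r ∨ p ∈ E → ∃ R₀, IsMode T D p R₀ ∧ IsGreedyShare D.a D.b D.k
    ((children r par p).filter fun u => D.ex p ≠ u.val + 1 ∧ u ∈ E) R₀ (R p)
  k_le : ∀ v ∈ E, D.k v ≤ D.b v
  k_ex : ∀ v ∈ E, D.ex (par v) = v.val + 1 → D.k v = D.a v - D.red (par v)
  lab_root : D.lab r = r.val + 1
  lab_eq : ∀ v ∈ E, D.lab v =
    if D.c v < D.ao v then D.tt v
    else if D.lab (par v) ≠ D.tt v ∧ D.c v < D.B v then 0 else D.lab (par v)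
  lab_le : ∀ v, v = r ∨ v ∈ E → D.lab v ≤ n

section

variable {n : ℕ} {G : SimpleGraph (Fin n)} {r : Fin n} {par : Fin n → Fin n}
  {depth : Fin n → ℕ} {T E : Finset (Fin n)} {D : Tables n} {R : Fin n → ℕ}

theorem IsTopDownOn.isTopDown (h : IsTopDownOn r par T E D R) (hE : ∀ v, v ≠ r → v ∈ E) :
    IsTopDown r par T D := by
  have hroot : ∀ p, p = r ∨ p ∈ E := fun p => (eq_or_ne p r).imp_right (hE p)
  refine ⟨fun p => ?_, fun p u hu he => ?_, h.lab_root, fun v hv => h.lab_eq v (hE v hv)⟩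
  · obtain ⟨R₀, h1, h2⟩ := h.share p (hroot p)
    refine ⟨R₀, R p, h1, ?_⟩
    convert h2 using 1
    refine Finset.filter_congr fun u hu => ?_
    rw [and_iff_left (hE u (mem_children.1 hu).1)]
  · obtain ⟨hur, rfl⟩ := mem_children.1 hu
    exact h.k_ex u (hE u hur) he

theorem isTopDownOn_empty (hr : IsMode T D r (R r)) (hl : D.lab r = r.val + 1) :
    IsTopDownOn r par T ∅ D R := by
  refine ⟨fun p hp => ?_, by simp, by simp, hl, by simp, fun v hv => ?_⟩
  · obtain rfl : p = r := by simpa using hp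
    refine ⟨R p, hr, ?_⟩
    simpa using isGreedyShare_empty _ _ _ _
  · obtain rfl : v = r := by simpa using hv
    rw [hl]
    exact v.isLt

/-- The tables with new top-down values of the vertex `v`. -/
def Tables.update (D : Tables n) (v : Fin n) (k lab red ex : ℕ) : Tables n :=
  { D with
    k := Function.update D.k v k
    lab := Function.update D.lab v lab
    red := Function.update D.red v red
    ex := Function.update D.ex v ex }

/-- Fixing the flow above `v` affects only the remainder kept at its parent and opens the
distribution at `v`. None of the children of `v` has been treated, so that distribution starts
empty. -/
theorem IsTopDownOn.step (hR : IsRooting G r par depth) (hB : IsBottomUp r par T D)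
    (h : IsTopDownOn r par T E D R) (hrE : r ∉ E)
    {v : Fin n} (hv : v ≠ r) (hvE : v ∉ E)
    (hp : par v = r ∨ par v ∈ E) (hch : ∀ u ∈ children r par v, u ∉ E) (htt : D.tt v ≤ n)
    {k lab red ex Rp Rv : ℕ}
    (hk : (D.ex (par v) = v.val + 1 ∧ k = D.a v - D.red (par v) ∧ Rp = R (par v)) ∨
      (D.ex (par v) ≠ v.val + 1 ∧ k = D.a v + min (R (par v)) (D.b v - D.a v) ∧
        Rp = R (par v) - min (R (par v)) (D.b v - D.a v)))
    (hl : lab = if D.c v < D.ao v then D.tt v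
      else if D.lab (par v) ≠ D.tt v ∧ D.c v < D.B v then 0 else D.lab (par v))
    (hm : IsMode T (D.update v k lab red ex) v Rv) :
    IsTopDownOn r par T (insert v E) (D.update v k lab red ex)
      (Function.update (Function.update R (par v) Rp) v Rv) := by
  have hne := hR.par_ne hv
  obtain ⟨hab, hbc, hpar⟩ := hB.bounds hR v hv
  have hE : ∀ u ∈ E, u ≠ v := fun u hu e => hvE (e ▸ hu)
  have hpE : ∀ u ∈ insert v E, par u ≠ v := by
    intro u hu
    rcases Finset.mem_insert.1 hu with rfl | hu
    · exact hne
    · intro e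
      exact hch u (mem_children.2 ⟨fun h => hrE (h ▸ hu), e⟩) hu
  refine ⟨fun p hpm => ?_, fun u hu => ?_, fun u hu he => ?_, ?_, fun u hu => ?_, fun u hu => ?_⟩
  · by_cases hpv : p = v
    · subst hpv
      refine ⟨Rv, hm, ?_⟩
      rw [Function.update_self, Finset.filter_false_of_mem]
      · exact isGreedyShare_empty _ _ _ _
      · intro u hu hu'
        rcases Finset.mem_insert.1 hu'.2 with rfl | hu'
        · exact hne (mem_children.1 hu).2
        · exact hch u hu hu'
    · obtain ⟨R₀, h1, h2⟩ := h.share p (hpm.imp_right fun h => (Finset.mem_insert.1 h).resolve_left hpv)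
      refine ⟨R₀, ?_, ?_⟩
      · simpa [IsMode, Tables.update, Function.update_of_ne hpv] using h1
      rw [Function.update_of_ne hpv]
      have hex : (D.update v k lab red ex).ex p = D.ex p := Function.update_of_ne hpv _ _
      rw [hex]
      have hkE : ∀ u ∈ (children r par p).filter (fun u => D.ex p ≠ u.val + 1 ∧ u ∈ E),
          (D.update v k lab red ex).k u = D.k u := fun u hu =>
        Function.update_of_ne (hE u (Finset.mem_filter.1 hu).2.2) _ _
      have hins : ∀ q, (p ≠ par v ∨ D.ex p = v.val + 1) → q = R p →
          IsGreedyShare D.a D.b (D.update v k lab red ex).k ((children r par p).filter fun u =>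
            D.ex p ≠ u.val + 1 ∧ u ∈ insert v E) R₀ q := by
        rintro q hq rfl
        convert h2.congr hkE using 1
        refine Finset.filter_congr fun u hu => ?_
        rw [Finset.mem_insert]
        refine and_congr_right fun hu' => or_iff_right ?_
        rintro rfl
        rcases hq with hq | hq
        · exact hq (mem_children.1 hu).2.symm
        · exact hu' hq
      by_cases hpp : p = par v
      · subst hpp
        rw [Function.update_self]
        rcases hk with ⟨g1, g2, g3⟩ | ⟨g1, g2, g3⟩
        · exact hins _ (Or.inr g1) g3
        · have hset : ((children r par (par v)).filter fun u =>
              D.ex (par v) ≠ u.val + 1 ∧ u ∈ insert v E) = insert v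
              ((children r par (par v)).filter fun u => D.ex (par v) ≠ u.val + 1 ∧ u ∈ E) := by
            ext u
            simp only [Finset.mem_filter, Finset.mem_insert]
            refine ⟨fun hu => ?_, fun hu => ?_⟩
            · exact hu.2.2.imp_right fun h => ⟨hu.1, hu.2.1, h⟩
            · rcases hu with rfl | hu
              · exact ⟨mem_children.2 ⟨hv, rfl⟩, g1, Or.inl rfl⟩
              · exact ⟨hu.1, hu.2.1, Or.inr hu.2.2⟩
          rw [hset]
          refine h2.insert (fun h => hvE (Finset.mem_filter.1 h).2.2) hkE hab hpar ?_ g3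
          simpa [Tables.update] using g2
      · rw [Function.update_of_ne hpp]
        exact hins _ (Or.inl hpp) rfl
  · rcases Finset.mem_insert.1 hu with rfl | hu
    · have : (D.update u k lab red ex).k u = k := Function.update_self _ _ _
      rw [this]
      change k ≤ D.b u
      lia
    · have : (D.update v k lab red ex).k u = D.k u := Function.update_of_ne (hE u hu) _ _
      rw [this]
      exact h.k_le u hu
  · have h1 : (D.update v k lab red ex).ex (par u) = D.ex (par u) :=
      Function.update_of_ne (hpE u hu) _ _
    have h2 : (D.update v k lab red ex).red (par u) = D.red (par u) :=
      Function.update_of_ne (hpE u hu) _ _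
    rw [h1] at he
    rw [h2]
    rcases Finset.mem_insert.1 hu with rfl | hu
    · have : (D.update u k lab red ex).k u = k := Function.update_self _ _ _
      rw [this]
      exact hk.elim (fun h => h.2.1) fun h => absurd he h.1
    · have : (D.update v k lab red ex).k u = D.k u := Function.update_of_ne (hE u hu) _ _
      rw [this]
      exact h.k_ex u hu he
  · exact (Function.update_of_ne hv.symm _ _).trans h.lab_root
  · have h1 : (D.update v k lab red ex).lab (par u) = D.lab (par u) :=
      Function.update_of_ne (hpE u hu) _ _
    rw [h1]
    rcases Finset.mem_insert.1 hu with rfl | hu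
    · exact (Function.update_self _ _ _).trans hl
    · exact (Function.update_of_ne (hE u hu) _ _).trans (h.lab_eq u hu)
  · by_cases huv : u = v
    · subst huv
      have : (D.update u k lab red ex).lab u = lab := Function.update_self _ _ _
      rw [this, hl]
      have := h.lab_le _ hp
      split_ifs
      · exact htt
      · exact Nat.zero_le _
      · exact this
    · have : (D.update v k lab red ex).lab u = D.lab u := Function.update_of_ne huv _ _
      rw [this]
      exact h.lab_le u (hu.imp_right fun h => (Finset.mem_insert.1 h).resolve_left huv)

end

namespace TreeFlow

open RAM Cmd Expr

/-- Compute the flow `8` on the edge above the vertex, and the amount `9` left for its siblings. -/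
def topFlow : Cmd :=
  -- Equality is tested by requiring the two truncated differences to add up to less than `1`.
  ite (add (sub (read 21 (var 6)) (add (var 3) (const 1)))
      (sub (add (var 3) (const 1)) (read 21 (var 6)))) (const 1)
    (seq (assign 8 (sub (read 16 (var 3)) (read 20 (var 6)))) (assign 9 (read 19 (var 6))))
    (seq (assign 8 (add (read 16 (var 3))
        (minExpr (read 19 (var 6)) (sub (read 17 (var 3)) (read 16 (var 3))))))
      (assign 9 (sub (read 19 (var 6))
        (minExpr (read 19 (var 6)) (sub (read 17 (var 3)) (read 16 (var 3)))))))

/-- Compute the label `10` of the vertex. -/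
def topLabel : Cmd :=
  ite (var 7) (read 18 (var 3)) (assign 10 (read 15 (var 3)))
    (ite (const 0) (add (sub (read 5 (var 6)) (read 15 (var 3)))
        (sub (read 15 (var 3)) (read 5 (var 6))))
      (ite (var 7) (read 10 (var 3)) (assign 10 (const 0)) (assign 10 (read 5 (var 6))))
      (assign 10 (read 5 (var 6))))

/-- Compute how the flow is to be distributed over the children of the vertex. -/
def topMode : Cmd :=
  ite (const 0) (read 3 (var 3))
    (seq (assign 11 (sub (read 10 (var 3)) (read 9 (var 3)))) <|
      seq (assign 12 (const 0)) (assign 13 (const 0)))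
    (ite (read 9 (var 3)) (var 8)
      (seq (assign 11 (sub (var 8) (read 9 (var 3)))) <|
        seq (assign 12 (const 0)) (assign 13 (const 0)))
      (seq (assign 14 (maxExpr (sub (add (read 11 (var 3)) (read 11 (var 3)))
          (add (read 9 (var 3)) (var 8))) (modExpr (add (read 9 (var 3)) (var 8))))) <|
        seq (assign 15 (sub (sub (read 10 (var 3)) (read 12 (var 3)))
          (sub (read 9 (var 3)) (read 11 (var 3))))) <|
        seq (assign 11 (minExpr (sub (var 14) (modExpr (var 14))) (var 15))) <|
        seq (assign 12 (maxExpr (sub (var 14) (var 15)) (modExpr (var 14)))) <|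
        assign 13 (read 13 (var 3))))

/-- Store the values of the vertex. -/
def topStore : Cmd :=
  seq (write 19 (var 6) (var 9)) <|
  seq (write 19 (var 3) (var 11)) <|
  seq (write 20 (var 3) (var 12)) <|
  seq (write 21 (var 3) (var 13)) <|
  seq (write 4 (var 4) (var 8)) <|
  write 5 (var 3) (var 10)

/-- Take the last vertex from the list. -/
def topLoad : Cmd :=
  seq (assign 5 (sub (var 5) (const 1))) <|
  seq (assign 3 (read 8 (var 5))) loadEdge

/-- Initialize the top-down values of the root. -/
def topInit : Cmd :=
  seq (write 19 (var 1) (sub (read 10 (var 1)) (read 9 (var 1)))) <|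
  seq (write 21 (var 1) (const 0)) <|
  write 5 (var 1) (add (var 1) (const 1))

/-- Compute the flow and the cut-system from the root to the leaves. -/
def topDown : Cmd :=
  seq topInit <|
  loop (const 0) (var 5) <|
  seq topLoad (seq topFlow (seq topLabel (seq topMode topStore)))

/-- The tables contained in a state. -/
def stateTables {n : ℕ} (r : Fin n) (ix cv : Fin n → ℕ) (s : State) : Tables n where
  c := cv
  A v := s.arr 9 v
  B v := s.arr 10 v
  mx v := s.arr 11 v
  mb v := s.arr 12 v
  m v := s.arr 13 v
  tin v := s.arr 14 v
  tt v := s.arr 15 v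
  a v := s.arr 16 v
  b v := s.arr 17 v
  ao v := s.arr 18 v
  -- The root has no parent edge; the value `0` there is a mere default.
  k v := if v = r then 0 else s.arr 4 (ix v)
  lab v := s.arr 5 v
  red v := s.arr 20 v
  ex v := s.arr 21 v

section

variable {n : ℕ} {r : Fin n} {par : Fin n → Fin n} {ix cv : Fin n → ℕ} {T : Finset (Fin n)}
  {M Z S B : ℕ} {G : SimpleGraph (Fin n)} {depth : Fin n → ℕ}

theorem TableInv.isBottomUp {D : Finset (Fin n)} {s : State} (h : TableInv r par cv T D s)
    (hD : ∀ v, v ≠ r → v ∈ D) : IsBottomUp r par T (stateTables r ix cv s) := by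
  have hf : ∀ p, (children r par p).filter (· ∈ D) = children r par p := fun p =>
    Finset.filter_true_of_mem fun u hu => hD u (mem_children.1 hu).1
  obtain ⟨h1, h2, h3, -, h5, h6, h7, h8⟩ := h
  simp only [hf] at h1 h2 h3
  exact ⟨fun v hv => h5 v (hD v hv), fun v hv => h6 v (hD v hv), fun v hv => h7 v (hD v hv),
    fun v hv => h8 v (hD v hv), h1, h2, h3⟩

/-- The list `O` contains all vertices except for the root, children before their parents. -/
structure IsElimination (r : Fin n) (par : Fin n → Fin n) (O : List (Fin n)) : Prop where
  nodup : O.Nodup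
  mem_iff : ∀ v, v ∈ O ↔ v ≠ r
  before : ∀ i (h : i < O.length), ∀ u ∈ children r par O[i], u ∈ O.take i

/-- The invariant of the top-down loop, with `i` vertices to be processed. -/
structure TopInv (r : Fin n) (par : Fin n → Fin n) (ix cv : Fin n → ℕ) (T : Finset (Fin n))
    (O : List (Fin n)) (i : ℕ) (s : State) : Prop where
  input : HasInput r par ix cv T s
  var_five : s.var 5 = i
  le : i ≤ O.length
  order : ∀ i (h : i < O.length), s.arr 8 i = (O[i]).val
  edge : ∀ v : Fin n, v ≠ r → s.arr 7 v.val = ix v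
  table : TableInv r par cv T O.toFinset s
  top : IsTopDownOn r par T (O.drop i).toFinset (stateTables r ix cv s) fun v => s.arr 19 v

/-- Bounds for the values read at the vertex `v` with flow `k`. -/
theorem IsMode.le (hL : IsLayout r ix cv M Z S B) {s : State} {O : List (Fin n)}
    (hO : IsElimination r par O)
    (ht : TableInv r par cv T O.toFinset s) {p : Fin n} {R₀ : ℕ}
    (h : IsMode T (stateTables r ix cv s) p R₀)
    (hk : p ∉ T → (stateTables r ix cv s).k p ≤ M) :
    R₀ ≤ Z ∧ s.arr 21 p ≤ n ∧ (s.arr 21 p ≠ 0 → s.arr 20 p ≤ Z + Z) := by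
  have hZ := hL.add_le
  have hr : r ∉ O.toFinset := fun h => ((hO.mem_iff r).1 (List.mem_toFinset.1 h)) rfl
  obtain ⟨b9, b10, b11, b12, b13⟩ := ht.sums_le hL hr p
  simp only [IsMode, stateTables] at h
  simp only [stateTables] at hk
  rcases h with ⟨-, h1, h2⟩ | ⟨h0, h1, h2, h3⟩ | ⟨h0, h1, h2, q, av, h3, h4, h5, h6⟩
  · lia
  · have := hk h0
    lia
  · have := hk h0
    omega

theorem topFlow_wp {s : State} {v p : Fin n} (hS : n ≤ S) (hB : 16 * Z ≤ B)
    (hZ : n + M + 2 ≤ Z) (h3 : s.var 3 = v.val)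
    (h6 : s.var 6 = p.val) (h21 : s.arr 21 p ≤ n) (h20 : s.arr 21 p ≠ 0 → s.arr 20 p ≤ Z + Z)
    (h19 : s.arr 19 p ≤ Z) (h16 : s.arr 16 v ≤ M) (h17 : s.arr 17 v ≤ M) :
    topFlow.wp S B (fun s' => s'.arr = s.arr ∧ (∀ x, x ≠ 8 → x ≠ 9 → s'.var x = s.var x) ∧
      ((s.arr 21 p = v.val + 1 ∧ s'.var 8 = s.arr 16 v - s.arr 20 p ∧ s'.var 9 = s.arr 19 p) ∨
      (s.arr 21 p ≠ v.val + 1 ∧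
        s'.var 8 = s.arr 16 v + min (s.arr 19 p) (s.arr 17 v - s.arr 16 v) ∧
        s'.var 9 = s.arr 19 p - min (s.arr 19 p) (s.arr 17 v - s.arr 16 v)))) s := by
  have hvn := v.isLt
  have hpn := p.isLt
  unfold topFlow
  simp only [minExpr_ok, minExpr_val, Cmd.wp, Expr.Ok, Expr.val, State.setVar_var,
    State.setVar_arr, Nat.reduceEqDiff, reduceIte, h3, h6]
  refine ⟨⟨⟨⟨⟨by lia, by lia, by lia⟩, by lia⟩, ⟨by lia, by lia⟩, by lia⟩, by lia⟩, fun h => ?_,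
    fun h => ?_⟩
  · have h20' := h20 (by lia)
    refine ⟨by lia, fun k hk => ⟨by lia, fun R hR => ⟨trivial, fun x h8 h9 => by simp [h8, h9],
      Or.inl ⟨by lia, by simpa using hk, by simpa using hR⟩⟩⟩⟩
  · have h' : min (s.arr 19 p) (s.arr 17 v - s.arr 16 v) ≤ Z := by lia
    refine ⟨⟨by lia, by lia, by lia⟩, fun k hk => ⟨⟨by lia, by lia, by lia⟩, fun R hR =>
      ⟨trivial, fun x h8 h9 => by simp [h8, h9], Or.inr ⟨by lia, by simpa using hk, by simpa using hR⟩⟩⟩⟩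

theorem topLabel_wp {s : State} {v p : Fin n} {c : ℕ} (hS : n ≤ S) (hB : 16 * Z ≤ B)
    (hZ : n + M + 2 ≤ Z) (h3 : s.var 3 = v.val) (h7 : s.var 7 = c) (hc : c ≤ M)
    (h6 : s.var 6 = p.val) (h5 : s.arr 5 p ≤ n) (h10 : s.arr 10 v ≤ Z) (h15 : s.arr 15 v ≤ n)
    (h18 : s.arr 18 v ≤ 2 * M + 1) :
    topLabel.wp S B (fun s' => s'.arr = s.arr ∧ (∀ x, x ≠ 10 → s'.var x = s.var x) ∧
      s'.var 10 = if c < s.arr 18 v then s.arr 15 v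
        else if s.arr 5 p ≠ s.arr 15 v ∧ c < s.arr 10 v then 0 else s.arr 5 p) s := by
  have hvn := v.isLt
  have hpn := p.isLt
  unfold topLabel
  simp only [Cmd.wp, Expr.Ok, Expr.val, State.setVar_arr, h3, h6, h7]
  refine ⟨by lia, fun h => ⟨by lia, fun w hw => ⟨trivial, fun x hx => by simp [hx], ?_⟩⟩,
    fun h => ⟨⟨by lia, ⟨⟨by lia, by lia⟩, ⟨by lia, by lia⟩, by lia⟩⟩, fun h' => ⟨by lia, fun h'' =>
    ⟨by lia, fun w hw => ⟨trivial, fun x hx => by simp [hx], ?_⟩⟩, fun h'' =>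
    ⟨by lia, fun w hw => ⟨trivial, fun x hx => by simp [hx], ?_⟩⟩⟩, fun h' =>
    ⟨by lia, fun w hw => ⟨trivial, fun x hx => by simp [hx], ?_⟩⟩⟩⟩
  · simp [h, hw]
  · rw [if_neg h, if_pos ⟨by lia, h''⟩]
    simpa using hw
  · rw [if_neg h, if_neg fun h => h'' h.2]
    simpa using hw
  · rw [if_neg h, if_neg fun h => h.1 (by lia)]
    simpa using hw

theorem topMode_wp {s : State} {v : Fin n} (hS : n ≤ S) (hB : 16 * Z ≤ B)
    (hZ : n + M + 2 ≤ Z) (h3 : s.var 3 = v.val) (h8 : s.var 8 ≤ M + Z)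
    (hterm : s.arr 3 v.val = if v ∈ T then 1 else 0)
    (h9 : s.arr 9 v ≤ Z) (h10 : s.arr 10 v ≤ Z) (h11 : s.arr 11 v ≤ M)
    (h12 : s.arr 12 v ≤ M) (h13 : s.arr 13 v ≤ n) (D : Tables n)
    (hA : D.A v = s.arr 9 v) (hBv : D.B v = s.arr 10 v) (hmx : D.mx v = s.arr 11 v)
    (hmb : D.mb v = s.arr 12 v) (hm : D.m v = s.arr 13 v) :
    topMode.wp S B (fun s' => s'.arr = s.arr ∧ (∀ x, x < 11 → s'.var x = s.var x) ∧
      s'.var 11 < B ∧ s'.var 12 < B ∧ s'.var 13 < B ∧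
      ∀ l, IsMode T (D.update v (s.var 8) l (s'.var 12) (s'.var 13)) v (s'.var 11)) s := by
  have hvn := v.isLt
  have ht1 : s.arr 3 v.val ≤ 1 := by
    rw [hterm]
    split_ifs <;> lia
  have hTp : 0 < s.arr 3 v.val → v ∈ T := by
    intro h
    by_contra hT
    simp [hterm, hT] at h
  have hTn : ¬ 0 < s.arr 3 v.val → v ∉ T := by
    intro h hT
    simp [hterm, hT] at h
  unfold topMode
  simp only [maxExpr_ok, maxExpr_val, modExpr_ok, modExpr_val, minExpr_ok, minExpr_val, Cmd.wp,
    Expr.Ok, Expr.val, State.setVar_var, State.setVar_arr, Nat.reduceEqDiff, reduceIte, h3,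
    IsMode, Tables.update, Function.update_self, hA, hBv, hmx, hmb, hm]
  have hvS : v.val < S := by lia
  have hvB : v.val < B := by lia
  have b9 : s.arr 9 v < B := by lia
  have b10 : s.arr 10 v < B := by lia
  have b11 : s.arr 11 v < B := by lia
  have b12 : s.arr 12 v < B := by lia
  have b13 : s.arr 13 v < B := by lia
  have b8 : s.var 8 < B := by lia
  have b0 : 0 < B := by lia
  refine ⟨⟨b0, hvB, hvS, by lia⟩, fun h => ⟨⟨⟨hvB, hvS, b10⟩, hvB, hvS, b9⟩, fun R hR =>
    ⟨b0, fun red hred => ⟨b0, fun ex hex => ⟨trivial, fun x hx => ?_, by lia, by lia, by lia,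
      fun l => Or.inl ⟨hTp h, hR, hex⟩⟩⟩⟩⟩,
    fun h => ⟨⟨⟨hvB, hvS, b9⟩, b8⟩, fun hlt => ⟨⟨b8, hvB, hvS, b9⟩, fun R hR => ⟨b0, fun red hred =>
    ⟨b0, fun ex hex => ⟨trivial, fun x hx => ?_, by lia, by lia, by lia,
      fun l => Or.inr (Or.inl ⟨hTn h, hlt, hR, hex⟩)⟩⟩⟩⟩,
    fun hlt => ⟨⟨⟨⟨⟨hvB, hvS, b11⟩, ⟨hvB, hvS, b11⟩, by lia⟩, ⟨hvB, hvS, b9⟩, b8, by lia⟩,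
      ⟨hvB, hvS, b9⟩, b8, by lia⟩, fun q hq => ?_⟩⟩⟩
  · simp only [show ∀ b, 11 ≤ b → x ≠ b from fun b hb => by lia, Nat.reduceLeDiff, reduceIte]
  · simp only [show ∀ b, 11 ≤ b → x ≠ b from fun b hb => by lia, Nat.reduceLeDiff, reduceIte]
  · have hqB : q < B := by omega
    refine ⟨⟨⟨⟨hvB, hvS, b10⟩, hvB, hvS, b12⟩, ⟨hvB, hvS, b9⟩, hvB, hvS, b11⟩, fun av hav => ?_⟩
    have haB : av < B := by omega
    refine ⟨⟨⟨hqB, hqB⟩, haB⟩, fun R hR => ⟨⟨⟨hqB, haB⟩, hqB⟩, fun red hred =>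
      ⟨⟨hvB, hvS, b13⟩, fun ex hex => ⟨trivial, fun x hx => ?_, by lia, by lia, by lia, fun l =>
      Or.inr (Or.inr ⟨hTn h, by lia, hex, q, av, ?_, hav, hR, hred⟩)⟩⟩⟩⟩
    · simp only [show ∀ b, 11 ≤ b → x ≠ b from fun b hb => by lia, Nat.reduceLeDiff, reduceIte]
    · rw [hq, two_mul]

end

end TreeFlow

namespace TreeFlow

open RAM Cmd Expr

section

variable {n : ℕ} {r : Fin n} {par : Fin n → Fin n} {ix cv : Fin n → ℕ} {T : Finset (Fin n)}
  {M Z S B : ℕ} {G : SimpleGraph (Fin n)} {depth : Fin n → ℕ}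

theorem update_val_comp (f : ℕ → ℕ) (v : Fin n) (x : ℕ) :
    (fun u : Fin n => Function.update f v.val x u.val) =
      Function.update (fun u : Fin n => f u.val) v x := by
  ext u
  simp [Function.update_apply, Fin.val_inj]

/-- Children precede their parents in the list, so in a backward reading the parent has been treated
already, unless it is the root. -/
theorem IsElimination.par_mem {O : List (Fin n)} (hO : IsElimination r par O) {i : ℕ}
    (hi : i < O.length) : par O[i] = r ∨ par O[i] ∈ O.drop (i + 1) := by
  rw [or_iff_not_imp_left]
  intro hp
  obtain ⟨j, hj, he⟩ := List.getElem_of_mem ((hO.mem_iff _).2 hp)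
  have hr : O[i] ≠ r := (hO.mem_iff _).1 (List.getElem_mem hi)
  obtain ⟨l, hl, he'⟩ := List.mem_take_iff_getElem.1
    (hO.before j hj O[i] (mem_children.2 ⟨hr, he.symm⟩))
  have : l = i := (hO.nodup.getElem_inj_iff).1 he'
  rw [List.mem_drop_iff_getElem]
  exact ⟨j - (i + 1), by lia, by rw [← he]; congr 1; lia⟩

theorem IsElimination.notMem_drop {O : List (Fin n)} (hO : IsElimination r par O) {i : ℕ}
    (hi : i < O.length) : O[i] ∉ O.drop (i + 1) ∧
      ∀ u ∈ children r par O[i], u ∉ O.drop (i + 1) := by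
  have key : ∀ u, u ∈ O.take (i + 1) → u ∉ O.drop (i + 1) := fun u h1 h2 =>
    List.disjoint_take_drop hO.nodup le_rfl h1 h2
  refine ⟨key _ (List.mem_take_iff_getElem.2 ⟨i, by lia, rfl⟩), fun u hu => key u ?_⟩
  exact List.take_subset_take_left O (Nat.le_succ i) (hO.before i hi u hu)

theorem topLoad_wp (hL : IsLayout r ix cv M Z S B) {O : List (Fin n)}
    (hO : IsElimination r par O) {i : ℕ} {s : State}
    (h : TopInv r par ix cv T O (i + 1) s) :
    topLoad.wp S B (fun s' => s'.arr = s.arr ∧ s'.var 0 = s.var 0 ∧ s'.var 1 = s.var 1 ∧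
      s'.var 5 = i ∧ s'.var 3 = (O[i]'h.le).val ∧ s'.var 4 = ix (O[i]'h.le) ∧
      s'.var 6 = (par (O[i]'h.le)).val ∧ s'.var 7 = cv (O[i]'h.le)) s := by
  have hS := hL.n_le_S
  have hB := hL.Z_le_B
  have hZ1 := hL.add_le
  have hlen : O.length < n := by
    have h1 : (r :: O).Nodup := List.nodup_cons.2 ⟨fun h => (hO.mem_iff r).1 h rfl, hO.nodup⟩
    simpa using h1.length_le_card
  have hvr := (hO.mem_iff _).1 (List.getElem_mem h.le)
  have h8 := h.order i h.le
  have h5 := h.var_five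
  have hle := h.le
  have h7 := h.edge _ hvr
  generalize O[i]'h.le = v at *
  have hvn := v.isLt
  unfold topLoad
  simp only [Cmd.wp, Expr.Ok, Expr.val, State.setVar_var, State.setVar_arr, reduceIte, h5]
  refine ⟨by lia, fun j hj => ?_⟩
  obtain rfl : i = j := by lia
  rw [h8]
  refine ⟨by lia, fun w hw => ?_⟩
  subst hw
  refine loadEdge_wp hL (h.input.congr (by simp) (by simp) rfl rfl rfl rfl) hvr (by simp)
    (by simpa using h7) ?_
  simp

theorem TopInv.body (hL : IsLayout r ix cv M Z S B) (hR : IsRooting G r par depth)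
    {O : List (Fin n)} (hO : IsElimination r par O) (hrT : r ∈ T) {i : ℕ} {s : State}
    (h : TopInv r par ix cv T O (i + 1) s) :
    Runs S B (seq topLoad (seq topFlow (seq topLabel (seq topMode topStore)))) s
      (topLoad.time + (topFlow.time + (topLabel.time + (topMode.time + topStore.time))))
      (TopInv r par ix cv T O i) := by
  have hS := hL.n_le_S
  have hB := hL.Z_le_B
  have hZ := hL.add_le
  have hi : i < O.length := h.le
  refine (topLoad_wp hL hO h).runs.seq fun s₁ ⟨harr₁, g0, g1, g5, g3, g4, g6, g7⟩ => ?_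
  have hvr := (hO.mem_iff _).1 (List.getElem_mem hi)
  have hr : r ∉ O.toFinset := fun h => ((hO.mem_iff r).1 (List.mem_toFinset.1 h)) rfl
  have hrE : r ∉ (O.drop (i + 1)).toFinset := fun h =>
    hr (List.mem_toFinset.2 (List.mem_of_mem_drop (List.mem_toFinset.1 h)))
  have hvO : O[i] ∈ O.toFinset := List.mem_toFinset.2 (List.getElem_mem hi)
  obtain ⟨hvE, hch⟩ := hO.notMem_drop hi
  have hp := hO.par_mem hi
  have hdrop : (O.drop i).toFinset = insert O[i] (O.drop (i + 1)).toFinset := by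
    rw [List.drop_eq_getElem_cons hi, List.toFinset_cons]
  have hbu : IsBottomUp r par T (stateTables r ix cv s) :=
    h.table.isBottomUp fun v hv => List.mem_toFinset.2 ((hO.mem_iff v).2 hv)
  have hc := hL.cv_le _ hvr
  have hix := hL.ix_lt _ hvr
  obtain ⟨b9, b10, b11, b12, b13⟩ := h.table.sums_le hL hr O[i]
  obtain ⟨b16, b17⟩ := h.table.le hL hr hvO
  have b14 := h.table.tin_le O[i]
  have b15 : s.arr 15 O[i] ≤ n := by
    rw [h.table.tt_eq _ hvO]
    split_ifs
    · exact O[i].isLt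
    · exact b14
  have b18 : s.arr 18 O[i] ≤ 2 * M + 1 := by
    rw [h.table.ao_eq _ hvO]
    split_ifs <;> omega
  have hterm := h.input.term O[i]
  have hp' : par O[i] = r ∨ par O[i] ∈ (O.drop (i + 1)).toFinset :=
    hp.imp_right List.mem_toFinset.2
  obtain ⟨R₀, hmode, hshare⟩ := h.top.share _ hp'
  have hRle : s.arr 19 (par O[i]) ≤ R₀ := hshare.le
  obtain ⟨c19, c21, c20⟩ := IsMode.le hL hO h.table hmode fun hpT => by
    have hpE := hp'.resolve_left fun e => hpT (e ▸ hrT)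
    have h1 := h.top.k_le _ hpE
    have h2 := (h.table.le hL hr (List.mem_toFinset.2
      (List.mem_of_mem_drop (List.mem_toFinset.1 hpE)))).2
    exact h1.trans h2
  have c5 : s.arr 5 (par O[i]) ≤ n := h.top.lab_le _ hp'
  refine (topFlow_wp hS hB hZ g3 g6 (by rwa [harr₁]) (by rwa [harr₁]) (by rw [harr₁]; lia)
    (by rwa [harr₁]) (by rwa [harr₁])).runs.seq fun s₂ ⟨harr₂, hvar₂, hk⟩ => ?_
  rw [harr₁] at harr₂ hk
  refine (topLabel_wp hS hB hZ ((hvar₂ 3 (by lia) (by lia)).trans g3)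
    ((hvar₂ 7 (by lia) (by lia)).trans g7) hc ((hvar₂ 6 (by lia) (by lia)).trans g6)
    (by rwa [harr₂]) (by rwa [harr₂]) (by rwa [harr₂]) (by rwa [harr₂])).runs.seq
    fun s₃ ⟨harr₃, hvar₃, hlab⟩ => ?_
  rw [harr₂] at harr₃ hlab
  have e8 : s₃.var 8 = s₂.var 8 := hvar₃ 8 (by lia)
  have hkle : s₂.var 8 ≤ M + Z ∧ s₂.var 9 ≤ Z := by omega
  refine (topMode_wp (T := T) hS hB hZ
    ((hvar₃ 3 (by lia)).trans ((hvar₂ 3 (by lia) (by lia)).trans g3))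
    (by lia) (by rwa [harr₃]) (by rwa [harr₃]) (by rwa [harr₃]) (by rwa [harr₃])
    (by rwa [harr₃]) (by rwa [harr₃]) (stateTables r ix cv s) (by rw [harr₃]; rfl)
    (by rw [harr₃]; rfl) (by rw [harr₃]; rfl) (by rw [harr₃]; rfl) (by rw [harr₃]; rfl)).runs.seq
    fun s₄ ⟨harr₄, hvar₄, d11, d12, d13, hm⟩ => ?_
  rw [harr₃] at harr₄
  have key : ∀ x, x < 8 → s₄.var x = s₁.var x := fun x hx => by
    rw [hvar₄ x (by lia), hvar₃ x (by lia), hvar₂ x (by lia) (by lia)]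
  have e8' : s₄.var 8 = s₂.var 8 := by rw [hvar₄ 8 (by lia), e8]
  have e9' : s₄.var 9 = s₂.var 9 := by rw [hvar₄ 9 (by lia), hvar₃ 9 (by lia)]
  have e10' : s₄.var 10 = s₃.var 10 := hvar₄ 10 (by lia)
  have d10 : s₃.var 10 ≤ n := by
    rw [hlab]
    split_ifs
    · exact b15
    · exact Nat.zero_le _
    · exact c5
  rw [e8] at hm
  have hstep := h.top.step hR hbu hrE hvr (by simpa using hvE) hp' (by simpa using hch) b15
    hk hlab (hm _)
  rw [← hdrop] at hstep
  refine Cmd.wp.runs ?_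
  unfold topStore
  have hvn := O[i].isLt
  have hpn := (par O[i]).isLt
  simp only [Cmd.wp, Expr.Ok, Expr.val, State.setArr_var, key 3 (by lia), key 6 (by lia),
    key 4 (by lia), g3, g6, g4, e8', e9', e10']
  refine ⟨by lia, by lia, fun x1 hx1 => ⟨by lia, by lia, fun x2 hx2 => ⟨by lia, by lia,
    fun x3 hx3 => ⟨by lia, by lia, fun x4 hx4 => ⟨by lia, by lia, fun x5 hx5 => ⟨by lia, by lia,
    fun x6 hx6 => ⟨h.input.congr ?_ ?_ ?_ ?_ ?_ ?_, ?_, ?_, ?_, ?_, h.table.congr ?_, ?_⟩⟩⟩⟩⟩⟩⟩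
  · simp [key 0 (by lia), g0]
  · simp [key 1 (by lia), g1]
  · simp [harr₄]
  · simp [harr₄]
  · simp [harr₄]
  · simp [harr₄]
  · simp [key 5 (by lia), g5]
  · exact hi.le
  · simpa [harr₄] using h.order
  · simpa [harr₄] using h.edge
  · intro a h9 h18
    simp only [State.setArr_arr, harr₄]
    simp only [show ∀ b, 19 ≤ b → a ≠ b from fun b hb => by lia,
      show ∀ b, b < 9 → a ≠ b from fun b hb => by lia, Nat.reduceLeDiff, Nat.reduceLT, reduceIte]
  · subst hx1 hx2 hx3 hx4 hx5 hx6
    convert hstep using 1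
    · simp only [stateTables, Tables.update, State.setArr_arr, harr₄, Nat.reduceEqDiff, reduceIte,
        update_val_comp, Tables.mk.injEq, true_and, and_true]
      ext u
      by_cases huv : u = O[i]
      · subst huv
        simp [hvr]
      · rw [Function.update_of_ne huv]
        by_cases hur : u = r
        · simp [hur]
        -- Edge indices are distinct, so writing the flow above one vertex leaves the flow above the
        -- others intact.
        · rw [if_neg hur, if_neg hur, Function.update_of_ne fun e =>
            huv (hL.ix_inj _ _ hur hvr e)]
    · simp only [State.setArr_arr, harr₄, Nat.reduceEqDiff, reduceIte, update_val_comp]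

theorem topDown_runs (hL : IsLayout r ix cv M Z S B) (hR : IsRooting G r par depth)
    (hrT : r ∈ T) {O : List (Fin n)} {s : State} (h : QueueInv r par ix cv T O.length O s)
    (ht : TableInv r par cv T O.toFinset s) :
    Runs S B topDown s (topInit.time + (3 + (topLoad.time + (topFlow.time +
      (topLabel.time + (topMode.time + topStore.time))))) * (n + 1))
      fun s => IsBottomUp r par T (stateTables r ix cv s) ∧
        IsTopDown r par T (stateTables r ix cv s) := by
  have hS := hL.n_le_S
  have hB := hL.Z_le_B
  have hZ := hL.add_le
  have hlen := h.length_le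
  have hO : IsElimination r par O := ⟨h.nodup, fun v =>
    ⟨fun hv e => h.root (e ▸ hv), h.mem hR v⟩, fun i hi u hu => (h.before i hi u hu).1⟩
  have hr : r ∉ O.toFinset := fun h => ((hO.mem_iff r).1 (List.mem_toFinset.1 h)) rfl
  have hinit : Runs S B topInit s topInit.time (TopInv r par ix cv T O O.length) := by
    refine Cmd.wp.runs ?_
    have h1 := h.input.var_one
    have hrn := r.isLt
    obtain ⟨b9, b10, -⟩ := ht.sums_le hL hr r
    unfold topInit
    simp only [Cmd.wp, Expr.Ok, Expr.val, State.setArr_var, h1]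
    refine ⟨by lia, by lia, fun x1 hx1 => ⟨by lia, by lia, fun x2 hx2 => ⟨by lia, by lia,
      fun x3 hx3 => ⟨h.input.congr ?_ ?_ ?_ ?_ ?_ ?_, ?_, le_rfl, ?_, fun v hv => ?_,
        ht.congr ?_, ?_⟩⟩⟩⟩
    · simp
    · simp
    · simp
    · simp
    · simp
    · simp
    · simpa using h.var_five
    · simpa using h.order
    · have h2 := h.sum v
      rw [if_neg hv, Finset.filter_false_of_mem, Finset.sum_empty, add_zero] at h2
      · simpa using h2
      · intro u hu
        rw [List.take_length, not_not]
        exact (hO.mem_iff u).2 (mem_children.1 hu).1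
    · intro a h9 h18
      simp only [State.setArr_arr]
      simp only [show ∀ b, 19 ≤ b → a ≠ b from fun b hb => by lia,
        show ∀ b, b < 9 → a ≠ b from fun b hb => by lia, Nat.reduceLeDiff, Nat.reduceLT, reduceIte]
    · rw [List.drop_length, List.toFinset_nil]
      refine isTopDownOn_empty (Or.inl ⟨hrT, ?_, ?_⟩) ?_
      · simp [stateTables, hx1]
      · simp [stateTables, hx2]
      · simp [stateTables, hx3]
  refine hinit.seq fun s hs => ?_
  refine (Runs.loop (I := fun j s => TopInv r par ix cv T O j s)
    (t := topLoad.time + (topFlow.time + (topLabel.time + (topMode.time + topStore.time))))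
    (fun j s h => ?_) (fun j s h hlt => ?_) (fun j s h hlt => ?_) O.length hs).mono
    (Nat.mul_le_mul_left _ (by lia)) fun _ h => h
  · have := h.var_five
    have := h.le
    simp only [Expr.Ok]
    lia
  · simp only [Expr.val, h.var_five] at hlt
    obtain ⟨j, rfl⟩ : ∃ j', j = j' + 1 := ⟨j - 1, by lia⟩
    exact ⟨j, rfl, h.body hL hR hO hrT⟩
  · simp only [Expr.val, h.var_five] at hlt
    obtain rfl : j = 0 := by lia
    refine ⟨h.table.isBottomUp fun v hv => List.mem_toFinset.2 ((hO.mem_iff v).2 hv),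
      h.top.isTopDown fun v hv => ?_⟩
    rw [List.drop_zero]
    exact List.mem_toFinset.2 ((hO.mem_iff v).2 hv)

end

end TreeFlow

/-! ### Assembly, time and size bounds -/

namespace TreeFlow

open RAM Cmd Expr

/-- The algorithm on instances with terminals. -/
def solveRooted : Cmd :=
  seq countEdges (seq findLeaves (seq peel topDown))

/-- The algorithm. -/
def solve : Cmd :=
  seq findRoot (ite (const 0) (var 1) solveRooted skip)

/-- The coefficient of `n` in the bound for the running time. -/
def slope : ℕ :=
  (3 + rootBody.time) + (5 + edgeBody.time) + (3 + leafBody.time) +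
    (3 + (peelLoad.time + (peelStore.time + peelRemove.time))) +
    (3 + (topLoad.time + (topFlow.time + (topLabel.time + (topMode.time + topStore.time)))))

/-- The constant of the algorithm. -/
def bound : ℕ := 20 + topInit.time + 2 * slope

section

variable {n : ℕ} {r : Fin n} {par : Fin n → Fin n} {ix cv : Fin n → ℕ} {T : Finset (Fin n)}
  {M Z S B : ℕ} {G : SimpleGraph (Fin n)} {depth : Fin n → ℕ}

theorem solveRooted_runs (hL : IsLayout r ix cv M Z S B) (hR : IsRooting G r par depth)
    (hrT : r ∈ T) {s₀ : State} (h0 : s₀.var 0 = n) (h1 : s₀.var 1 = r.val + 1)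
    (hends : ∀ v, v ≠ r → (s₀.arr 0 (ix v) = v.val ∧ s₀.arr 1 (ix v) = (par v).val) ∨
      (s₀.arr 0 (ix v) = (par v).val ∧ s₀.arr 1 (ix v) = v.val))
    (hcap : ∀ v, v ≠ r → s₀.arr 2 (ix v) = cv v)
    (hterm : ∀ v : Fin n, s₀.arr 3 v.val = if v ∈ T then 1 else 0)
    (hzero : ∀ a, 6 ≤ a → ∀ j, s₀.arr a j = 0) :
    Runs S B solveRooted s₀
      (4 + (3 + (2 + (5 + edgeBody.time) * n)) +
        (2 + (2 + ((3 + leafBody.time) * (n + 1) + 2)) +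
          ((3 + (peelLoad.time + (peelStore.time + peelRemove.time))) * (n + 1) +
            (topInit.time + (3 + (topLoad.time + (topFlow.time + (topLabel.time +
              (topMode.time + topStore.time))))) * (n + 1)))))
      fun s => IsBottomUp r par T (stateTables r ix cv s) ∧
        IsTopDown r par T (stateTables r ix cv s) :=
  (countEdges_runs hL hR h0 h1 hends hcap hterm hzero).seq fun _ hs =>
    (findLeaves_runs hL hs).seq fun _ ⟨⟨_, hq⟩, hz⟩ =>
      (peel_runs hL hR hq (tableInv_empty hz)).seq fun _ ⟨_, hq, ht⟩ =>
        topDown_runs hL hR hrT hq ht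

end

theorem time_le {n : ℕ} (hn : 1 ≤ n) : 2 + (3 + rootBody.time) * (n + 1) + (3 +
      (4 + (3 + (2 + (5 + edgeBody.time) * n)) +
        (2 + (2 + ((3 + leafBody.time) * (n + 1) + 2)) +
          ((3 + (peelLoad.time + (peelStore.time + peelRemove.time))) * (n + 1) +
            (topInit.time + (3 + (topLoad.time + (topFlow.time + (topLabel.time +
              (topMode.time + topStore.time))))) * (n + 1)))))) ≤ bound * n := by
  -- The loops cost `slope * (n + 1)` at most; one copy of `slope` in `bound` covers `n`, the other
  -- covers the extra `1`.
  have h1 : bound * n = (20 + topInit.time + slope) * n + slope * n := by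
    unfold bound
    ring
  have h2 : 20 + topInit.time + slope ≤ (20 + topInit.time + slope) * n :=
    Nat.le_mul_of_pos_right _ hn
  rw [h1]
  refine le_trans ?_ (Nat.add_le_add_right h2 _)
  unfold slope
  generalize topLoad.time + (topFlow.time + (topLabel.time + (topMode.time + topStore.time))) = x
  generalize peelLoad.time + (peelStore.time + peelRemove.time) = y
  generalize rootBody.time = z
  generalize leafBody.time = w
  generalize edgeBody.time = e
  ring_nf
  lia

/-- The index of the edge `e` in the list `L`. -/
def edgeIndex {V : Type*} [DecidableEq V] (L : List (V × V)) (e : Sym2 V) : ℕ :=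
  (L.map fun p => s(p.1, p.2)).idxOf e

section

variable {V : Type*} [DecidableEq V] {L : List (V × V)}

theorem edgeIndex_of_getElem {G : SimpleGraph V} (hL : IsEdgeList G L) {i : ℕ} {p : V × V}
    (h : L[i]? = some p) : edgeIndex L s(p.1, p.2) = i := by
  obtain ⟨hi, rfl⟩ := List.getElem?_eq_some_iff.1 h
  have h1 : i < (L.map fun p => s(p.1, p.2)).length := by simpa using hi
  have h2 := hL.1.idxOf_getElem i h1
  simpa [edgeIndex] using h2

theorem exists_getElem_edgeIndex {G : SimpleGraph V} (hL : IsEdgeList G L) {e : Sym2 V}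
    (he : e ∈ G.edgeSet) : ∃ p, L[edgeIndex L e]? = some p ∧ s(p.1, p.2) = e := by
  obtain ⟨p, hp, hpe⟩ := List.mem_map.1 ((hL.2 e).2 he)
  obtain ⟨i, hi, rfl⟩ := List.getElem_of_mem hp
  have h := List.getElem?_eq_getElem hi
  have h1 := edgeIndex_of_getElem hL h
  refine ⟨L[i], ?_, hpe⟩
  rw [hpe] at h1
  rw [h1, h]

theorem _root_.IsEdgeList.length_add_one [Fintype V] {G : SimpleGraph V} (hL : IsEdgeList G L)
    (hG : G.IsTree) : L.length + 1 = Fintype.card V := by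
  classical
  rw [← hG.card_edgeFinset, ← List.length_map (f := fun p : V × V => s(p.1, p.2)),
    ← List.toFinset_card_of_nodup hL.1]
  congr 2
  ext e
  rw [List.mem_toFinset, hL.2, SimpleGraph.mem_edgeFinset]

end

section

variable {n : ℕ} {r : Fin n} {par : Fin n → Fin n} {T : Finset (Fin n)}
  {M : ℕ} {G : SimpleGraph (Fin n)} {depth : Fin n → ℕ} {c : Sym2 (Fin n) → ℕ}
  {L : List (Fin n × Fin n)}

theorem le_bound : 6 ≤ bound := by
  unfold bound
  lia

/-- The base is at least `2`, so its fourth power absorbs the factor `16`, and the exponent `6` is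
below `bound`. -/
theorem bound_pow_le : 16 * (n + M + 2) ^ 2 ≤ (n + M + 2) ^ bound := by
  have h1 : (2 : ℕ) ^ 4 ≤ (n + M + 2) ^ 4 := Nat.pow_le_pow_left (by lia) 4
  calc 16 * (n + M + 2) ^ 2 ≤ (n + M + 2) ^ 4 * (n + M + 2) ^ 2 := Nat.mul_le_mul_right _ h1
    _ = (n + M + 2) ^ 6 := by ring
    _ ≤ (n + M + 2) ^ bound := Nat.pow_le_pow_right (by lia) le_bound

theorem sq_add_two : (n + M + 2) ^ 2 =
      (n * n + n) + n * M + (n + M + 2) + (n * M + M * M + 2 * n + 3 * M + 2) := by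
  ring

theorem isLayout (hG : G.IsTree) (hL : IsEdgeList G L) (hR : IsRooting G r par depth)
    (hM : ∀ e ∈ G.edgeSet, c e ≤ M) :
    IsLayout r (fun v => edgeIndex L s(v, par v)) (fun v => c s(v, par v)) M ((n + M + 2) ^ 2)
      (bound * n) ((n + M + 2) ^ bound) := by
  have hlen := hL.length_add_one hG
  rw [Fintype.card_fin] at hlen
  have hmem : ∀ v, v ≠ r → s(v, par v) ∈ G.edgeSet := fun v hv => hR.adj_par v hv
  have hsq := sq_add_two (n := n) (M := M)
  refine ⟨?_, bound_pow_le, by lia, by lia, by lia, fun v hv => ?_,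
    fun u v hu hv huv => ?_, fun i hi => ?_, fun v hv => hM _ (hmem v hv)⟩
  · exact Nat.le_mul_of_pos_left _ (by have := le_bound; lia)
  · obtain ⟨p, hp, -⟩ := exists_getElem_edgeIndex hL (hmem v hv)
    have := (List.getElem?_eq_some_iff.1 hp).1
    lia
  · obtain ⟨p, hp, hpu⟩ := exists_getElem_edgeIndex hL (hmem u hu)
    obtain ⟨q, hq, hqv⟩ := exists_getElem_edgeIndex hL (hmem v hv)
    rw [huv, hq, Option.some_inj] at hp
    refine hR.edge_injOn hu hv ?_
    exact hpu.symm.trans (hp ▸ hqv)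
  · have hi' : i < L.length := by lia
    have h := List.getElem?_eq_getElem hi'
    obtain ⟨v, hv, he⟩ := hR.mem_edgeSet_iff.1 ((hL.2 s(L[i].1, L[i].2)).1
      (List.mem_map.2 ⟨L[i], List.getElem_mem hi', rfl⟩))
    refine ⟨v, hv, ?_⟩
    simp only [he]
    exact edgeIndex_of_getElem hL h

theorem inputState_term (T : Finset (Fin n)) (c : Sym2 (Fin n) → ℕ) (L : List (Fin n × Fin n))
    (v : Fin n) : (inputState T c L).arr 3 v.val = if v ∈ T then 1 else 0 := by
  simp [inputState, Fin.val_inj]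

theorem inputState_zero (T : Finset (Fin n)) (c : Sym2 (Fin n) → ℕ) (L : List (Fin n × Fin n))
    {a : ℕ} (ha : 4 ≤ a) (j : ℕ) : (inputState T c L).arr a j = 0 := by
  obtain ⟨a, rfl⟩ := Nat.exists_eq_add_of_le' ha
  rfl

/-- Without terminals the blank arrays encode the zero flow and the empty cut-system. The value of
the latter is at most zero, and weak duality gives the converse. -/
theorem solve_of_empty (L : List (Fin n × Fin n)) {s : State}
    (hs : s.arr = (inputState ∅ c L).arr) :
    IsOutput ∅ L s 0 (fun _ => ∅) ∧ IsFeasibleFlow G ∅ c 0 ∧ IsCutSystem G ∅ (fun _ => ∅) ∧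
      flowValue G ∅ 0 = cutSystemValue G ∅ c fun _ => ∅ := by
  have hf : IsFeasibleFlow G ∅ c 0 := ⟨⟨0, by simp⟩, by simp⟩
  have hX : IsCutSystem G ∅ (fun _ => ∅) := ⟨by simp, by simp⟩
  refine ⟨⟨fun i p _ => ?_, by simp, fun v _ => ?_⟩, hf, hX,
    (flowValue_le_cutSystemValue hf hX).antisymm ?_⟩
  · rw [hs, inputState_zero _ _ _ le_rfl]
    rfl
  · rw [hs, inputState_zero _ _ _ (by lia)]
  · simp only [flowValue, cutSystemValue, cutSystemGamma, Finset.sum_empty]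
    have : (0 : ℚ) ≤ cutSystemKappa G ∅ c fun _ => ∅ := Nat.cast_nonneg _
    push_cast
    linarith

theorem solve_of_isTopDown (hG : G.IsTree) (hL : IsEdgeList G L) (hR : IsRooting G r par depth)
    (hrT : r ∈ T) (hc : ∀ e ∈ G.edgeSet, 1 ≤ c e) {s : State} {D : Tables n}
    (hD : D = stateTables r (fun v => edgeIndex L s(v, par v)) (fun v => c s(v, par v)) s)
    (hB : IsBottomUp r par T D) (hT : IsTopDown r par T D) :
    IsOutput T L s (fun e => s.arr 4 (edgeIndex L e)) (labelSet D.lab) ∧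
      IsFeasibleFlow G T c (fun e => s.arr 4 (edgeIndex L e)) ∧ IsCutSystem G T (labelSet D.lab) ∧
      flowValue G T (fun e => s.arr 4 (edgeIndex L e)) = cutSystemValue G T c (labelSet D.lab) := by
  have hlab : ∀ v : Fin n, D.lab v = s.arr 5 v := fun v => by rw [hD]; rfl
  have hcv : ∀ v, v ≠ r → c s(v, par v) = D.c v := fun v _ => by rw [hD]; rfl
  have hk : ∀ v, v ≠ r → s.arr 4 (edgeIndex L s(v, par v)) = D.k v := fun v hv => by
    rw [hD]
    exact (if_neg hv).symm
  have h : IsSolved G r par depth T D := ⟨hR, hB, hT, hrT, fun v hv => by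
    rw [← hcv v hv]
    exact hc _ (hR.adj_par v hv)⟩
  refine ⟨⟨fun i p hp => ?_, fun t ht v hv => ?_, fun v hv => ?_⟩, h.isFeasibleFlow hG hcv hk,
    h.isCutSystem, h.flowValue_eq hG hcv hk⟩
  · simp only [edgeIndex_of_getElem hL hp]
  · rw [← hlab]
    exact hv
  · rw [← hlab]
    exact h.mem_uncovered.1 hv

theorem solve_runs (hG : G.IsTree) (hc : ∀ e ∈ G.edgeSet, 1 ≤ c e)
    (hM : ∀ e ∈ G.edgeSet, c e ≤ M) (hL : IsEdgeList G L) :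
    Runs (bound * n) ((n + M + 2) ^ bound) solve (inputState T c L) (bound * n) fun s =>
      ∃ f X, IsOutput T L s f X ∧ IsFeasibleFlow G T c f ∧ IsCutSystem G T X ∧
        flowValue G T f = cutSystemValue G T c X := by
  have hn : 1 ≤ n := by
    obtain ⟨v⟩ := hG.connected.nonempty
    exact v.pos
  have hS : n ≤ bound * n := Nat.le_mul_of_pos_left _ (by have := le_bound; lia)
  have hB : n + 2 ≤ (n + M + 2) ^ bound := by
    have := bound_pow_le (n := n) (M := M)
    have := sq_add_two (n := n) (M := M)
    lia
  refine Runs.mono ((findRoot_runs hS hB rfl rfl (inputState_term T c L)).seq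
    fun s ⟨harr, h0, h1⟩ => ?_) (time_le hn) fun _ h => h
  rcases h1 with ⟨h1, rfl⟩ | ⟨r, hrT, h1⟩
  · refine Runs.ite (p := const 0) (q := var 1) ?_ ?_ (fun h => ?_)
      fun _ => ⟨1, s, .skip, by lia, 0, fun _ => ∅, solve_of_empty L harr⟩
    · simp only [Expr.Ok]
      lia
    · simp only [Expr.Ok]
      lia
    · simp only [Expr.val] at h
      lia
  · obtain ⟨par, depth, hR⟩ := hG.exists_isRooting r
    refine Runs.ite (p := const 0) (q := var 1) ?_ ?_ (fun _ => ?_) (fun h => ?_)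
    · simp only [Expr.Ok]
      lia
    · have := r.isLt
      simp only [Expr.Ok]
      lia
    · refine (solveRooted_runs (isLayout hG hL hR hM) hR hrT h0 h1 (fun v hv => ?_)
        (fun v hv => ?_) (by rw [harr]; exact inputState_term T c L)
        (by rw [harr]; exact fun a ha j => inputState_zero T c L (by lia) j)).mono le_rfl
        fun s hs => ⟨_, _, solve_of_isTopDown hG hL hR hrT hc rfl hs.1 hs.2⟩
      · obtain ⟨p, hp, he⟩ := exists_getElem_edgeIndex hL
          (show s(v, par v) ∈ G.edgeSet from hR.adj_par v hv)
        rw [harr]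
        simp only [inputState, hp]
        rcases Sym2.eq_iff.1 he with ⟨e1, e2⟩ | ⟨e1, e2⟩
        · exact Or.inl (by simp [e1, e2])
        · exact Or.inr (by simp [e1, e2])
      · obtain ⟨p, hp, he⟩ := exists_getElem_edgeIndex hL
          (show s(v, par v) ∈ G.edgeSet from hR.adj_par v hv)
        rw [harr]
        simp only [inputState, hp]
        simp [he]
    · simp only [Expr.val] at h
      lia

end

end TreeFlow

theorem mainTheorem1 :
    ∃ (program : RAM.Cmd) (K : ℕ),
      ∀ (n : ℕ) (G : SimpleGraph (Fin n)) (T : Finset (Fin n)) (c : Sym2 (Fin n) → ℕ)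
        (M : ℕ) (L : List (Fin n × Fin n)),
        G.IsTree → (∀ e ∈ G.edgeSet, 1 ≤ c e) → (∀ e ∈ G.edgeSet, c e ≤ M) → IsEdgeList G L →
        ∃ (time : ℕ) (s : RAM.State) (f : Sym2 (Fin n) → ℕ) (X : Fin n → Set (Fin n)),
          RAM.Exec (K * n) ((n + M + 2) ^ K) program (inputState T c L) time s ∧
          time ≤ K * n ∧
          IsOutput T L s f X ∧
          IsFeasibleFlow G T c f ∧
          IsCutSystem G T X ∧
          flowValue G T f = cutSystemValue G T c X ∧
          IsMaximumFlow G T c f ∧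
          IsMinimumCutSystem G T c X := by
  refine ⟨TreeFlow.solve, TreeFlow.bound, fun n G T c M L hG hc hM hL => ?_⟩
  obtain ⟨time, s, h1, h2, f, X, h3, h4, h5, h6⟩ := TreeFlow.solve_runs (T := T) hG hc hM hL
  obtain ⟨h7, h8⟩ := isMaximumFlow_and_isMinimumCutSystem h4 h5 h6
  exact ⟨time, s, f, X, h1, h2, h3, h4, h5, h6, h7, h8⟩
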